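/- Let $R$ be a discrete valuation ring and let $\mathcal X$ be a flat $R$-scheme. Let $\mathcal X^\dagger=(\mathcal X,\mathcal M_{\mathcal X})$ be the Zariski log scheme with the divisorial log structure of the special fibre, $\mathcal M_{\mathcal X}=\mathcal O_{\mathcal X}\cap j_*\mathcal O_{\mathcal X_\eta}^\times$, where $j:\mathcal X_\eta\to\mathcal X$ is the generic fibre. Write $\mathcal M^\sharp=\mathcal M/\mathcal O^\times$, and for $x\in\mathcal X$ let $I(x)\subseteq\mathcal O_{\mathcal X,x}$ be the ideal generated by $\mathcal M_{\mathcal X,x}\setminus\mathcal O_{\mathcal X,x}^\times$. Assume that $\mathcal X^\dagger$ is log regular: it is fs, and for every $x$ the ring $\mathcal O_{\mathcal X,x}/I(x)$ is a regular local ring with $\dim\mathcal O_{\mathcal X,x}=\dim\mathcal O_{\mathcal X,x}/I(x)+\operatorname{rank}_{\mathbf Z}(\mathcal M^\sharp_{\mathcal X,x})^{\mathrm{gp}}$. Let $F(\mathcal X)=\{x\in\mathcal X : I(x)=\mathfrak m_x\}$ be the fan of $\mathcal X^\dagger$, with the subspace topology and the restriction of $\mathcal M^\sharp_{\mathcal X}$,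 and let $\pi:(\mathcal X,\mathcal M_{\mathcal X}^\sharp)\to F(\mathcal X)$ be the characteristic morphism, which maps $x$ to the point corresponding to the prime ideal $I(x)$ of $\mathcal O_{\mathcal X,x}$. For $y\in F(\mathcal X)$ put $U(y)=\pi^{-1}(y)$. The height $h$ of a point of a fan is the dimension of the stalk of the structure sheaf of monoids at that point. Let $\varphi:F'\to F(\mathcal X)$ be a subdivision, i.e. a morphism of monoidal spaces such that $F'$ is an fs fan (locally isomorphic to the fan $\operatorname{Spec}P$ of an fs monoid $P$), the map $\mathcal M_{F(\mathcal X),\varphi(t)}^{\mathrm{gp}}\to\mathcal M_{F',t}^{\mathrm{gp}}$ is surjective for every $t\in F'$, and $\operatorname{Mor}(\operatorname{Spec}\mathbf N,F')\to\operatorname{Mor}(\operatorname{Spec}\mathbf N,F(\mathcal X))$ is injective. Let $\mathrm{Bl}_\varphi:\varphi^\star\mathcal X\to\mathcal X^\dagger$ be the log blow-up along $\varphi$, i.e. the final object among the fs log schemes $T$ equipped with a morphism $f:T\to\mathcal X^\dagger$ and a morphism of monoidal spaces $g:(T,\mathcal M_T^\sharp)\to F'$ such that $\varphi\circ g=\pi\circ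 f$; let $\rho:(\varphi^\star\mathcal X,\mathcal M^\sharp)\to F'$ be its structural morphism, and for $x'\in F'$ put $U(x')=\rho^{-1}(x')$. Let $x'\in F'$ and let $x\in\mathcal X$ be a point of $U(\varphi(x'))$, i.e. $\pi(x)=\varphi(x')$. Then $U(x')$ is locally closed in $\varphi^\star\mathcal X$, the heights $h(x')\le h(\varphi(x'))$ are finite, and, if $U(x')$ is given its reduced scheme structure, its scheme-theoretic intersection with the fibre $\mathrm{Bl}_\varphi^{-1}(x)$ (that is, the fibre over $x$ of $U(x')\to\mathcal X$) is isomorphic, as a $\kappa(x)$-scheme, to the split torus $$U(x')\cap\mathrm{Bl}_\varphi^{-1}(x)\;\cong\;\mathbf G_{m,\kappa(x)}^{\,h(\varphi(x'))-h(x')}.$$ -/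

import Mathlib

open AlgebraicGeometry CategoryTheory TopologicalSpace

universe u v w

namespace LogGeom

/-! ### Monoids -/

section Monoids

/-- A face of a commutative monoid `P`: a submonoid `S` such that `a * b ∈ S` implies `a ∈ S` (and
hence `b ∈ S`).  Faces are exactly the complements of the prime ideals of `P`. -/
def Face (P : Type u) [CommMonoid P] : Type u :=
  {S : Submonoid P // ∀ a b : P, a * b ∈ S → a ∈ S}

instance (P : Type u) [CommMonoid P] : PartialOrder (Face P) :=
  inferInstanceAs (PartialOrder {S : Submonoid P // ∀ a b : P, a * b ∈ S → a ∈ S})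

/-- The dimension of a monoid: the supremum of the lengths of chains of prime ideals (equivalently,
of their complements, the faces). -/
noncomputable def monoidDim (P : Type u) [CommMonoid P] : WithBot ℕ∞ :=
  Order.krullDim (Face P)

/-- A fine and saturated (fs) monoid: cancellative, finitely generated, and saturated, i.e. if
`x = a / b` in the group envelope satisfies `x ^ n ∈ P` for some `n > 0`, then `x ∈ P`. -/
structure IsFsMonoid (P : Type u) [CommMonoid P] : Prop where
  cancel : IsCancelMul P
  fg : Monoid.FG P
  saturated : ∀ (a b c : P) (n : ℕ), n ≠ 0 → a ^ n = b ^ n * c → ∃ d, a = b * d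

/-- The rank of the group envelope of a commutative monoid. -/
noncomputable def gpRank (P : Type u) [CommMonoid P] : ℕ :=
  Module.finrank ℤ (Additive (Algebra.GrothendieckGroup P))

/-- The map of group envelopes induced by a homomorphism of commutative monoids. -/
noncomputable def gpMap {P : Type u} {Q : Type v} [CommMonoid P] [CommMonoid Q] (f : P →* Q) :
    Algebra.GrothendieckGroup P →* Algebra.GrothendieckGroup Q :=
  Algebra.GrothendieckGroup.lift ((Algebra.GrothendieckGroup.of (M := Q)).comp f)

/-- For a monoid homomorphism `f : P →* Q`, the induced homomorphism `P/Pˣ →* Q/Qˣ`.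
(`Associates P` is the quotient of `P` by its group of units.) -/
def sharpMap {P : Type u} {Q : Type v} [CommMonoid P] [CommMonoid Q] (f : P →* Q) :
    Associates P →* Associates Q where
  toFun := Quotient.map f fun _ _ h => h.map f
  map_one' := by
    change Associates.mk (f 1) = 1
    rw [map_one]; rfl
  map_mul' a b := by
    refine Quotient.inductionOn₂ a b fun x y => ?_
    change Associates.mk (f (x * y)) = Associates.mk (f x) * Associates.mk (f y)
    rw [map_mul, Associates.mk_mul_mk]

@[simp] theorem sharpMap_mk {P : Type u} {Q : Type v} [CommMonoid P] [CommMonoid Q] (f : P →* Q)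
    (a : P) : sharpMap f (Associates.mk a) = Associates.mk (f a) := rfl

/-- The congruence on `P` attached to a face `S`, whose quotient is the sharp localisation
`P_S / (P_S)ˣ`, where `P_S = S⁻¹P`. -/
def faceCon {P : Type u} [CommMonoid P] (S : Face P) : Con P where
  r a b := ∃ s ∈ S.1, ∃ t ∈ S.1, a * s = b * t
  iseqv :=
    { refl := fun a => ⟨1, S.1.one_mem, 1, S.1.one_mem, rfl⟩
      symm := fun ⟨s, hs, t, ht, h⟩ => ⟨t, ht, s, hs, h.symm⟩
      trans := by
        rintro a b c ⟨s, hs, t, ht, h⟩ ⟨s', hs', t', ht', h'⟩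
        refine ⟨s * s', S.1.mul_mem hs hs', t' * t, S.1.mul_mem ht' ht, ?_⟩
        rw [← mul_assoc, h, mul_right_comm, h', mul_assoc] }
  mul' := by
    rintro a b c d ⟨s, hs, t, ht, h⟩ ⟨s', hs', t', ht', h'⟩
    refine ⟨s * s', S.1.mul_mem hs hs', t * t', S.1.mul_mem ht ht', ?_⟩
    rw [mul_mul_mul_comm, h, h', mul_mul_mul_comm]

end Monoids

/-! ### Sheaves of monoids -/

/-- A sheaf of commutative monoids on a topological space, given by its stalks together with, for
every open `U`, the submonoid of those families of germs over `U` that are sections (the espace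
étalé description of a sheaf).  The axiom `locality` says that sections restrict and glue, i.e.
that being a section is a local property; every germ comes from a section near the point, and two
sections with the same germ at a point agree near it. -/
structure MonoidSheaf (X : Type u) [TopologicalSpace X] where
  stalk : X → Type v
  [stalkMonoid : ∀ x, CommMonoid (stalk x)]
  sections : ∀ U : Opens X, Submonoid (∀ x : U, stalk x)
  locality : ∀ (U : Opens X) (s : ∀ x : U, stalk x),
    (∀ x ∈ U, ∃ (V : Opens X) (_ : x ∈ V) (t : ∀ y : V, stalk y), t ∈ sections V ∧
      ∀ (y : X) (hU : y ∈ U) (hV : y ∈ V), s ⟨y, hU⟩ = t ⟨y, hV⟩) → s ∈ sections U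
  exists_germ : ∀ (x : X) (m : stalk x), ∃ (U : Opens X) (hx : x ∈ U) (s : ∀ y : U, stalk y),
    s ∈ sections U ∧ s ⟨x, hx⟩ = m
  germ_eq : ∀ (U V : Opens X) (s : ∀ y : U, stalk y) (t : ∀ y : V, stalk y),
    s ∈ sections U → t ∈ sections V → ∀ (x : X) (hU : x ∈ U) (hV : x ∈ V),
    s ⟨x, hU⟩ = t ⟨x, hV⟩ → ∃ W : Opens X, x ∈ W ∧
      ∀ (y : X) (hU : y ∈ U) (hV : y ∈ V), y ∈ W → s ⟨y, hU⟩ = t ⟨y, hV⟩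

attribute [instance] MonoidSheaf.stalkMonoid

namespace MonoidSheaf

/-- The sheaf of monoids with given stalks whose sections are the families of germs that locally
belong to a given collection of basic families. -/
def ofBase {X : Type u} [TopologicalSpace X] (stalk : X → Type v) [∀ x, CommMonoid (stalk x)]
    (IsBase : ∀ U : Opens X, (∀ x : U, stalk x) → Prop)
    (one : IsBase ⊤ 1)
    (mul : ∀ (U V : Opens X) (s : ∀ x : U, stalk x) (t : ∀ x : V, stalk x), IsBase U s →
      IsBase V t → IsBase (U ⊓ V) fun x => s ⟨x, x.2.1⟩ * t ⟨x, x.2.2⟩)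
    (exists_germ : ∀ (x : X) (m : stalk x), ∃ (U : Opens X) (hx : x ∈ U) (s : ∀ y : U, stalk y),
      IsBase U s ∧ s ⟨x, hx⟩ = m)
    (germ_eq : ∀ (U V : Opens X) (s : ∀ y : U, stalk y) (t : ∀ y : V, stalk y),
      IsBase U s → IsBase V t → ∀ (x : X) (hU : x ∈ U) (hV : x ∈ V),
      s ⟨x, hU⟩ = t ⟨x, hV⟩ → ∃ W : Opens X, x ∈ W ∧
        ∀ (y : X) (hU : y ∈ U) (hV : y ∈ V), y ∈ W → s ⟨y, hU⟩ = t ⟨y, hV⟩) :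
    MonoidSheaf.{u, v} X where
  stalk := stalk
  sections U :=
    { carrier := {s | ∀ x ∈ U, ∃ (W V : Opens X) (_ : x ∈ W) (_ : x ∈ V) (t : ∀ y : V, stalk y),
        IsBase V t ∧ ∀ (y : X) (hU : y ∈ U) (hV : y ∈ V), y ∈ W → s ⟨y, hU⟩ = t ⟨y, hV⟩}
      one_mem' := fun _ _ => ⟨⊤, ⊤, trivial, trivial, 1, one, fun _ _ _ _ => rfl⟩
      mul_mem' := by
        intro s s' hs hs' x hx
        obtain ⟨W, V, hW, hV, t, ht, e⟩ := hs x hx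
        obtain ⟨W', V', hW', hV', t', ht', e'⟩ := hs' x hx
        refine ⟨W ⊓ W', V ⊓ V', ⟨hW, hW'⟩, ⟨hV, hV'⟩, _, mul V V' t t' ht ht',
          fun y hU hy hyW => ?_⟩
        rw [Pi.mul_apply, e y hU hy.1 hyW.1, e' y hU hy.2 hyW.2] }
  locality U s h x hx := by
    obtain ⟨V, hV, t, ht, e⟩ := h x hx
    obtain ⟨W, A, hW, hA, r, hr, e'⟩ := ht x hV
    exact ⟨W ⊓ V, A, ⟨hW, hV⟩, hA, r, hr,
      fun y hU hyA hy => (e y hU hy.2).trans (e' y hy.2 hyA hy.1)⟩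
  exists_germ x m := by
    obtain ⟨U, hx, s, hs, e⟩ := exists_germ x m
    exact ⟨U, hx, s, fun y hy => ⟨⊤, U, trivial, hy, s, hs, fun _ _ _ _ => rfl⟩, e⟩
  germ_eq U V s t hs ht x hU hV e := by
    obtain ⟨A', A, hA', hA, a, ha, ea⟩ := hs x hU
    obtain ⟨B', B, hB', hB, b, hb, eb⟩ := ht x hV
    obtain ⟨W, hW, h⟩ := germ_eq A B a b ha hb x hA hB
      (by rw [← ea x hU hA hA', ← eb x hV hB hB', e])
    refine ⟨W ⊓ ((A ⊓ B) ⊓ (A' ⊓ B')), ⟨hW, ⟨hA, hB⟩, hA', hB'⟩, fun y yU yV hy => ?_⟩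
    rw [ea y yU hy.2.1.1 hy.2.2.1, eb y yV hy.2.1.2 hy.2.2.2, h y _ _ hy.1]

/-- The inverse image `f⁻¹M` of a sheaf of monoids under a continuous map: the stalk at `x` is
the stalk of `M` at `f x`, and the sections are the families that are locally pulled back from
sections of `M`. -/
def pullback {X : Type u} {Y : Type w} [TopologicalSpace X] [TopologicalSpace Y]
    (f : C(X, Y)) (M : MonoidSheaf.{w, v} Y) : MonoidSheaf.{u, v} X :=
  ofBase (fun x => M.stalk (f x))
    (fun U s => ∃ (V : Opens Y) (hV : ∀ x ∈ U, f x ∈ V) (t : ∀ y : V, M.stalk y),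
      t ∈ M.sections V ∧ ∀ x : U, s x = t ⟨f x, hV x x.2⟩)
    ⟨⊤, fun _ _ => trivial, 1, (M.sections ⊤).one_mem, fun _ => rfl⟩
    (by
      rintro U V s t ⟨A, hA, a, ha, ea⟩ ⟨B, hB, b, hb, eb⟩
      refine ⟨A ⊓ B, fun x hx => ⟨hA x hx.1, hB x hx.2⟩,
        (fun y : ↥(A ⊓ B) => a ⟨y, y.2.1⟩) * (fun y : ↥(A ⊓ B) => b ⟨y, y.2.2⟩),
        Submonoid.mul_mem _ ?_ ?_, ?_⟩
      · exact M.locality _ _ fun x hx => ⟨A, hx.1, a, ha, fun _ _ _ => rfl⟩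
      · exact M.locality _ _ fun x hx => ⟨B, hx.2, b, hb, fun _ _ _ => rfl⟩
      · intro x
        simp only [Pi.mul_apply, ea, eb])
    (by
      intro x m
      obtain ⟨V, hV, t, ht, e⟩ := M.exists_germ (f x) m
      exact ⟨V.comap f, hV, fun y => t ⟨f y, y.2⟩, ⟨V, fun _ h => h, t, ht, fun _ => rfl⟩, e⟩)
    (by
      rintro U V s t ⟨A, hA, a, ha, ea⟩ ⟨B, hB, b, hb, eb⟩ x hU hV e
      obtain ⟨W, hW, h⟩ := M.germ_eq A B a b ha hb (f x) (hA x hU) (hB x hV)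
        (by rw [← ea ⟨x, hU⟩, ← eb ⟨x, hV⟩, e])
      exact ⟨W.comap f, hW, fun y yU yV hy => by rw [ea, eb]; exact h _ _ _ hy⟩)

/-- The sheaf `M^♯ = M/M^×`: its stalks are the quotients of the stalks of `M` by their units, and
its sections are the families that are locally induced by sections of `M`. -/
def sharp {X : Type u} [TopologicalSpace X] (M : MonoidSheaf.{u, v} X) : MonoidSheaf.{u, v} X :=
  ofBase (fun x => Associates (M.stalk x))
    (fun U s => ∃ t ∈ M.sections U, ∀ x : U, s x = Associates.mk (t x))
    ⟨1, (M.sections ⊤).one_mem, fun _ => rfl⟩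
    (by
      rintro U V s t ⟨a, ha, ea⟩ ⟨b, hb, eb⟩
      refine ⟨(fun y : ↥(U ⊓ V) => a ⟨y, y.2.1⟩) * (fun y : ↥(U ⊓ V) => b ⟨y, y.2.2⟩),
        Submonoid.mul_mem _ ?_ ?_, ?_⟩
      · exact M.locality _ _ fun x hx => ⟨U, hx.1, a, ha, fun _ _ _ => rfl⟩
      · exact M.locality _ _ fun x hx => ⟨V, hx.2, b, hb, fun _ _ _ => rfl⟩
      · intro x
        simp only [Pi.mul_apply, ea, eb, Associates.mk_mul_mk])
    (by
      intro x m
      obtain ⟨m, rfl⟩ := Associates.mk_surjective m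
      obtain ⟨V, hV, t, ht, e⟩ := M.exists_germ x m
      exact ⟨V, hV, fun y => Associates.mk (t y), ⟨t, ht, fun _ => rfl⟩, congrArg _ e⟩)
    (by
      rintro U V s t ⟨a, ha, ea⟩ ⟨b, hb, eb⟩ x hU hV e
      rw [ea, eb, Associates.mk_eq_mk_iff_associated] at e
      obtain ⟨c, hc⟩ := e
      obtain ⟨A, hA, p, hp, ep⟩ := M.exists_germ x (c : M.stalk x)
      obtain ⟨B, hB, q, hq, eq⟩ := M.exists_germ x ((c⁻¹ : (M.stalk x)ˣ) : M.stalk x)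
      -- products of sections, restricted to the intersections of their domains
      have key : ∀ (C D : Opens X) (c' : ∀ y : C, M.stalk y) (d' : ∀ y : D, M.stalk y),
          c' ∈ M.sections C → d' ∈ M.sections D →
          (fun y : ↥(C ⊓ D) => c' ⟨y, y.2.1⟩ * d' ⟨y, y.2.2⟩) ∈ M.sections (C ⊓ D) := by
        intro C D c' d' hc' hd'
        refine Submonoid.mul_mem (M.sections (C ⊓ D)) (x := fun y => c' ⟨y, y.2.1⟩)
          (y := fun y => d' ⟨y, y.2.2⟩) ?_ ?_
        · exact M.locality _ _ fun x hx => ⟨C, hx.1, c', hc', fun _ _ _ => rfl⟩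
        · exact M.locality _ _ fun x hx => ⟨D, hx.2, d', hd', fun _ _ _ => rfl⟩
      obtain ⟨W₁, hW₁, h₁⟩ := M.germ_eq (A ⊓ B) ⊤ _ 1 (key A B p q hp hq) (M.sections ⊤).one_mem x
        ⟨hA, hB⟩ trivial (by simp [ep, eq])
      obtain ⟨W₂, hW₂, h₂⟩ := M.germ_eq (U ⊓ A) V _ b (key U A a p ha hp) hb x ⟨hU, hA⟩ hV
        (by simpa [ep] using hc)
      refine ⟨(W₁ ⊓ W₂) ⊓ (A ⊓ B), ⟨⟨hW₁, hW₂⟩, hA, hB⟩, fun y yU yV hy => ?_⟩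
      rw [ea, eb, Associates.mk_eq_mk_iff_associated]
      have hu := h₁ y ⟨hy.2.1, hy.2.2⟩ trivial hy.1.1
      exact ⟨Units.mkOfMulEqOne _ _ hu, h₂ y ⟨yU, hy.2.1⟩ yV hy.1.2⟩)

end MonoidSheaf

/-! ### Monoidal spaces and fans -/

/-- A monoidal space: a topological space with a sheaf of commutative monoids. -/
structure MonoidalSpace where
  carrier : Type u
  [top : TopologicalSpace carrier]
  sheaf : MonoidSheaf.{u, u} carrier

namespace MonoidalSpace

instance : CoeSort MonoidalSpace.{u} (Type u) := ⟨carrier⟩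

instance (X : MonoidalSpace.{u}) : TopologicalSpace X := X.top

/-- The stalk of the structure sheaf of a monoidal space. -/
abbrev stalk (X : MonoidalSpace.{u}) (x : X) : Type u := X.sheaf.stalk x

/-- A morphism of monoidal spaces: a continuous map `f : X → Y` with a homomorphism of sheaves of
monoids `f⁻¹M_Y → M_X` that is local on the stalks. -/
@[ext]
structure Hom (X : MonoidalSpace.{u}) (Y : MonoidalSpace.{v}) where
  toFun : X → Y
  continuous : Continuous toFun
  stalkMap : ∀ x, Y.stalk (toFun x) →* X.stalk x
  isLocal : ∀ x m, IsUnit (stalkMap x m) → IsUnit m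
  map_sections : ∀ (V : Opens Y), ∀ s ∈ Y.sheaf.sections V,
    (fun x : V.comap ⟨toFun, continuous⟩ => stalkMap x (s ⟨toFun x, x.2⟩)) ∈
      X.sheaf.sections (V.comap ⟨toFun, continuous⟩)

instance (X : MonoidalSpace.{u}) (Y : MonoidalSpace.{v}) :
    CoeFun (Hom X Y) fun _ => X → Y := ⟨Hom.toFun⟩

/-- Composition of morphisms of monoidal spaces (`f.comp g` is `f` after `g`). -/
def Hom.comp {X : MonoidalSpace.{u}} {Y : MonoidalSpace.{v}} {Z : MonoidalSpace.{w}}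
    (f : Hom Y Z) (g : Hom X Y) : Hom X Z where
  toFun x := f (g x)
  continuous := f.continuous.comp g.continuous
  stalkMap x := (g.stalkMap x).comp (f.stalkMap (g x))
  isLocal _ _ h := f.isLocal _ _ (g.isLocal _ _ h)
  map_sections V s hs := g.map_sections _ _ (f.map_sections V s hs)

/-- An isomorphism of monoidal spaces: a homeomorphism that is bijective on all stalks. -/
structure Hom.IsIso {X : MonoidalSpace.{u}} {Y : MonoidalSpace.{v}} (f : Hom X Y) : Prop where
  isHomeomorph : IsHomeomorph f
  bijective : ∀ x, Function.Bijective (f.stalkMap x)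

/-- The monoidal space induced on a subset: the subspace topology and the restricted sheaf. -/
def restrict (X : MonoidalSpace.{u}) (Z : Set X) : MonoidalSpace.{u} where
  carrier := Z
  sheaf := X.sheaf.pullback ⟨Subtype.val, continuous_subtype_val⟩

end MonoidalSpace

/-- The topology on the set of faces (prime ideals) of `P`, with the sets
`D(a) = {S | a ∈ S}` as a basis. -/
instance (P : Type u) [CommMonoid P] : TopologicalSpace (Face P) :=
  TopologicalSpace.generateFrom {D | ∃ a : P, D = {S : Face P | a ∈ S.1}}

/-- The affine fan `Spec P` of a commutative monoid: the space of prime ideals of `P`, here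
represented by their complementary faces `S`, with the sheaf of monoids with stalks
`P_S / (P_S)ˣ`, whose sections are locally given by elements of `P`. -/
def specFan (P : Type u) [CommMonoid P] : MonoidalSpace.{u} where
  carrier := Face P
  sheaf := MonoidSheaf.ofBase (fun S : Face P => (faceCon S).Quotient)
    (fun U s => ∃ p : P, ∀ S : U, s S = (p : (faceCon S.1).Quotient))
    ⟨1, fun _ => rfl⟩
    (by
      rintro U V s t ⟨p, hp⟩ ⟨q, hq⟩
      exact ⟨p * q, fun S => congrArg₂ (· * ·) (hp ⟨S.1, S.2.1⟩) (hq ⟨S.1, S.2.2⟩)⟩)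
    (by
      intro S m
      obtain ⟨p, rfl⟩ := Con.mk'_surjective m
      exact ⟨⊤, trivial, fun _ => (p : (faceCon _).Quotient), ⟨p, fun _ => rfl⟩, rfl⟩)
    (by
      rintro U V s t ⟨p, hp⟩ ⟨q, hq⟩ S hU hV e
      rw [hp, hq] at e
      obtain ⟨a, ha, b, hb, h⟩ := (Con.eq _).1 e
      let D (c : P) : Opens (Face P) := ⟨{T : Face P | c ∈ T.1},
        TopologicalSpace.isOpen_generateFrom_of_mem ⟨c, rfl⟩⟩
      refine ⟨D a ⊓ D b, ⟨ha, hb⟩, fun T hU hV hT => ?_⟩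
      rw [hp, hq]
      exact (Con.eq _).2 ⟨a, hT.1, b, hT.2, h⟩)

/-- An fs fan: a monoidal space that is locally isomorphic to `Spec P` for fs monoids `P`. -/
def IsFsFan (F : MonoidalSpace.{u}) : Prop :=
  ∀ t : F, ∃ U : Opens F, t ∈ U ∧ ∃ (P : Type u) (_ : CommMonoid P), IsFsMonoid P ∧
    ∃ f : MonoidalSpace.Hom (F.restrict (U : Set F)) (specFan P), f.IsIso

/-- The height of a point of a fan: the dimension of the stalk at that point. -/
noncomputable def height (F : MonoidalSpace.{u}) (t : F) : WithBot ℕ∞ :=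
  monoidDim (F.stalk t)

/-- Subdivisions `φ : F' → F` of a fan `F` (not necessarily proper): `F'` is an fs fan, the maps
on the group envelopes of the stalks are surjective, and
`Mor(Spec ℕ, F') → Mor(Spec ℕ, F)` is injective. -/
structure IsSubdivision {F' F : MonoidalSpace.{u}} (φ : MonoidalSpace.Hom F' F) : Prop where
  isFsFan : IsFsFan F'
  gp_surjective : ∀ t : F', Function.Surjective (gpMap (φ.stalkMap t))
  injective : Function.Injective
    fun h : MonoidalSpace.Hom (specFan (Multiplicative ℕ)) F' => φ.comp h

/-! ### Log schemes -/

/-- A (Zariski) log scheme: a scheme `X` with a sheaf of monoids `M` and a homomorphism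
`α : M → 𝒪_X` of sheaves of monoids (given on stalks, and mapping sections to sections) that
induces an isomorphism `α⁻¹(𝒪_X^×) → 𝒪_X^×`. -/
structure LogScheme where
  X : Scheme.{u}
  M : MonoidSheaf.{u, u} X
  α : ∀ x, M.stalk x →* X.presheaf.stalk x
  α_sections : ∀ (U : X.Opens), ∀ s ∈ M.sections U, ∀ x ∈ U,
    ∃ (V : X.Opens) (_ : x ∈ V) (f : Γ(X, V)), ∀ (y : X) (hU : y ∈ U) (hV : y ∈ V),
      α y (s ⟨y, hU⟩) = X.presheaf.germ V y hV f
  existsUnique_unit : ∀ x (a : (X.presheaf.stalk x)ˣ), ∃! m : M.stalk x, α x m = a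

namespace LogScheme

theorem isUnit_of_isUnit_α (X : LogScheme.{u}) {x : X.X} {m : X.M.stalk x}
    (h : IsUnit (X.α x m)) : IsUnit m := by
  obtain ⟨a, ha⟩ := h
  obtain ⟨n, hn, -⟩ := X.existsUnique_unit x a⁻¹
  obtain ⟨e, -, he⟩ := X.existsUnique_unit x 1
  have h1 : m * n = e := he _ (by simp [hn, ← ha])
  have h2 : 1 = e := he _ (by simp)
  exact IsUnit.of_mul_eq_one n (h1.trans h2.symm)

/-- A morphism of log schemes: a morphism of schemes `f : T → X` and a homomorphism of sheaves of
monoids `f⁻¹M_X → M_T` (given on stalks, and mapping sections to sections) compatible with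
`f⁻¹𝒪_X → 𝒪_T`. -/
@[ext]
structure Hom (T X : LogScheme.{u}) where
  base : T.X ⟶ X.X
  stalkMap : ∀ t, X.M.stalk (base t) →* T.M.stalk t
  map_sections : ∀ (V : X.X.Opens), ∀ s ∈ X.M.sections V,
    (fun t : ↥(base ⁻¹ᵁ V) => stalkMap t (s ⟨base t, t.2⟩)) ∈ T.M.sections (base ⁻¹ᵁ V)
  α_stalkMap : ∀ t m, T.α t (stalkMap t m) = base.stalkMap t (X.α (base t) m)

theorem Hom.isUnit_of_isUnit_stalkMap {T X : LogScheme.{u}} (f : Hom T X) {t : T.X}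
    {m : X.M.stalk (f.base t)} (h : IsUnit (f.stalkMap t m)) : IsUnit m := by
  apply X.isUnit_of_isUnit_α
  have h' := h.map (T.α t)
  rw [f.α_stalkMap] at h'
  exact isUnit_of_map_unit (f.base.stalkMap t).hom _ h'

/-- Composition of morphisms of log schemes (`f.comp g` is `f` after `g`). -/
def Hom.comp {S T X : LogScheme.{u}} (f : Hom T X) (g : Hom S T) : Hom S X where
  base := g.base ≫ f.base
  stalkMap s := (g.stalkMap s).comp (f.stalkMap (g.base s))
  map_sections V s hs := g.map_sections _ _ (f.map_sections V s hs)
  α_stalkMap s m := by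
    rw [Scheme.Hom.stalkMap_comp]
    exact (g.α_stalkMap s _).trans (congrArg _ (f.α_stalkMap (g.base s) m))

/-- The monoidal space `(X, M_X^♯)` of a log scheme, with `M_X^♯ = M_X/𝒪_X^×`. -/
abbrev sharp (X : LogScheme.{u}) : MonoidalSpace.{u} where
  carrier := X.X
  sheaf := X.M.sharp

/-- The morphism `(T, M_T^♯) → (X, M_X^♯)` induced by a morphism of log schemes. -/
def Hom.sharp {T X : LogScheme.{u}} (f : Hom T X) : MonoidalSpace.Hom T.sharp X.sharp where
  toFun t := f.base t
  continuous := f.base.continuous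
  stalkMap t := sharpMap (f.stalkMap t)
  isLocal t m h := by
    obtain ⟨m, rfl⟩ := Associates.mk_surjective m
    exact Associates.isUnit_mk.2 (f.isUnit_of_isUnit_stalkMap (Associates.isUnit_mk.1 h))
  map_sections V s hs t ht := by
    obtain ⟨W, A, hW, hA, r, ⟨p, hp, ep⟩, e⟩ := hs (f.base t) ht
    exact ⟨f.base ⁻¹ᵁ W, f.base ⁻¹ᵁ A, hW, hA,
      fun y => Associates.mk (f.stalkMap y (p ⟨f.base y, y.2⟩)),
      ⟨_, f.map_sections A p hp, fun _ => rfl⟩, fun y yU yA yW => by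
        have := (e (f.base y) yU yA yW).trans (ep _)
        exact congrArg (sharpMap (f.stalkMap y)) this⟩

/-- A chart of the log structure on an open `U`: a homomorphism `β : P → M_X(U)` such that the
associated log structure `P^a = P ⊕_{β⁻¹(𝒪^×)} 𝒪_X^× → M_X|_U` is an isomorphism, spelled out on
stalks as surjectivity and injectivity of `(p, u) ↦ β(p)u`.  (The units of `M_{X,y}` are those of
`𝒪_{X,y}`.) -/
structure IsChart (X : LogScheme.{u}) (U : X.X.Opens) {P : Type u} [CommMonoid P]
    (β : P →* X.M.sections U) : Prop where
  surjective : ∀ (y : U) (m : X.M.stalk y), ∃ (p : P) (a : (X.M.stalk y)ˣ), (β p).1 y * a = m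
  injective : ∀ (y : U) (p q : P) (a b : (X.M.stalk y)ˣ), (β p).1 y * a = (β q).1 y * b →
    ∃ f g : P, IsUnit ((β f).1 y) ∧ IsUnit ((β g).1 y) ∧ p * f = q * g ∧
      a * (β g).1 y = b * (β f).1 y

/-- An fs log scheme: locally, the log structure has a chart by an fs monoid. -/
def IsFs (X : LogScheme.{u}) : Prop :=
  ∀ x : X.X, ∃ U : X.X.Opens, x ∈ U ∧ ∃ (P : Type u) (_ : CommMonoid P) (β : P →* X.M.sections U),
    IsFsMonoid P ∧ X.IsChart U β

/-- The ideal `I(x, M_X)` of `𝒪_{X,x}` generated by `M_{X,x} ∖ 𝒪_{X,x}^×`. -/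
noncomputable def logIdeal (X : LogScheme.{u}) (x : X.X) : Ideal (X.X.presheaf.stalk x) :=
  Ideal.span {a | ∃ m : X.M.stalk x, ¬ IsUnit m ∧ X.α x m = a}

/-- Log regularity: `X` is fs and, for every point `x`, the local ring `𝒪_{X,x}/I(x, M_X)` is
regular and `dim 𝒪_{X,x} = dim 𝒪_{X,x}/I(x, M_X) + rank (M_{X,x}^♯)^gp`. -/
structure IsLogRegular (X : LogScheme.{u}) : Prop where
  isFs : X.IsFs
  isRegularLocalRing : ∀ x, IsRegularLocalRing (X.X.presheaf.stalk x ⧸ X.logIdeal x)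
  dim_eq : ∀ x, ringKrullDim (X.X.presheaf.stalk x) =
    ringKrullDim (X.X.presheaf.stalk x ⧸ X.logIdeal x) + (gpRank (X.sharp.stalk x) : ℕ)

/-- The fan `F(X)`: the set of points `x` such that `I(x, M_X)` is the maximal ideal of `𝒪_{X,x}`,
with the subspace topology and the restriction of `M_X^♯`. -/
noncomputable def fan (X : LogScheme.{u}) : MonoidalSpace.{u} :=
  X.sharp.restrict {x : X.X | X.logIdeal x = IsLocalRing.maximalIdeal (X.X.presheaf.stalk x)}

/-- For `y ∈ F(X)` and `x ∈ X`: `y` is the image `π(x)` of `x` under the characteristic morphism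
`π : X → F(X)`, i.e. `y` is the point of `X` (a generisation of `x`) which corresponds to the prime
ideal `I(x, M_X)` of `𝒪_{X,x}`.  In other words, `x` lies in the stratum `U(y) = π⁻¹(y)`. -/
def IsCharPoint (X : LogScheme.{u}) (x : X.X) (y : X.fan) : Prop :=
  ∃ h : y.1 ⤳ x, X.logIdeal x =
    (IsLocalRing.maximalIdeal (X.X.presheaf.stalk y.1)).comap
      (X.X.presheaf.stalkSpecializes h).hom

/-- For a morphism of log schemes `f : T → X`, a morphism of monoidal spaces `φ : F' → F(X)` and a
morphism `g : (T, M_T^♯) → F'`: the square `φ ∘ g = π ∘ f^♯` of monoidal spaces commutes, where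
`π : (X, M_X^♯) → F(X)` is the characteristic morphism.  On points this says that
`π(f(t)) = φ(g(t))`.  The homomorphism `π⁻¹M_{F(X)} → M_X^♯` is the isomorphism that on stalks is
inverse to the cospecialisation maps `M_{X,x}^♯ → M_{X,π(x)}^♯ = M_{F(X),π(x)}`, `s_x ↦ s_{π(x)}`;
so on sheaves the condition says that, for a section `s` of `M_X` near `f(t)`, the germ of `s` at
`π(f(t))`, carried to `M_{T,t}^♯` by `φ` and `g`, is equal to the germ of `s` at `f(t)`, carried to
`M_{T,t}^♯` by `f`. -/
def IsCompatible {T X : LogScheme.{u}} {F' : MonoidalSpace.{u}} (φ : MonoidalSpace.Hom F' X.fan)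
    (f : Hom T X) (g : MonoidalSpace.Hom T.sharp F') : Prop :=
  ∀ t : T.X, X.IsCharPoint (f.base t) (φ (g t)) ∧
    ∀ (U : X.X.Opens), ∀ s ∈ X.M.sections U, ∀ (ht : f.base t ∈ U) (hy : (φ (g t)).1 ∈ U),
      g.stalkMap t (φ.stalkMap (g t) (Associates.mk (s ⟨(φ (g t)).1, hy⟩))) =
        Associates.mk (f.stalkMap t (s ⟨f.base t, ht⟩))

/-- The log blow-up `Y = φ^⋆X → X` along a subdivision `φ : F' → F(X)`: an fs log scheme `Y` with
a morphism `b : Y → X` and a morphism `ρ : (Y, M_Y^♯) → F'` such that `φ ∘ ρ = π ∘ b^♯`, which is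
universal, i.e. a final object, among all such triples. -/
structure IsLogBlowup {X Y : LogScheme.{u}} {F' : MonoidalSpace.{u}}
    (φ : MonoidalSpace.Hom F' X.fan) (b : Hom Y X) (ρ : MonoidalSpace.Hom Y.sharp F') : Prop where
  isFs : Y.IsFs
  isCompatible : IsCompatible φ b ρ
  existsUnique : ∀ (T : LogScheme.{u}) (f : Hom T X) (g : MonoidalSpace.Hom T.sharp F'),
    T.IsFs → IsCompatible φ f g → ∃! h : Hom T Y, b.comp h = f ∧ ρ.comp h.sharp = g

/-- A function `f` on an open `V` of `X` is invertible on `V ∩ U`. -/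
def IsUnitOn {X : Scheme.{u}} (U : X.Opens) {V : X.Opens} (f : Γ(X, V)) : Prop :=
  ∀ (y : X) (hy : y ∈ V), y ∈ U → IsUnit (X.presheaf.germ V y hy f)

/-- The product of the restrictions of two functions to the intersection of their domains. -/
def resMul {X : Scheme.{u}} {V W : X.Opens} (f : Γ(X, V)) (g : Γ(X, W)) : Γ(X, V ⊓ W) :=
  X.presheaf.map (homOfLE inf_le_left).op f * X.presheaf.map (homOfLE inf_le_right).op g

theorem germ_resMul {X : Scheme.{u}} {V W : X.Opens} (f : Γ(X, V)) (g : Γ(X, W)) (y : X)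
    (hy : y ∈ V ⊓ W) : X.presheaf.germ (V ⊓ W) y hy (resMul f g) =
      X.presheaf.germ V y hy.1 f * X.presheaf.germ W y hy.2 g := by
  rw [resMul, map_mul]
  exact congrArg₂ (· * ·) (X.presheaf.germ_res_apply (homOfLE inf_le_left) y hy f)
    (X.presheaf.germ_res_apply (homOfLE inf_le_right) y hy g)

theorem IsUnitOn.resMul {X : Scheme.{u}} {U V W : X.Opens} {f : Γ(X, V)} {g : Γ(X, W)}
    (hf : IsUnitOn U f) (hg : IsUnitOn U g) : IsUnitOn U (resMul f g) := by
  intro y hy hU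
  rw [germ_resMul]
  exact (hf y hy.1 hU).mul (hg y hy.2 hU)

theorem isUnitOn_one {X : Scheme.{u}} {U V : X.Opens} : IsUnitOn U (1 : Γ(X, V)) := by
  intro y hy _
  rw [map_one]
  exact isUnit_one

/-- The stalk at `x` of `𝒪_X ∩ j_*𝒪_U^×`, for an open `j : U → X`: the germs of functions `f` on a
neighbourhood `V` of `x` that are invertible on `V ∩ U`. -/
noncomputable def divisorialStalk (X : Scheme.{u}) (U : X.Opens) (x : X) : Submonoid (X.presheaf.stalk x) where
  carrier := {a | ∃ (V : X.Opens) (hx : x ∈ V) (f : Γ(X, V)),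
    IsUnitOn U f ∧ X.presheaf.germ V x hx f = a}
  one_mem' := ⟨⊤, trivial, 1, isUnitOn_one, map_one _⟩
  mul_mem' := by
    rintro _ _ ⟨V, hV, f, hf, rfl⟩ ⟨W, hW, g, hg, rfl⟩
    exact ⟨V ⊓ W, ⟨hV, hW⟩, resMul f g, hf.resMul hg, germ_resMul f g x _⟩

/-- The sheaf of monoids `𝒪_X ∩ j_*𝒪_U^×`, for an open `j : U → X`: its sections are given by the
functions that are invertible on `U`. -/
noncomputable def divisorialSheaf (X : Scheme.{u}) (U : X.Opens) : MonoidSheaf.{u, u} X :=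
  MonoidSheaf.ofBase (fun x => divisorialStalk X U x)
    (fun V s => ∃ f : Γ(X, V), IsUnitOn U f ∧
      ∀ y : V, (s y : X.presheaf.stalk y.1) = X.presheaf.germ V y.1 y.2 f)
    ⟨1, isUnitOn_one, fun _ => (map_one _).symm⟩
    (by
      rintro V W s t ⟨f, hf, ef⟩ ⟨g, hg, eg⟩
      refine ⟨resMul f g, hf.resMul hg, fun y => ?_⟩
      rw [germ_resMul]
      exact congrArg₂ (· * ·) (ef ⟨y.1, y.2.1⟩) (eg ⟨y.1, y.2.2⟩))
    (by
      rintro x ⟨_, V, hx, f, hf, rfl⟩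
      exact ⟨V, hx, fun y => ⟨X.presheaf.germ V y.1 y.2 f, V, y.2, f, hf, rfl⟩,
        ⟨f, hf, fun _ => rfl⟩, rfl⟩)
    (by
      rintro V V' s t ⟨f, hf, ef⟩ ⟨f', hf', ef'⟩ x hV hV' e
      have e' : X.presheaf.germ V x hV f = X.presheaf.germ V' x hV' f' :=
        (ef ⟨x, hV⟩).symm.trans ((congrArg Subtype.val e).trans (ef' ⟨x, hV'⟩))
      obtain ⟨W, hW, i, j, h⟩ := TopCat.Presheaf.germ_eq X.presheaf x hV hV' f f' e'
      refine ⟨W, hW, fun y yV yV' yW => Subtype.ext ?_⟩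
      refine (ef ⟨y, yV⟩).trans (Eq.trans ?_ (ef' ⟨y, yV'⟩).symm)
      have h₁ := X.presheaf.germ_res_apply i y yW f
      have h₂ := X.presheaf.germ_res_apply j y yW f'
      exact h₁.symm.trans ((congrArg _ h).trans h₂))

/-- The divisorial log structure `M_X = 𝒪_X ∩ j_*𝒪_U^× ⊆ 𝒪_X` for an open `j : U → X` (the
complement of the divisor). -/
noncomputable def divisorial (X : Scheme.{u}) (U : X.Opens) : LogScheme.{u} where
  X := X
  M := divisorialSheaf X U
  α x := (divisorialStalk X U x).subtype
  α_sections V s hs x hx := by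
    obtain ⟨W, A, hW, hA, r, ⟨f, hf, ef⟩, e⟩ := hs x hx
    refine ⟨A ⊓ W, ⟨hA, hW⟩, X.presheaf.map (homOfLE inf_le_left).op f, fun y yV yW => ?_⟩
    refine Eq.trans ?_ (X.presheaf.germ_res_apply (homOfLE inf_le_left) y yW f).symm
    exact (congrArg Subtype.val (e y yV yW.1 yW.2)).trans (ef ⟨y, yW.1⟩)
  existsUnique_unit x a := by
    obtain ⟨V, hx, f, hf⟩ := X.presheaf.exists_germ_eq (a : X.presheaf.stalk x)
    have hx' : x ∈ X.basicOpen f := by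
      rw [Scheme.mem_basicOpen X f x hx, hf]
      exact a.isUnit
    refine ⟨⟨a, X.basicOpen f, hx', X.presheaf.map (homOfLE (X.basicOpen_le f)).op f,
      fun y hy _ => ?_, ?_⟩, rfl, fun m hm => Subtype.ext hm⟩
    · have h := X.presheaf.germ_res_apply (homOfLE (X.basicOpen_le f)) y hy f
      exact h.symm ▸ (Scheme.mem_basicOpen X f y (X.basicOpen_le f hy)).1 hy
    · exact (X.presheaf.germ_res_apply (homOfLE (X.basicOpen_le f)) x hx' f).trans hf

end LogScheme

/-- For a scheme `𝒳` over a discrete valuation ring `R`, the log scheme `𝒳^†`: the scheme `𝒳` with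
the divisorial log structure induced by the special fibre (the preimage of the closed point). -/
noncomputable def dagger {R : Type u} [CommRing R] [IsLocalRing R] {𝒳 : Scheme.{u}}
    (q : 𝒳 ⟶ Spec (CommRingCat.of R)) : LogScheme.{u} :=
  LogScheme.divisorial 𝒳
    ⟨(q ⁻¹' {IsLocalRing.closedPoint R})ᶜ,
      ((IsLocalRing.isClosed_singleton_closedPoint R).preimage q.continuous).isOpen_compl⟩

/-! ### Reduced strata and tori -/

/-- The reduced closed subscheme supported on the closure of a subset `Z` of a scheme. -/
noncomputable def reducedClosure (Y : Scheme.{u}) (Z : Set Y) : Y.IdealSheafData :=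
  Scheme.IdealSheafData.vanishingIdeal ⟨closure Z, isClosed_closure⟩

/-- A locally closed subset `Z` of a scheme `Y` as an open subset of its closure.  (For a general
subset, this is the largest open subset of the closure that is contained in `Z`.) -/
noncomputable def openInClosure (Y : Scheme.{u}) (Z : Set Y) :
    (reducedClosure Y Z).subscheme.Opens :=
  ⟨interior ((reducedClosure Y Z).subschemeι ⁻¹' Z), isOpen_interior⟩

/-- A locally closed subset `Z` of a scheme `Y` with its reduced induced scheme structure. -/
noncomputable def reducedSubscheme (Y : Scheme.{u}) (Z : Set Y) : Scheme.{u} :=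
  (openInClosure Y Z).toScheme

/-- The immersion of a locally closed subset with its reduced induced scheme structure. -/
noncomputable def reducedSubschemeι (Y : Scheme.{u}) (Z : Set Y) : reducedSubscheme Y Z ⟶ Y :=
  (openInClosure Y Z).ι ≫ (reducedClosure Y Z).subschemeι

/-- The split torus `𝔾_m^r = Spec k[ℤ^r]` over `k`, as a `k`-scheme. -/
noncomputable def splitTorus (k : CommRingCat.{u}) (r : ℕ) : Over (Spec k) :=
  Over.mk (Spec.map (CommRingCat.ofHom (algebraMap k (AddMonoidAlgebra k (Fin r → ℤ)))))

end LogGeom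

/-!
Over a point `x` of the stratum of `φ(x')`, let `P` be the stalk of `F'` at `x'` and `N` the
characteristic monoid of `X` at `φ(x')`. The surjection `N^gp → P^gp` splits, so `N` embeds into
`P × ℤ^r` with the same group, where `r = rank N^gp - rank P^gp`; since the dimension of a sharp
fine monoid is the rank of its group, `r = h(φ(x')) - h(x')`.

On the torus `G = 𝔾_m^r` over `κ(x)`, the hollow log structure `P ⊕ 𝒪_G^×`, in which every `p ≠ 1`
maps to `0`, receives a homomorphism from `M_{X,x}` through this embedding, the `ℤ^r`-component
going to the characters of `G`. The universal property of the log blow-up turns it into a morphism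
`f : G → φ^⋆X` into the stratum of `x'`. Conversely, every element of `P × ℤ^r` is a fraction of
elements of `N`, so on the fibre of the stratum the log structure of `φ^⋆X` contains elements
indexed by `P × ℤ^r`; those indexed by `ℤ^r` are invertible functions and define a morphism `g` to
`G`, and the functions given by `p ≠ 1` are nowhere invertible, hence vanish because the stratum is
reduced. Thus the inverse image log structure on the fibre of the stratum is pulled back from the
hollow one, and uniqueness in the universal property shows that `f` and `g` are inverse to each
other.
-/

namespace LogGeom

/-! ### The dimension of a sharp fine monoid -/

section Finrank

variable {R : Type*} [CommRing R] [IsDomain R] {A : Type*} [AddCommGroup A] [Module R A]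
  {V W : Submodule R A}

theorem finrank_quotient_comap_add_finrank_inf [Module.Finite R W] :
    Module.finrank R (W ⧸ V.comap W.subtype) + Module.finrank R ↥(V ⊓ W) = Module.finrank R W := by
  have e : V.comap W.subtype = (V ⊓ W).comap W.subtype := by simp
  rw [← Submodule.finrank_quotient_add_finrank (V.comap W.subtype),
    ← (Submodule.comapSubtypeEquivOfLe (inf_le_right : V ⊓ W ≤ W)).finrank_eq, ← e]

theorem finrank_lt_of_smul_notMem [Module.Finite R W] (h : V ≤ W) {x : A} (hx : x ∈ W)
    (hxV : ∀ r : R, r ≠ 0 → r • x ∉ V) : Module.finrank R V < Module.finrank R W := by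
  have rank_add := finrank_quotient_comap_add_finrank_inf (V := V) (W := W)
  rw [inf_eq_left.2 h] at rank_add
  have : Module.finrank R (W ⧸ V.comap W.subtype) ≠ 0 := by
    intro h0
    obtain ⟨r, hr, hrx⟩ := Module.finrank_eq_zero_iff.1 h0 (Submodule.Quotient.mk ⟨x, hx⟩)
    rw [← Submodule.Quotient.mk_smul, Submodule.Quotient.mk_eq_zero] at hrx
    exact hxV r hr hrx
  omega

theorem finrank_le_of_smul_mem [Module.Finite R V] [Module.Finite R W]
    (h : ∀ x ∈ W, ∃ r : R, r ≠ 0 ∧ r • x ∈ V) : Module.finrank R W ≤ Module.finrank R V := by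
  rw [← finrank_quotient_comap_add_finrank_inf (V := V), Module.finrank_eq_zero_iff.2, zero_add]
  · exact Submodule.finrank_mono inf_le_left
  · intro y
    obtain ⟨⟨x, hx⟩, rfl⟩ := Submodule.Quotient.mk_surjective _ y
    obtain ⟨r, hr, hrx⟩ := h x hx
    refine ⟨r, hr, ?_⟩
    rwa [← Submodule.Quotient.mk_smul, Submodule.Quotient.mk_eq_zero]

theorem finrank_sup_le [Module.Finite R V] [Module.Finite R W] :
    Module.finrank R ↥(V ⊔ W) ≤ Module.finrank R V + Module.finrank R W := by
  have rank_add_le := Submodule.rank_add_le_rank_add_rank V W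
  simp only [← Module.finrank_eq_rank] at rank_add_le
  exact_mod_cast rank_add_le

end Finrank

theorem krullDim_eq_of_strictMono_nat {α : Type*} [PartialOrder α] {f : α → ℕ} (hf : StrictMono f)
    {n : ℕ} (hn : ∀ a, f a ≤ n) (hsucc : ∀ a, f a < n → ∃ b, a < b ∧ f b ≤ f a + 1) {a₀ : α}
    (h₀ : f a₀ = 0) : Order.krullDim α = n := by
  apply le_antisymm
  · refine iSup_le fun p => ?_
    have hp (i : ℕ) : (hi : i < p.length + 1) → i ≤ f (p ⟨i, hi⟩) := by
      induction i with
      | zero => exact fun _ => Nat.zero_le _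
      | succ i ih =>
        exact fun hi => (ih (by omega)).trans_lt (hf (p.strictMono (Nat.lt_succ_self i)))
    exact_mod_cast (hp p.length (by omega)).trans (hn _)
  · have chain : ∀ k ≤ n, ∃ p : LTSeries α, p.length = k ∧ f p.last = k := by
      intro k
      induction k with
      | zero => exact fun _ => ⟨RelSeries.singleton _ a₀, rfl, h₀⟩
      | succ k ih =>
        intro hk
        obtain ⟨p, hpk, hfp⟩ := ih (by omega)
        obtain ⟨b, hb, hfb⟩ := hsucc p.last (by omega)
        have := hf hb
        exact ⟨p.snoc b hb, by simp [hpk], by rw [RelSeries.last_snoc]; omega⟩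
    obtain ⟨p, hpn, -⟩ := chain n le_rfl
    exact hpn ▸ Order.LTSeries.length_le_krullDim p

section GroupEnvelope

variable {N : Type*} [CommMonoid N]

/-- The class of an element in the group envelope, written additively so that linear algebra over
`ℤ` applies. -/
noncomputable def gpOf (a : N) : Additive (Algebra.GrothendieckGroup N) :=
  Additive.ofMul (Algebra.GrothendieckGroup.of a)

@[simp]
theorem gpOf_mul (a b : N) : gpOf (a * b) = gpOf a + gpOf b := by
  simp [gpOf, map_mul]

@[simp]
theorem gpOf_one : gpOf (1 : N) = 0 := by
  simp [gpOf]

@[simp]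
theorem gpOf_pow (a : N) (n : ℕ) : gpOf (a ^ n) = n • gpOf a := by
  simp [gpOf, map_pow]

theorem gpOf_injective [IsCancelMul N] : Function.Injective (gpOf (N := N)) := fun _ _ h =>
  Algebra.GrothendieckGroup.of_injective (Additive.ofMul.injective h)

theorem exists_gpOf_sub (x : Additive (Algebra.GrothendieckGroup N)) :
    ∃ a b : N, x = gpOf a - gpOf b := by
  obtain ⟨⟨a, b⟩, h⟩ := (Localization.monoidOf (⊤ : Submonoid N)).surj x.toMul
  exact ⟨a, b, eq_sub_of_add_eq (congrArg Additive.ofMul h)⟩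

instance [Monoid.FG N] : Module.Finite ℤ (Additive (Algebra.GrothendieckGroup N)) := by
  rw [Module.Finite.iff_addGroup_fg]
  exact GroupFG.iff_add_fg.1 (Group.fg_iff_monoid_fg.2 inferInstance)

/-- The subgroup of the group envelope generated by a submonoid. -/
noncomputable def gpSpan (S : Submonoid N) : Submodule ℤ (Additive (Algebra.GrothendieckGroup N)) :=
  Submodule.span ℤ (gpOf '' (S : Set N))

theorem gpOf_mem_gpSpan {S : Submonoid N} {a : N} (h : a ∈ S) : gpOf a ∈ gpSpan S :=
  Submodule.subset_span ⟨a, h, rfl⟩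

theorem gpSpan_mono {S T : Submonoid N} (h : S ≤ T) : gpSpan S ≤ gpSpan T :=
  Submodule.span_mono (Set.image_mono h)

theorem gpSpan_bot : gpSpan (⊥ : Submonoid N) = ⊥ := by
  simp [gpSpan]

theorem gpSpan_top : gpSpan (⊤ : Submonoid N) = ⊤ := by
  refine eq_top_iff.2 fun x _ => ?_
  obtain ⟨a, b, rfl⟩ := exists_gpOf_sub x
  exact sub_mem (gpOf_mem_gpSpan trivial) (gpOf_mem_gpSpan trivial)

theorem exists_of_mem_gpSpan {S : Submonoid N} {x : Additive (Algebra.GrothendieckGroup N)}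
    (h : x ∈ gpSpan S) : ∃ a ∈ S, ∃ b ∈ S, x = gpOf a - gpOf b := by
  rw [gpSpan, ← Submodule.mem_toAddSubgroup, Submodule.span_int_eq_addSubgroupClosure] at h
  induction h using AddSubgroup.closure_induction with
  | mem x h =>
    obtain ⟨a, ha, rfl⟩ := h
    exact ⟨a, ha, 1, S.one_mem, by simp⟩
  | zero => exact ⟨1, S.one_mem, 1, S.one_mem, by simp⟩
  | add x y _ _ hx hy =>
    obtain ⟨a, ha, b, hb, rfl⟩ := hx
    obtain ⟨c, hc, d, hd, rfl⟩ := hy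
    exact ⟨a * c, S.mul_mem ha hc, b * d, S.mul_mem hb hd, by rw [gpOf_mul, gpOf_mul]; abel⟩
  | neg x _ hx =>
    obtain ⟨a, ha, b, hb, rfl⟩ := hx
    exact ⟨b, hb, a, ha, neg_sub _ _⟩

end GroupEnvelope

section Dimension

variable {N : Type*} [CommMonoid N]

theorem Face.mul_mem_iff (S : Face N) {a b : N} : a * b ∈ S.1 ↔ a ∈ S.1 ∧ b ∈ S.1 :=
  ⟨fun h => ⟨S.2 a b h, S.2 b a (mul_comm a b ▸ h)⟩, fun h => S.1.mul_mem h.1 h.2⟩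

theorem Face.mem_of_pow_mem (S : Face N) {a : N} {n : ℕ} (hn : n ≠ 0) (h : a ^ n ∈ S.1) :
    a ∈ S.1 := by
  obtain ⟨m, rfl⟩ := Nat.exists_eq_succ_of_ne_zero hn
  exact S.2 a (a ^ m) (pow_succ' a m ▸ h)

/-- The rank of the subgroup of the group envelope generated by a face. -/
noncomputable def faceRank (S : Face N) : ℕ :=
  Module.finrank ℤ (gpSpan S.1)

theorem faceRank_strictMono [IsCancelMul N] [Monoid.FG N] :
    StrictMono (faceRank : Face N → ℕ) := by
  intro S T h
  obtain ⟨hle, t, ht, htS⟩ := SetLike.lt_iff_le_and_exists.1 (show S.1 < T.1 from h)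
  refine finrank_lt_of_smul_notMem (gpSpan_mono hle) (gpOf_mem_gpSpan ht) fun n hn hx => htS ?_
  have hx' : n.natAbs • gpOf t ∈ gpSpan S.1 := by
    obtain ⟨k, rfl | rfl⟩ := n.eq_nat_or_neg <;> simpa using hx
  obtain ⟨a, ha, b, -, e⟩ := exists_of_mem_gpSpan hx'
  rw [← gpOf_pow, eq_sub_iff_add_eq, ← gpOf_mul] at e
  have hab : t ^ n.natAbs * b = a := gpOf_injective e
  exact S.mem_of_pow_mem (Int.natAbs_ne_zero.2 hn) (S.2 _ b (hab ▸ ha))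

/-- The elements of `N` that lie in the rational cone generated by `R` modulo the linear span
of `S`, spelled out with positive multiples in `N` (written as powers). -/
def coneClosure (S : Submonoid N) (R : Set N) : Submonoid N where
  carrier := {v | ∃ k : ℕ, k ≠ 0 ∧ ∃ s ∈ S, ∃ s' ∈ S, ∃ r ∈ Submonoid.closure R,
    v ^ k * s = r * s'}
  one_mem' := ⟨1, one_ne_zero, 1, S.one_mem, 1, S.one_mem, 1, one_mem _, by simp⟩
  mul_mem' := by
    rintro a b ⟨k, hk, s, hs, s', hs', r, hr, e⟩ ⟨l, hl, t, ht, t', ht', q, hq, e'⟩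
    refine ⟨k * l, mul_ne_zero hk hl, s ^ l * t ^ k, S.mul_mem (S.pow_mem hs l) (S.pow_mem ht k),
      s' ^ l * t' ^ k, S.mul_mem (S.pow_mem hs' l) (S.pow_mem ht' k), r ^ l * q ^ k,
      mul_mem (pow_mem hr l) (pow_mem hq k), ?_⟩
    rw [mul_pow, mul_mul_mul_comm, mul_mul_mul_comm (r ^ l), ← mul_pow, ← mul_pow, ← e, ← e',
      mul_pow, mul_pow, ← pow_mul, ← pow_mul, mul_comm l k]

theorem closure_le_coneClosure (S : Submonoid N) (R : Set N) :
    Submonoid.closure R ≤ coneClosure S R := fun r hr =>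
  ⟨1, one_ne_zero, 1, S.one_mem, 1, S.one_mem, r, hr, by simp⟩

theorem le_coneClosure (S : Submonoid N) (R : Set N) : S ≤ coneClosure S R := fun s hs =>
  ⟨1, one_ne_zero, 1, S.one_mem, s, hs, 1, one_mem _, by simp⟩

theorem coneClosure_le_coneClosure {S : Submonoid N} {R R' : Set N}
    (h : R ⊆ coneClosure S R') : coneClosure S R ≤ coneClosure S R' := by
  rintro v ⟨k, hk, s, hs, s', hs', r, hr, e⟩
  obtain ⟨l, hl, t, ht, t', ht', q, hq, e'⟩ := Submonoid.closure_le.2 h hr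
  refine ⟨k * l, mul_ne_zero hk hl, s ^ l * t, S.mul_mem (S.pow_mem hs l) ht, s' ^ l * t',
    S.mul_mem (S.pow_mem hs' l) ht', q, hq, ?_⟩
  rw [← mul_assoc, pow_mul, ← mul_pow, e, mul_pow, mul_right_comm, e', mul_assoc, mul_comm t']

theorem coneClosure_empty (S : Face N) : coneClosure S.1 ∅ = S.1 := by
  refine le_antisymm ?_ (le_coneClosure _ _)
  rintro v ⟨k, hk, s, -, s', hs', r, hr, e⟩
  rw [Submonoid.closure_empty, Submonoid.mem_bot] at hr
  rw [hr, one_mul] at e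
  exact S.mem_of_pow_mem hk (S.2 _ s (e ▸ hs'))

/-- The face generated by a face and an element. -/
def faceAdjoin (S : Face N) (c : N) : Face N :=
  ⟨{ carrier := {p | ∃ q, ∃ n : ℕ, ∃ s ∈ S.1, p * q = c ^ n * s}
     one_mem' := ⟨1, 0, 1, S.1.one_mem, by simp⟩
     mul_mem' := by
       rintro a b ⟨q, n, s, hs, e⟩ ⟨q', n', s', hs', e'⟩
       refine ⟨q * q', n + n', s * s', S.1.mul_mem hs hs', ?_⟩
       rw [mul_mul_mul_comm, e, e', pow_add, mul_mul_mul_comm] },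
   fun a b ⟨q, n, s, hs, e⟩ => ⟨b * q, n, s, hs, by rw [← mul_assoc, e]⟩⟩

theorem lt_faceAdjoin {S : Face N} {c : N} (hc : c ∉ S.1) : S < faceAdjoin S c :=
  (SetLike.lt_iff_le_and_exists (p := S.1) (q := (faceAdjoin S c).1)).2
    ⟨fun s hs => ⟨1, 0, s, hs, by simp⟩, c, ⟨1, 1, 1, S.1.one_mem, by simp⟩, hc⟩

theorem mem_face_of_pow_mul_eq [IsCancelMul N] {S : Face N} {R : Set N} {c : N}
    (hc : c ∉ coneClosure S.1 R) {m n : ℕ} {s s' r : N} (hs : s ∈ S.1) (hs' : s' ∈ S.1)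
    (hr : r ∈ Submonoid.closure R) (e : c ^ m * s = c ^ n * (r * s')) : r ∈ S.1 := by
  rcases lt_or_ge n m with h | h
  · obtain ⟨d, rfl⟩ := Nat.exists_eq_add_of_lt h
    rw [add_assoc, pow_add, mul_assoc] at e
    exact absurd ⟨d + 1, Nat.succ_ne_zero d, s, hs, s', hs', r, hr, mul_left_cancel e⟩ hc
  · obtain ⟨d, rfl⟩ := Nat.exists_eq_add_of_le h
    rw [pow_add, mul_assoc] at e
    exact (S.mul_mem_iff.1 (S.mul_mem_iff.1 (mul_left_cancel e ▸ hs)).2).1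

theorem exists_pow_mul_of_mem_closure_insert {R : Set N} {c r : N}
    (hr : r ∈ Submonoid.closure (insert c R)) :
    ∃ n : ℕ, ∃ q ∈ Submonoid.closure R, r = c ^ n * q := by
  rw [← Set.singleton_union, Submonoid.closure_union, Submonoid.mem_sup] at hr
  obtain ⟨_, hy, q, hq, rfl⟩ := hr
  obtain ⟨n, rfl⟩ := Submonoid.mem_closure_singleton.1 hy
  exact ⟨n, q, hq, rfl⟩

/- Geometrically, `c` spans an extremal ray of the cone of `N` modulo `S`: if `p + q` lies on this
ray, so do `p` and `q`. -/
theorem faceAdjoin_le_coneClosure_singleton [IsCancelMul N] {S : Face N} {R : Set N} {c : N}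
    (hR : coneClosure S.1 (insert c R) = ⊤) (hc : c ∉ coneClosure S.1 R) :
    (faceAdjoin S c).1 ≤ coneClosure S.1 {c} := by
  rintro p ⟨q, n, s, hs, e⟩
  obtain ⟨k, hk, a, ha, a', ha', _, hr₀, er⟩ :=
    hR.ge (Submonoid.mem_top p)
  obtain ⟨l, hl, b, hb, b', hb', _, ht₀, et⟩ :=
    hR.ge (Submonoid.mem_top q)
  obtain ⟨i, r, hr, rfl⟩ := exists_pow_mul_of_mem_closure_insert hr₀
  obtain ⟨j, t, ht, rfl⟩ := exists_pow_mul_of_mem_closure_insert ht₀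
  have hpq : c ^ (n * (k * l)) * (s ^ (k * l) * (a ^ l * b ^ k)) =
      c ^ (i * l + j * k) * (r ^ l * t ^ k * (a' ^ l * b' ^ k)) := by
    calc c ^ (n * (k * l)) * (s ^ (k * l) * (a ^ l * b ^ k))
        = (p * q) ^ (k * l) * (a ^ l * b ^ k) := by rw [e, mul_pow, ← pow_mul, mul_assoc]
      _ = (p ^ k * a) ^ l * (q ^ l * b) ^ k := by
          rw [mul_pow p, mul_pow (p ^ k), mul_pow (q ^ l), ← pow_mul, ← pow_mul, mul_comm l k,
            mul_mul_mul_comm]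
      _ = _ := by
          rw [er, et, mul_pow, mul_pow, mul_pow, mul_pow, ← pow_mul, ← pow_mul, pow_add,
            mul_mul_mul_comm, mul_mul_mul_comm (c ^ (i * l)), mul_assoc]
  have hrt : r ^ l * t ^ k ∈ S.1 := mem_face_of_pow_mul_eq hc
    (mul_mem (pow_mem hs _) (mul_mem (pow_mem ha _) (pow_mem hb _)))
    (mul_mem (pow_mem ha' _) (pow_mem hb' _)) (mul_mem (pow_mem hr _) (pow_mem ht _)) hpq
  have hrS : r ∈ S.1 := S.mem_of_pow_mem hl (S.mul_mem_iff.1 hrt).1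
  exact ⟨k, hk, a, ha, r * a', mul_mem hrS ha', c ^ i,
    pow_mem (Submonoid.mem_closure_singleton_self (y := c)) i, by rw [er, mul_assoc]⟩

theorem exists_smul_mem_of_le_coneClosure {S T : Submonoid N} {R : Set N}
    (h : T ≤ coneClosure S R) {x : Additive (Algebra.GrothendieckGroup N)} (hx : x ∈ gpSpan T) :
    ∃ n : ℤ, n ≠ 0 ∧ n • x ∈ gpSpan S ⊔ Submodule.span ℤ (gpOf '' R) := by
  have hclosure : ∀ r ∈ Submonoid.closure R, gpOf r ∈ Submodule.span ℤ (gpOf '' R) := by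
    intro r hr
    induction hr using Submonoid.closure_induction with
    | mem r hr => exact Submodule.subset_span ⟨r, hr, rfl⟩
    | one => simp
    | mul r q _ _ hr hq => exact gpOf_mul r q ▸ add_mem hr hq
  have hgpOf : ∀ a ∈ T, ∃ k : ℕ, k ≠ 0 ∧
      k • gpOf a ∈ gpSpan S ⊔ Submodule.span ℤ (gpOf '' R) := by
    intro a ha
    obtain ⟨k, hk, s, hs, s', hs', r, hr, e⟩ := h ha
    have e' : k • gpOf a = gpOf s' - gpOf s + gpOf r := by
      rw [sub_add_eq_add_sub, eq_sub_iff_add_eq, ← gpOf_pow, ← gpOf_mul, ← gpOf_mul, e, mul_comm]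
    exact ⟨k, hk, e' ▸ Submodule.add_mem_sup
      (sub_mem (gpOf_mem_gpSpan hs') (gpOf_mem_gpSpan hs)) (hclosure r hr)⟩
  obtain ⟨a, ha, b, hb, rfl⟩ := exists_of_mem_gpSpan hx
  obtain ⟨m, hm, hma⟩ := hgpOf a ha
  obtain ⟨n, hn, hnb⟩ := hgpOf b hb
  refine ⟨(m * n : ℕ), by exact_mod_cast mul_ne_zero hm hn, ?_⟩
  rw [natCast_zsmul, smul_sub, mul_comm, mul_smul, mul_comm, mul_smul]
  exact sub_mem (nsmul_mem hma n) (nsmul_mem hnb m)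

theorem finrank_gpSpan_le_of_le_coneClosure [Monoid.FG N] {S T : Submonoid N} {R : Finset N}
    (h : T ≤ coneClosure S R) :
    Module.finrank ℤ (gpSpan T) ≤ Module.finrank ℤ (gpSpan S) + R.card := by
  classical
  calc Module.finrank ℤ (gpSpan T)
      ≤ Module.finrank ℤ ↥(gpSpan S ⊔ Submodule.span ℤ (gpOf '' (R : Set N))) :=
        finrank_le_of_smul_mem fun _ => exists_smul_mem_of_le_coneClosure h
    _ ≤ Module.finrank ℤ (gpSpan S) + Module.finrank ℤ (Submodule.span ℤ (gpOf '' (R : Set N))) :=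
        finrank_sup_le
    _ ≤ Module.finrank ℤ (gpSpan S) + R.card := by
        gcongr
        rw [← Finset.coe_image]
        exact (finrank_span_finset_le_card _).trans Finset.card_image_le

theorem exists_gt_faceRank_le_succ [IsCancelMul N] [Monoid.FG N] {S : Face N} (hS : S.1 ≠ ⊤) :
    ∃ T : Face N, S < T ∧ faceRank T ≤ faceRank S + 1 := by
  classical
  obtain ⟨G, hG⟩ := (Monoid.FG.fg_top : (⊤ : Submonoid N).FG)
  obtain ⟨R, -, hR⟩ := exists_minimal_le_of_wellFoundedLT
    (fun R : Finset N => coneClosure S.1 (R : Set N) = ⊤) G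
    (top_le_iff.1 (hG ▸ closure_le_coneClosure S.1 _))
  obtain ⟨c, hc⟩ : R.Nonempty := by
    rw [Finset.nonempty_iff_ne_empty]
    rintro rfl
    exact hS (by simpa [coneClosure_empty] using hR.prop)
  have hinsert : insert c ((R.erase c : Finset N) : Set N) = R := by
    rw [← Finset.coe_insert, Finset.insert_erase hc]
  have hcR : c ∉ coneClosure S.1 ((R.erase c : Finset N) : Set N) := by
    refine fun hmem => hR.not_prop_of_lt (Finset.erase_ssubset hc) (top_le_iff.1 ?_)
    rw [← hR.prop, ← hinsert]
    exact coneClosure_le_coneClosure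
      (Set.insert_subset hmem (Submonoid.subset_closure.trans (closure_le_coneClosure _ _)))
  refine ⟨faceAdjoin S c, lt_faceAdjoin fun h => hcR (le_coneClosure _ _ h), ?_⟩
  refine finrank_gpSpan_le_of_le_coneClosure (R := {c}) ?_
  rw [Finset.coe_singleton]
  exact faceAdjoin_le_coneClosure_singleton (hinsert ▸ hR.prop) hcR

theorem monoidDim_eq_gpRank [IsCancelMul N] [Monoid.FG N] [Subsingleton Nˣ] :
    monoidDim N = gpRank N := by
  have faceRank_of_eq_top {S : Face N} (h : S.1 = ⊤) : faceRank S = gpRank N := by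
    rw [faceRank, h, gpSpan_top, finrank_top, gpRank]
  refine krullDim_eq_of_strictMono_nat faceRank_strictMono (fun S => Submodule.finrank_le _)
    (fun S hS => exists_gt_faceRank_le_succ fun h => hS.ne (faceRank_of_eq_top h))
    (a₀ := ⟨⊥, fun a b h => (mul_eq_one.1 h).1⟩) ?_
  exact (congrArg (fun L : Submodule ℤ _ => Module.finrank ℤ L) gpSpan_bot).trans (finrank_bot _ _)

end Dimension

/-! ### Quotients and splittings of monoids -/

section FaceQuotient

variable {P : Type*} {N : Type*} [CommMonoid P] [CommMonoid N] {S : Face P} {π : P →* N}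

theorem IsFsMonoid.of_face_quotient (hP : IsFsMonoid P) (hπ : Function.Surjective π)
    (h : ∀ p q, π p = π q ↔ ∃ f ∈ S.1, ∃ g ∈ S.1, p * f = q * g) : IsFsMonoid N := by
  have := hP.cancel
  have := hP.fg
  refine ⟨?_, Monoid.fg_of_surjective π hπ, ?_⟩
  · have : IsLeftCancelMul N := ⟨hπ.forall.2 fun a => hπ.forall.2 fun b => hπ.forall.2 fun c e => by
      simp only [← map_mul] at e
      obtain ⟨f, hf, g, hg, e⟩ := (h _ _).1 e
      rw [mul_assoc, mul_assoc] at e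
      exact (h _ _).2 ⟨f, hf, g, hg, mul_left_cancel e⟩⟩
    exact CommMagma.IsLeftCancelMul.toIsCancelMul N
  · refine hπ.forall.2 fun a => hπ.forall.2 fun b => hπ.forall.2 fun c n hn e => ?_
    simp only [← map_mul, ← map_pow] at e
    obtain ⟨f, hf, g, -, e⟩ := (h _ _).1 e
    obtain ⟨m, rfl⟩ := Nat.exists_eq_succ_of_ne_zero hn
    obtain ⟨d, hd⟩ := hP.saturated (a * f) b (c * g * f ^ m) (m + 1) (Nat.succ_ne_zero m) (by
      rw [mul_pow, pow_succ' f, ← mul_assoc, e]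
      ac_rfl)
    refine ⟨π d, ?_⟩
    rw [← map_mul, ← hd, h]
    exact ⟨f, hf, 1, S.1.one_mem, by simp⟩

theorem subsingleton_units_of_face_quotient (hπ : Function.Surjective π)
    (h : ∀ p q, π p = π q ↔ ∃ f ∈ S.1, ∃ g ∈ S.1, p * f = q * g) : Subsingleton Nˣ := by
  suffices ∀ c : Nˣ, c = 1 from ⟨fun c d => (this c).trans (this d).symm⟩
  refine fun c => Units.ext ?_
  obtain ⟨a, ha⟩ := hπ c
  obtain ⟨b, hb⟩ := hπ c⁻¹.1
  have hab : π (a * b) = π 1 := by rw [map_mul, map_one, ha, hb, Units.mul_inv]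
  obtain ⟨f, -, g, hg, e⟩ := (h _ _).1 hab
  rw [one_mul, mul_assoc] at e
  have haS : a ∈ S.1 := S.2 a (b * f) (e ▸ hg)
  rw [Units.val_one, ← ha, ← map_one π, h]
  exact ⟨1, S.1.one_mem, a, haS, by simp⟩

end FaceQuotient

theorem IsFsMonoid.pow_left_injective {N : Type*} [CommMonoid N] (hN : IsFsMonoid N)
    [Subsingleton Nˣ] {n : ℕ} (hn : n ≠ 0) : Function.Injective fun a : N => a ^ n := by
  have := hN.cancel
  intro a b e
  obtain ⟨d, hd⟩ := hN.saturated a b 1 n hn (by simpa using e)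
  obtain ⟨c, hc⟩ := hN.saturated b a 1 n hn (by simpa using e.symm)
  have hdc : d * c = 1 := by
    rw [hd, mul_assoc] at hc
    exact mul_eq_left.1 hc.symm
  rw [hd, (mul_eq_one.1 hdc).1, mul_one]

theorem IsFsMonoid.isTorsionFree_gp {N : Type*} [CommMonoid N] (hN : IsFsMonoid N)
    [Subsingleton Nˣ] : Module.IsTorsionFree ℤ (Additive (Algebra.GrothendieckGroup N)) := by
  have := hN.cancel
  refine Module.isTorsionFree_iff_smul_eq_zero.2 fun n x e => or_iff_not_imp_left.2 fun hn => ?_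
  obtain ⟨a, b, rfl⟩ := exists_gpOf_sub x
  have e' : n.natAbs • (gpOf a - gpOf b) = 0 := by
    obtain ⟨k, rfl | rfl⟩ := n.eq_nat_or_neg <;> simpa using e
  rw [smul_sub, ← gpOf_pow, ← gpOf_pow, sub_eq_zero] at e'
  rw [hN.pow_left_injective (Int.natAbs_ne_zero.2 hn) (gpOf_injective e'), sub_self]

theorem IsFsMonoid.free_gp {N : Type*} [CommMonoid N] (hN : IsFsMonoid N) [Subsingleton Nˣ] :
    Module.Free ℤ (Additive (Algebra.GrothendieckGroup N)) := by
  have := hN.fg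
  have := hN.isTorsionFree_gp
  infer_instance

section GpLinearMap

variable {N : Type*} {P : Type*} [CommMonoid N] [CommMonoid P]

/-- The homomorphism of group envelopes induced by a homomorphism of monoids, as a linear map. -/
noncomputable def gpLinearMap (ψ : N →* P) :
    Additive (Algebra.GrothendieckGroup N) →ₗ[ℤ] Additive (Algebra.GrothendieckGroup P) :=
  (MonoidHom.toAdditive (gpMap ψ)).toIntLinearMap

@[simp]
theorem gpLinearMap_gpOf (ψ : N →* P) (a : N) : gpLinearMap ψ (gpOf a) = gpOf (ψ a) :=
  congrArg Additive.ofMul (DFunLike.congr_fun (Algebra.GrothendieckGroup.lift.symm_apply_apply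
    ((Algebra.GrothendieckGroup.of (M := P)).comp ψ)) a)

theorem gpLinearMap_surjective {ψ : N →* P} (hψ : Function.Surjective ψ) :
    Function.Surjective (gpLinearMap ψ) := by
  intro y
  obtain ⟨a, b, rfl⟩ := exists_gpOf_sub y
  obtain ⟨a, rfl⟩ := hψ a
  obtain ⟨b, rfl⟩ := hψ b
  exact ⟨gpOf a - gpOf b, by simp⟩

end GpLinearMap

theorem exists_linearEquiv_ker_prod {R A B : Type*} [CommRing R] [AddCommGroup A] [AddCommGroup B]
    [Module R A] [Module R B] [Module.Projective R B] {g : A →ₗ[R] B}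
    (hg : Function.Surjective g) :
    ∃ e : A ≃ₗ[R] LinearMap.ker g × B, ∀ x, (e x).2 = g x := by
  obtain ⟨s, hs⟩ := Module.projective_lifting_property g LinearMap.id hg
  obtain ⟨e, -, he⟩ := (LinearMap.exact_subtype_ker_map g).splitSurjectiveEquiv
    Subtype.val_injective ⟨s, hs⟩
  exact ⟨e, fun x => (LinearMap.congr_fun he x).symm⟩

section

variable {N : Type*} {P : Type*} [CommMonoid N] [CommMonoid P] [IsCancelMul N] [IsCancelMul P]

theorem exists_torus_splitting [Monoid.FG N]
    [Module.Free ℤ (Additive (Algebra.GrothendieckGroup N))]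
    [Module.Free ℤ (Additive (Algebra.GrothendieckGroup P))] (ψ : N →* P)
    (hψ : Function.Surjective (gpMap ψ)) :
    ∃ (r : ℕ) (θ : N →* Multiplicative (Fin r → ℤ)), gpRank N = gpRank P + r ∧
      Function.Injective (ψ.prod θ) ∧ ∀ q, ∃ a b, ψ.prod θ a = q * ψ.prod θ b := by
  have hsurj : Function.Surjective (gpLinearMap ψ) := hψ
  have := Module.Finite.of_surjective _ hsurj
  obtain ⟨e, he⟩ := exists_linearEquiv_ker_prod hsurj
  let b := (Module.finBasis ℤ (LinearMap.ker (gpLinearMap ψ))).equivFun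
  let θ : N →* Multiplicative (Fin _ → ℤ) :=
    { toFun n := Multiplicative.ofAdd (b (e (gpOf n)).1)
      map_one' := by simp
      map_mul' m n := by simp }
  have e_gpOf (n : N) : e (gpOf n) = (b.symm (θ n).toAdd, gpOf (ψ n)) :=
    Prod.ext (by simp [θ]) (by simp [he])
  refine ⟨_, θ, ?_, fun m n h => ?_, fun ⟨p, l⟩ => ?_⟩
  · rw [gpRank, e.finrank_eq, Module.finrank_prod, add_comm, gpRank]
  · obtain ⟨hψ, hθ⟩ := Prod.ext_iff.1 h
    refine gpOf_injective (e.injective ?_)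
    simp only [MonoidHom.prod_apply] at hψ hθ
    rw [e_gpOf, e_gpOf, hψ, hθ]
  · obtain ⟨m, n, h⟩ := exists_gpOf_sub (e.symm (b.symm l.toAdd, gpOf p))
    rw [LinearEquiv.symm_apply_eq, map_sub, e_gpOf, e_gpOf, eq_sub_iff_add_eq] at h
    obtain ⟨hθ, hψ⟩ := Prod.ext_iff.1 h
    refine ⟨m, n, Prod.ext (gpOf_injective ?_) (Multiplicative.toAdd.injective ?_)⟩
    · simpa using hψ.symm
    · simpa using (b.symm.injective (by simpa using hθ)).symm

theorem exists_rightInverse_of_associated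
    [Module.Projective ℤ (Additive (Algebra.GrothendieckGroup P))]
    {μ : N →* P} (hμ : Function.Surjective μ) (h : ∀ a b, μ a = μ b → Associated a b) :
    ∃ σ : P →* N, Function.RightInverse σ μ := by
  obtain ⟨s, hs⟩ := Module.projective_lifting_property (gpLinearMap μ) LinearMap.id
    (gpLinearMap_surjective hμ)
  replace hs (y) : gpLinearMap μ (s y) = y := LinearMap.congr_fun hs y
  have exists_lift (p : P) : ∃ n : N, gpOf n = s (gpOf p) := by
    obtain ⟨n, rfl⟩ := hμ p
    obtain ⟨a, b, hab⟩ := exists_gpOf_sub (s (gpOf (μ n)) - gpOf n)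
    have hμab : μ b = μ a := by
      have := congrArg (gpLinearMap μ) hab
      rw [map_sub, hs, gpLinearMap_gpOf, sub_self, map_sub, eq_comm, sub_eq_zero] at this
      simpa using (gpOf_injective (by simpa using this)).symm
    obtain ⟨c, hc⟩ := h b a hμab
    rw [← hc, gpOf_mul, add_sub_cancel_left] at hab
    exact ⟨n * c, by rw [gpOf_mul, ← hab, add_sub_cancel]⟩
  choose σ hσ using exists_lift
  refine ⟨⟨⟨σ, gpOf_injective (by simp [hσ])⟩, fun p q => gpOf_injective (by simp [hσ])⟩,
    fun p => ?_⟩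
  exact gpOf_injective (by rw [← gpLinearMap_gpOf]; exact (congrArg _ (hσ p)).trans (hs _))

end

theorem exists_unitPart {M N : Type*} [CommMonoid M] [CommMonoid N] [IsCancelMul M]
    {μ : M →* N} {σ : N →* M} (h : ∀ m, Associated (σ (μ m)) m) :
    ∃ c : M →* Mˣ, ∀ m, m = σ (μ m) * c m := by
  choose c hc using h
  refine ⟨⟨⟨c, Units.ext (mul_left_cancel (a := σ (μ 1)) ?_)⟩,
    fun a b => Units.ext (mul_left_cancel (a := σ (μ (a * b))) ?_)⟩, fun m => (hc m).symm⟩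
  · rw [hc, map_one, map_one, one_mul, Units.val_one]
  · rw [hc, Units.val_mul, map_mul, map_mul, mul_mul_mul_comm, hc, hc]

theorem exists_monoidHom_extension {N Q M : Type*} [CommMonoid N] [CommMonoid Q]
    [CommMonoid M] [IsCancelMul M] (ι : N →* Q) (hι : Function.Injective ι)
    (hs : ∀ q, ∃ a b, ι a = q * ι b) (f : N →* M)
    (hd : ∀ q a b, ι a = q * ι b → f b ∣ f a) :
    ∃ E : Q →* M, ∀ q a b, ι a = q * ι b → f a = E q * f b := by
  choose a b hab using hs
  choose e he using fun q => hd q _ _ (hab q)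
  have f_eq (q a' b') (h : ι a' = q * ι b') : f a' = e q * f b' := by
    have hcross : a' * b q = a q * b' := hι (by
      rw [map_mul, map_mul, h, hab, mul_assoc, mul_assoc, mul_comm (ι b')])
    have hf := congrArg f hcross
    rw [map_mul, map_mul, he] at hf
    refine mul_right_cancel (b := f (b q)) (hf.trans ?_)
    ac_rfl
  have e_unique (q m a' b') (h : ι a' = q * ι b') (h' : f a' = m * f b') : e q = m :=
    mul_right_cancel ((f_eq q a' b' h).symm.trans h')
  refine ⟨⟨⟨e, e_unique 1 1 1 1 (by simp) (by simp)⟩, fun q q' =>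
    e_unique _ _ (a q * a q') (b q * b q') ?_ ?_⟩, f_eq⟩
  · rw [map_mul, map_mul, hab, hab, mul_mul_mul_comm]
  · rw [map_mul, map_mul, he, he, mul_mul_mul_comm, mul_comm]

namespace MonoidSheaf

variable {X : Type u} [TopologicalSpace X] (M : MonoidSheaf.{u, v} X)

theorem restrict_mem {U V : Opens X} (h : V ≤ U) {s : ∀ x : U, M.stalk x}
    (hs : s ∈ M.sections U) : (fun x : V => s ⟨x, h x.2⟩) ∈ M.sections V :=
  M.locality _ _ fun _ hx => ⟨U, h hx, s, hs, fun _ _ _ => rfl⟩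

theorem exists_cosp {x y : X} (h : x ⤳ y) (m : M.stalk y) :
    ∃ m' : M.stalk x, ∀ (U : Opens X) (s : ∀ z : U, M.stalk z), s ∈ M.sections U →
      ∀ (hx : x ∈ U) (hy : y ∈ U), s ⟨y, hy⟩ = m → s ⟨x, hx⟩ = m' := by
  obtain ⟨U, hy, s, hs, rfl⟩ := M.exists_germ y m
  refine ⟨s ⟨x, h.mem_open U.2 hy⟩, fun V t ht hx hyV e => ?_⟩
  obtain ⟨W, hW, hWe⟩ := M.germ_eq V U t s ht hs y hyV hy e
  exact hWe x _ _ (h.mem_open W.2 hW)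

/-- The cospecialisation homomorphism on stalks. -/
noncomputable def cosp {x y : X} (h : x ⤳ y) : M.stalk y →* M.stalk x where
  toFun m := (M.exists_cosp h m).choose
  map_one' := ((M.exists_cosp h 1).choose_spec ⊤ 1 (M.sections ⊤).one_mem trivial trivial rfl).symm
  map_mul' m n := by
    obtain ⟨U, hU, s, hs, rfl⟩ := M.exists_germ y m
    obtain ⟨V, hV, t, ht, rfl⟩ := M.exists_germ y n
    rw [← (M.exists_cosp h _).choose_spec U s hs (h.mem_open U.2 hU) hU rfl,
      ← (M.exists_cosp h _).choose_spec V t ht (h.mem_open V.2 hV) hV rfl]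
    exact ((M.exists_cosp h _).choose_spec (U ⊓ V) _
      (mul_mem (M.restrict_mem inf_le_left hs) (M.restrict_mem inf_le_right ht))
      (h.mem_open (U ⊓ V).2 ⟨hU, hV⟩) ⟨hU, hV⟩ rfl).symm

theorem cosp_section {x y : X} (h : x ⤳ y) {U : Opens X} {s : ∀ z : U, M.stalk z}
    (hs : s ∈ M.sections U) (hx : x ∈ U) (hy : y ∈ U) : M.cosp h (s ⟨y, hy⟩) = s ⟨x, hx⟩ :=
  ((M.exists_cosp h _).choose_spec U s hs hx hy rfl).symm

@[simp] theorem cosp_refl {x : X} (h : x ⤳ x) (m : M.stalk x) : M.cosp h m = m := by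
  obtain ⟨U, hU, s, hs, rfl⟩ := M.exists_germ x m
  exact M.cosp_section h hs hU hU

theorem cosp_cosp {x y z : X} (h : x ⤳ y) (h' : y ⤳ z) (m : M.stalk z) :
    M.cosp h (M.cosp h' m) = M.cosp (h.trans h') m := by
  obtain ⟨U, hU, s, hs, rfl⟩ := M.exists_germ z m
  have hy := h'.mem_open U.2 hU
  have hx := h.mem_open U.2 hy
  rw [M.cosp_section h' hs hy hU, M.cosp_section h hs hx hy, M.cosp_section _ hs hx hU]

theorem exists_unit_section {x : X} (c : (M.stalk x)ˣ) : ∃ (U : Opens X) (hx : x ∈ U)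
    (s : ∀ y : U, (M.stalk y)ˣ), (fun y : U => (s y : M.stalk y)) ∈ M.sections U ∧
      (fun y : U => ((s y)⁻¹.1 : M.stalk y)) ∈ M.sections U ∧ s ⟨x, hx⟩ = c := by
  obtain ⟨A, hA, p, hp, ep⟩ := M.exists_germ x (c : M.stalk x)
  obtain ⟨B, hB, q, hq, eq⟩ := M.exists_germ x (c⁻¹.1 : M.stalk x)
  obtain ⟨W, hW, h⟩ := M.germ_eq (A ⊓ B) ⊤ _ 1
    (mul_mem (M.restrict_mem inf_le_left hp) (M.restrict_mem inf_le_right hq))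
    (M.sections ⊤).one_mem x ⟨hA, hB⟩ trivial (by simp [ep, eq])
  refine ⟨W ⊓ (A ⊓ B), ⟨hW, hA, hB⟩, fun y => Units.mkOfMulEqOne (p ⟨y, y.2.2.1⟩) (q ⟨y, y.2.2.2⟩)
    (h y y.2.2 trivial y.2.1), ?_, ?_, Units.ext ep⟩
  · exact M.restrict_mem (inf_le_right.trans inf_le_left) hp
  · exact M.restrict_mem (inf_le_right.trans inf_le_right) hq

theorem mk_mem_sharp {U : Opens X} {s : ∀ x : U, M.stalk x} (hs : s ∈ M.sections U) :
    (fun x : U => (Associates.mk (s x) : M.sharp.stalk x)) ∈ M.sharp.sections U :=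
  fun _ hx => ⟨⊤, U, trivial, hx, _, ⟨s, hs, fun _ => rfl⟩, fun _ _ _ _ => rfl⟩

end MonoidSheaf

theorem MonoidalSpace.Hom.ext_of_sections {X : MonoidalSpace.{u}} {Y : MonoidalSpace.{v}}
    {f g : MonoidalSpace.Hom X Y} (h : ∀ x, f x = g x)
    (h' : ∀ (x : X) (V : Opens Y), ∀ s ∈ Y.sheaf.sections V, ∀ (hf : f x ∈ V) (hg : g x ∈ V),
      f.stalkMap x (s ⟨f x, hf⟩) = g.stalkMap x (s ⟨g x, hg⟩)) : f = g := by
  obtain ⟨f, hf, fs, _, _⟩ := f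
  obtain ⟨g, hg, gs, _, _⟩ := g
  obtain rfl : f = g := funext h
  congr 1
  funext x
  ext m
  obtain ⟨V, hV, s, hs, rfl⟩ := Y.sheaf.exists_germ (f x) m
  exact h' x V s hs hV hV

namespace LogScheme

theorem Hom.ext_of_sections {T X : LogScheme.{u}} {f g : Hom T X} (h : f.base = g.base)
    (h' : ∀ (t : T.X) (V : X.X.Opens), ∀ s ∈ X.M.sections V, ∀ (hf : f.base t ∈ V)
      (hg : g.base t ∈ V), f.stalkMap t (s ⟨f.base t, hf⟩) = g.stalkMap t (s ⟨g.base t, hg⟩)) :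
    f = g := by
  obtain ⟨f, fs, _, _⟩ := f
  obtain ⟨g, gs, _, _⟩ := g
  obtain rfl : f = g := h
  congr 1
  funext x
  ext m
  obtain ⟨V, hV, s, hs, rfl⟩ := X.M.exists_germ (f x) m
  exact h' x V s hs hV hV

/-! ### Stalks of fs log schemes -/

section Chart

variable {X : LogScheme.{u}} {U : X.X.Opens} {P : Type u} [CommMonoid P]

/-- The values at a point of the sections in a chart. -/
def chartEval (β : P →* X.M.sections U) (y : U) : P →* X.M.stalk y :=
  ((Pi.evalMonoidHom (fun y : U => X.M.stalk y) y).comp (X.M.sections U).subtype).comp β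

/-- The face of a chart of elements that are invertible at a point. -/
def chartFace (β : P →* X.M.sections U) (y : U) : Face P :=
  ⟨(IsUnit.submonoid (X.M.stalk y)).comap (chartEval β y), fun a b h => by
    rw [Submonoid.mem_comap, map_mul] at h
    exact isUnit_of_mul_isUnit_left h⟩

theorem IsChart.mk_eq_mk_iff {β : P →* X.M.sections U} (h : X.IsChart U β) (y : U) (p q : P) :
    Associates.mk (chartEval β y p) = Associates.mk (chartEval β y q) ↔
      ∃ f ∈ (chartFace β y).1, ∃ g ∈ (chartFace β y).1, p * f = q * g := by
  rw [Associates.mk_eq_mk_iff_associated]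
  constructor
  · rintro ⟨c, hc⟩
    obtain ⟨f, g, hf, hg, e, -⟩ :=
      h.injective y p q c 1 (hc.trans (by rw [Units.val_one, mul_one]; rfl))
    exact ⟨f, hf, g, hg, e⟩
  · rintro ⟨f, hf, g, hg, e⟩
    calc Associated (chartEval β y p) (chartEval β y p * chartEval β y f) :=
          associated_mul_unit_right _ _ hf
      _ = chartEval β y q * chartEval β y g := by rw [← map_mul, e, map_mul]
      Associated _ (chartEval β y q) := associated_mul_unit_left _ _ hg

theorem IsChart.exists_associated {β : P →* X.M.sections U} (h : X.IsChart U β) (y : U)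
    (m : X.M.stalk y) : ∃ p, Associated (chartEval β y p) m := by
  obtain ⟨p, a, rfl⟩ := h.surjective y m
  exact ⟨p, a, rfl⟩

theorem IsChart.isFsMonoid_associates {β : P →* X.M.sections U} (h : X.IsChart U β)
    (hP : IsFsMonoid P) (y : U) : IsFsMonoid (Associates (X.M.stalk y)) := by
  refine hP.of_face_quotient (π := Associates.mkMonoidHom.comp (chartEval β y))
    (Associates.mk_surjective.forall.2 fun m => ?_) (h.mk_eq_mk_iff y)
  obtain ⟨p, hp⟩ := h.exists_associated y m
  exact ⟨p, Associates.mk_eq_mk_iff_associated.2 hp⟩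

theorem IsChart.isCancelMul [IsCancelMul P] {β : P →* X.M.sections U} (h : X.IsChart U β)
    (y : U) : IsCancelMul (X.M.stalk y) := by
  have : IsLeftCancelMul (X.M.stalk y) := ⟨fun n m m' e => by
    obtain ⟨p, a, rfl⟩ := h.surjective y m
    obtain ⟨q, b, rfl⟩ := h.surjective y m'
    obtain ⟨r, c, rfl⟩ := h.surjective y n
    obtain ⟨f, g, hf, hg, hfg, hunits⟩ := h.injective y (r * p) (r * q) (c * a) (c * b) (by
      simp only [map_mul, Submonoid.coe_mul, Pi.mul_apply, Units.val_mul]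
      simp only at e
      rwa [mul_mul_mul_comm, mul_mul_mul_comm ((β r).1 y) (c : X.M.stalk y) ((β q).1 y)] at e)
    rw [mul_assoc, mul_assoc] at hfg
    have hβ := congrArg (fun a => (β a).1 y) (mul_left_cancel hfg)
    simp only [map_mul, Submonoid.coe_mul, Pi.mul_apply] at hβ
    simp only [Units.val_mul, mul_assoc] at hunits
    have hab := (Units.mul_right_inj c).1 hunits
    refine (hf.mul hg).mul_left_injective (?_ : _ * _ = _ * _)
    calc (β p).1 y * a * ((β f).1 y * (β g).1 y)
        = ((β p).1 y * (β f).1 y) * (a * (β g).1 y) := by ac_rfl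
      _ = (β q).1 y * b * ((β f).1 y * (β g).1 y) := by rw [hβ, hab]; ac_rfl⟩
  exact CommMagma.IsLeftCancelMul.toIsCancelMul _

theorem IsFs.isCancelMul (h : X.IsFs) (x : X.X) : IsCancelMul (X.M.stalk x) := by
  obtain ⟨U, hx, P, _, β, hP, hβ⟩ := h x
  have := hP.cancel
  exact hβ.isCancelMul ⟨x, hx⟩

theorem IsFs.isFsMonoid_associates (h : X.IsFs) (x : X.X) :
    IsFsMonoid (Associates (X.M.stalk x)) := by
  obtain ⟨U, hx, P, _, β, hP, hβ⟩ := h x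
  exact hβ.isFsMonoid_associates hP ⟨x, hx⟩

/-- The homomorphism `M_x → M_y^♯` for a specialisation `y ⤳ x`. -/
noncomputable def charMap (X : LogScheme.{u}) {x y : X.X} (h : y ⤳ x) :
    X.M.stalk x →* Associates (X.M.stalk y) :=
  Associates.mkMonoidHom.comp (X.M.cosp h)

theorem charMap_section {x y : X.X} (h : y ⤳ x) {U : X.X.Opens} {s : ∀ z : U, X.M.stalk z}
    (hs : s ∈ X.M.sections U) (hx : x ∈ U) (hy : y ∈ U) :
    X.charMap h (s ⟨x, hx⟩) = Associates.mk (s ⟨y, hy⟩) :=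
  congrArg Associates.mk (X.M.cosp_section h hs hy hx)

theorem α_cosp {x y : X.X} (h : y ⤳ x) (m : X.M.stalk x) :
    X.α y (X.M.cosp h m) = X.X.presheaf.stalkSpecializes h (X.α x m) := by
  obtain ⟨U, hU, s, hs, rfl⟩ := X.M.exists_germ x m
  have hy := h.mem_open U.2 hU
  obtain ⟨V, hV, f, hf⟩ := X.α_sections U s hs x hU
  rw [X.M.cosp_section h hs hy hU, hf y hy (h.mem_open V.2 hV), hf x hU hV]
  exact (TopCat.Presheaf.germ_stalkSpecializes_apply X.X.presheaf hV h f).symm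

theorem IsCharPoint.isUnit_of_isUnit_cosp {x : X.X} {y : X.fan} (h : X.IsCharPoint x y)
    {m : X.M.stalk x} (hm : IsUnit (X.M.cosp h.choose m)) : IsUnit m := by
  by_contra hm'
  have hα : X.α x m ∈ X.logIdeal x := Ideal.subset_span ⟨m, hm', rfl⟩
  rw [h.choose_spec, Ideal.mem_comap, IsLocalRing.mem_maximalIdeal] at hα
  exact hα (α_cosp h.choose m ▸ hm.map (X.α y.1))

theorem IsCharPoint.charMap_surjective (hX : X.IsFs) {x : X.X} {y : X.fan}
    (h : X.IsCharPoint x y) : Function.Surjective (X.charMap h.choose) := by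
  refine Associates.mk_surjective.forall.2 fun m => ?_
  obtain ⟨U, hx, P, _, β, -, hβ⟩ := hX x
  have hy : y.1 ∈ U := h.choose.mem_open U.2 hx
  obtain ⟨p, hp⟩ := hβ.exists_associated ⟨y.1, hy⟩ m
  exact ⟨(β p).1 ⟨x, hx⟩, (charMap_section _ (β p).2 hx hy).trans
    (Associates.mk_eq_mk_iff_associated.2 hp)⟩

/- An element of a chart at `x` that becomes invertible at the characteristic point is already
invertible at `x`, so both stalks are the quotient of the chart by the same face. -/
theorem IsCharPoint.associated_of_charMap_eq (hX : X.IsFs) {x : X.X} {y : X.fan}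
    (h : X.IsCharPoint x y) {a b : X.M.stalk x} (e : X.charMap h.choose a = X.charMap h.choose b) :
    Associated a b := by
  obtain ⟨U, hx, P, _, β, -, hβ⟩ := hX x
  have hy : y.1 ∈ U := h.choose.mem_open U.2 hx
  obtain ⟨p, hp⟩ := hβ.exists_associated ⟨x, hx⟩ a
  obtain ⟨q, hq⟩ := hβ.exists_associated ⟨x, hx⟩ b
  have charMap_of_associated {m : X.M.stalk x} {p : P}
      (hpm : Associated (chartEval β ⟨x, hx⟩ p) m) :
      X.charMap h.choose m = Associates.mk (chartEval β ⟨y.1, hy⟩ p) :=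
    (associated_iff_eq.1 (hpm.map (X.charMap h.choose))).symm.trans
      (charMap_section _ (β p).2 hx hy)
  have chartFace_le : (chartFace β ⟨y.1, hy⟩).1 ≤ (chartFace β ⟨x, hx⟩).1 := fun f hf =>
    h.isUnit_of_isUnit_cosp ((X.M.cosp_section h.choose (β f).2 hy hx).symm ▸ hf)
  rw [charMap_of_associated hp, charMap_of_associated hq, hβ.mk_eq_mk_iff ⟨y.1, hy⟩] at e
  obtain ⟨f, hf, g, hg, e⟩ := e
  have hpq := (hβ.mk_eq_mk_iff ⟨x, hx⟩ p q).2 ⟨f, chartFace_le hf, g, chartFace_le hg, e⟩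
  exact hp.symm.trans ((Associates.mk_eq_mk_iff_associated.1 hpq).trans hq)

end Chart
end LogScheme

/-! ### The structure sheaf of a scheme as a sheaf of monoids -/

section StructSheaf

variable {S : Scheme.{u}}

theorem germ_ext {U : S.Opens} {f g : Γ(S, U)}
    (h : ∀ (x : S) (hx : x ∈ U), S.presheaf.germ U x hx f = S.presheaf.germ U x hx g) : f = g :=
  TopCat.Presheaf.section_ext S.sheaf U f g h

theorem exists_glue {U : S.Opens} (s : ∀ x : U, S.presheaf.stalk x.1)
    (h : ∀ x ∈ U, ∃ (V : S.Opens) (_ : x ∈ V) (f : Γ(S, V)),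
      ∀ (y : S) (hU : y ∈ U) (hV : y ∈ V), s ⟨y, hU⟩ = S.presheaf.germ V y hV f) :
    ∃ f : Γ(S, U), ∀ x : U, s x = S.presheaf.germ U x.1 x.2 f := by
  choose V hV f hf using h
  let W : U → S.Opens := fun x => V x.1 x.2 ⊓ U
  let fW : ∀ x : U, Γ(S, W x) := fun x => S.presheaf.map (homOfLE inf_le_left).op (f x.1 x.2)
  have hW : ∀ (x : U) (y : S) (hy : y ∈ W x), S.presheaf.germ (W x) y hy (fW x) = s ⟨y, hy.2⟩ := by
    intro x y hy
    rw [hf x.1 x.2 y hy.2 hy.1]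
    exact S.presheaf.germ_res_apply (homOfLE inf_le_left) y hy (f x.1 x.2)
  obtain ⟨g, hg, -⟩ := TopCat.Sheaf.existsUnique_gluing' S.sheaf W U
    (fun x => homOfLE inf_le_right) (fun x hx => by
      rw [Opens.mem_iSup]
      exact ⟨⟨x, hx⟩, hV x hx, hx⟩) fW (by
      intro x x'
      refine germ_ext fun y hy => ?_
      refine (S.presheaf.germ_res_apply (Opens.infLELeft _ _) y hy (fW x)).trans
        (Eq.trans ?_ (S.presheaf.germ_res_apply (Opens.infLERight _ _) y hy (fW x')).symm)
      rw [hW, hW])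
  refine ⟨g, fun x => ?_⟩
  rw [← hW x x.1 ⟨hV x.1 x.2, x.2⟩, ← hg x]
  exact S.presheaf.germ_res_apply (homOfLE inf_le_right) x.1 _ g

/-- The multiplicative monoid of the structure sheaf. -/
noncomputable def structSheaf (S : Scheme.{u}) : MonoidSheaf.{u, u} S where
  stalk x := S.presheaf.stalk x
  sections U :=
    { carrier := {s | ∃ f : Γ(S, U), ∀ x : U, s x = S.presheaf.germ U x.1 x.2 f}
      one_mem' := ⟨1, fun x => (map_one _).symm⟩
      mul_mem' := by
        rintro a b ⟨f, hf⟩ ⟨g, hg⟩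
        exact ⟨f * g, fun x => by rw [Pi.mul_apply, hf, hg, map_mul]⟩ }
  locality U s h := exists_glue s fun x hx => by
    obtain ⟨V, hV, t, ⟨f, hf⟩, e⟩ := h x hx
    exact ⟨V, hV, f, fun y hU hyV => (e y hU hyV).trans (hf ⟨y, hyV⟩)⟩
  exists_germ x m := by
    obtain ⟨V, hx, f, hf⟩ := S.presheaf.exists_germ_eq m
    exact ⟨V, hx, fun y => S.presheaf.germ V y.1 y.2 f, ⟨f, fun _ => rfl⟩, hf⟩
  germ_eq := by
    rintro U V s t ⟨f, hf⟩ ⟨g, hg⟩ x hU hV e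
    rw [hf, hg] at e
    obtain ⟨W, hW, i, j, h⟩ := TopCat.Presheaf.germ_eq S.presheaf x hU hV f g e
    refine ⟨W, hW, fun y yU yV yW => ?_⟩
    rw [hf, hg]
    have h₁ := S.presheaf.germ_res_apply i y yW f
    have h₂ := S.presheaf.germ_res_apply j y yW g
    exact h₁.symm.trans ((congrArg _ h).trans h₂)

theorem germ_mem_structSheaf {U : S.Opens} (f : Γ(S, U)) :
    (fun x : U => (S.presheaf.germ U x.1 x.2 f : (structSheaf S).stalk x.1)) ∈
      (structSheaf S).sections U := ⟨f, fun _ => rfl⟩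

theorem structSheaf_pullback {T : Scheme.{u}} (i : T ⟶ S) {U : S.Opens}
    {s : ∀ x : U, S.presheaf.stalk x.1} (hs : s ∈ (structSheaf S).sections U) :
    (fun t : ↥(i ⁻¹ᵁ U) => (i.stalkMap t.1 (s ⟨i t.1, t.2⟩) : T.presheaf.stalk t.1)) ∈
      (structSheaf T).sections (i ⁻¹ᵁ U) := by
  obtain ⟨f, hf⟩ := hs
  exact ⟨i.app U f, fun t => (congrArg (i.stalkMap t.1) (hf ⟨i t.1, t.2⟩)).trans
    (Scheme.Hom.germ_stalkMap_apply i U t.1 t.2 f)⟩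

theorem exists_unit_germ {x : S} (c : (S.presheaf.stalk x)ˣ) :
    ∃ (U : S.Opens) (hx : x ∈ U) (s : ∀ y : U, (S.presheaf.stalk y.1)ˣ),
      (fun y : U => (s y : S.presheaf.stalk y.1)) ∈ (structSheaf S).sections U ∧
      (fun y : U => ((s y)⁻¹.1 : S.presheaf.stalk y.1)) ∈ (structSheaf S).sections U ∧
      s ⟨x, hx⟩ = c :=
  (structSheaf S).exists_unit_section (x := x) c

theorem LogScheme.α_mem {X : LogScheme.{u}} {U : X.X.Opens} {s : ∀ x : U, X.M.stalk x}
    (hs : s ∈ X.M.sections U) :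
    (fun x : U => (X.α x.1 (s x) : X.X.presheaf.stalk x.1)) ∈ (structSheaf X.X).sections U := by
  refine (structSheaf X.X).locality _ _ fun x hx => ?_
  obtain ⟨V, hV, f, hf⟩ := X.α_sections U s hs x hx
  exact ⟨V, hV, _, germ_mem_structSheaf f, hf⟩

theorem exists_germ_of_mem {U : S.Opens} {s : ∀ x : U, S.presheaf.stalk x.1}
    (hs : s ∈ (structSheaf S).sections U) (x : S) (hx : x ∈ U) :
    ∃ (V : S.Opens) (_ : x ∈ V) (f : Γ(S, V)), ∀ (y : S) (hU : y ∈ U) (hV : y ∈ V),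
      s ⟨y, hU⟩ = S.presheaf.germ V y hV f := by
  obtain ⟨f, hf⟩ := hs
  exact ⟨U, hx, f, fun y hU _ => hf ⟨y, hU⟩⟩

end StructSheaf

/-! ### Hollow log structures -/

namespace LogScheme

/-- The sheaf of monoids `P ⊕ 𝒪_S^×`. -/
noncomputable def hollowSheaf (S : Scheme.{u}) (P : Type u) [CommMonoid P] :
    MonoidSheaf.{u, u} S :=
  MonoidSheaf.ofBase (fun t : S => P × (S.presheaf.stalk t)ˣ)
    (fun U s => ∃ p : P, (∀ y : U, (s y).1 = p) ∧
      (fun y : U => ((s y).2 : S.presheaf.stalk y.1)) ∈ (structSheaf S).sections U)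
    ⟨1, fun _ => rfl, ((structSheaf S).sections ⊤).one_mem⟩
    (by
      rintro U V s t ⟨p, hp, hs⟩ ⟨q, hq, ht⟩
      refine ⟨p * q, fun y => congrArg₂ (· * ·) (hp _) (hq _), ?_⟩
      exact mul_mem ((structSheaf S).restrict_mem inf_le_left hs)
        ((structSheaf S).restrict_mem inf_le_right ht))
    (by
      rintro x ⟨p, c⟩
      obtain ⟨U, hx, s, hs, -, e⟩ := exists_unit_germ c
      exact ⟨U, hx, fun y => (p, s y), ⟨p, fun _ => rfl, hs⟩, congrArg (Prod.mk p) e⟩)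
    (by
      rintro U V s t ⟨p, hp, hs⟩ ⟨q, hq, ht⟩ x hU hV e
      obtain ⟨W, hW, h⟩ := (structSheaf S).germ_eq U V _ _ hs ht x hU hV
        (congrArg (fun a => (a.2 : S.presheaf.stalk x)) e)
      refine ⟨W, hW, fun y yU yV yW => Prod.ext ?_ (Units.ext (h y yU yV yW))⟩
      rw [hp, hq, ← hp ⟨x, hU⟩, ← hq ⟨x, hV⟩, e])

open Classical in
/-- The homomorphism `P ⊕ Aˣ → A` that vanishes outside `Aˣ`, for a sharp monoid `P`. -/
noncomputable def hollowHom (P : Type*) [CommMonoid P] [Subsingleton Pˣ]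
    (A : Type*) [MonoidWithZero A] : P × Aˣ →* A where
  toFun a := if a.1 = 1 then (a.2 : A) else 0
  map_one' := if_pos rfl
  map_mul' := by
    rintro ⟨p, a⟩ ⟨q, b⟩
    by_cases hp : p = 1 <;> by_cases hq : q = 1 <;> simp [hp, hq]

section HollowHom

variable {P : Type*} [CommMonoid P] [Subsingleton Pˣ] {A : Type*} [MonoidWithZero A]

theorem hollowHom_of_eq_one {a : P × Aˣ} (h : a.1 = 1) : hollowHom P A a = a.2 := if_pos h

theorem hollowHom_of_ne_one {a : P × Aˣ} (h : a.1 ≠ 1) : hollowHom P A a = 0 := if_neg h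

theorem existsUnique_hollowHom_eq_unit [Nontrivial A] (a : Aˣ) :
    ∃! m, hollowHom P A m = a := by
  refine ⟨(1, a), hollowHom_of_eq_one rfl, ?_⟩
  rintro ⟨p, b⟩ h
  by_cases hp : p = 1
  · rw [hollowHom_of_eq_one hp] at h
    exact Prod.ext hp (Units.ext h)
  · rw [hollowHom_of_ne_one hp] at h
    exact absurd h.symm a.ne_zero

end HollowHom

theorem hollowHom_mem_structSheaf {S : Scheme.{u}} {P : Type u} [CommMonoid P]
    [Subsingleton Pˣ] {U : S.Opens} {s : ∀ y : U, P × (S.presheaf.stalk y.1)ˣ}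
    (hs : s ∈ (hollowSheaf S P).sections U) :
    (fun y : U => hollowHom P (S.presheaf.stalk y.1) (s y)) ∈ (structSheaf S).sections U := by
  refine (structSheaf S).locality _ _ fun x hx => ?_
  obtain ⟨W, V, hW, hV, t, ⟨p, hp, ht⟩, e⟩ := hs x hx
  by_cases h : p = 1
  · refine ⟨V ⊓ W, ⟨hV, hW⟩, _, (structSheaf S).restrict_mem inf_le_left ht, fun y yU yV => ?_⟩
    refine (congrArg (hollowHom P (S.presheaf.stalk y)) (e y yU yV.1 yV.2)).trans ?_
    exact hollowHom_of_eq_one ((hp _).trans h)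
  · refine ⟨V ⊓ W, ⟨hV, hW⟩, _, germ_mem_structSheaf 0, fun y yU yV => ?_⟩
    refine (congrArg (hollowHom P (S.presheaf.stalk y)) (e y yU yV.1 yV.2)).trans ?_
    exact (hollowHom_of_ne_one (fun h' => h ((hp _).symm.trans h'))).trans (map_zero _).symm

/-- The hollow log scheme with underlying scheme `S` and `M = P ⊕ 𝒪_S^×`, where `α` vanishes outside
the units, for a sharp monoid `P`. -/
noncomputable def hollow (S : Scheme.{u}) (P : Type u) [CommMonoid P] [Subsingleton Pˣ] :
    LogScheme.{u} where
  X := S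
  M := hollowSheaf S P
  α t := hollowHom P (S.presheaf.stalk t)
  α_sections _ _ hs := exists_germ_of_mem (hollowHom_mem_structSheaf hs)
  existsUnique_unit _ a := existsUnique_hollowHom_eq_unit a

section UnitsOfProd

variable {P G : Type*} [CommMonoid P] [CommGroup G]

theorem exists_one_mul_unit_eq (m : P × G) : ∃ (p : P) (a : (P × G)ˣ), (p, 1) * (a : P × G) = m :=
  ⟨m.1, ⟨(1, m.2), (1, m.2⁻¹), by simp, by simp⟩, by simp⟩

theorem eq_and_eq_of_one_mul_unit_eq [Subsingleton Pˣ] {p q : P} {a b : (P × G)ˣ}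
    (h : (p, 1) * (a : P × G) = (q, 1) * (b : P × G)) : p = q ∧ a = b := by
  have fst_eq_one (a : (P × G)ˣ) : a.1.1 = 1 :=
    isUnit_iff_eq_one.1 (a.isUnit.map (MonoidHom.fst P G))
  have hp := congrArg Prod.fst h
  have ha := congrArg Prod.snd h
  simp only [Prod.fst_mul, Prod.snd_mul, fst_eq_one, mul_one, one_mul] at hp ha
  exact ⟨hp, Units.ext (Prod.ext ((fst_eq_one a).trans (fst_eq_one b).symm) ha)⟩

end UnitsOfProd

section Hollow

variable {S : Scheme.{u}} {P : Type u} [CommMonoid P]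

theorem prodMk_mem_hollowSheaf {U : S.Opens} (p : P) {s : ∀ y : U, (S.presheaf.stalk y.1)ˣ}
    (hs : (fun y : U => (s y : S.presheaf.stalk y.1)) ∈ (structSheaf S).sections U) :
    (fun y : U => ((p, s y) : P × (S.presheaf.stalk y.1)ˣ)) ∈ (hollowSheaf S P).sections U :=
  fun _ hx => ⟨⊤, U, trivial, hx, fun y => (p, s y), ⟨p, fun _ => rfl, hs⟩, fun _ _ _ _ => rfl⟩

theorem hollow_isFs [Subsingleton Pˣ] (hP : IsFsMonoid P) : (hollow S P).IsFs := by
  intro x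
  refine ⟨(⊤ : S.Opens), trivial, P, inferInstance,
    { toFun p := ⟨fun y => (p, 1),
        prodMk_mem_hollowSheaf (s := 1) p ((structSheaf S).sections ⊤).one_mem⟩
      map_one' := rfl
      map_mul' p q := Subtype.ext (funext fun y => Prod.ext rfl (mul_one _).symm) }, hP,
    ⟨fun y m => exists_one_mul_unit_eq (P := P) (G := (S.presheaf.stalk y.1)ˣ) m,
      fun y p q a b h => ?_⟩⟩
  obtain ⟨hpq, hab⟩ := eq_and_eq_of_one_mul_unit_eq (G := (S.presheaf.stalk y.1)ˣ) h
  exact ⟨1, 1, isUnit_one, isUnit_one, by rw [hpq], congrArg (fun c => Units.val c * _) hab⟩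

end Hollow
end LogScheme

/-! ### Pushouts along the units -/

section UnitPushout

variable {M : Type u} [CommMonoid M] {G : Type v} [CommGroup G]

/-- The congruence defining the pushout of `M` and `G` along a homomorphism `Mˣ → G`. -/
def unitPushoutCon (v : Mˣ →* G) : Con (M × G) where
  r a b := ∃ c : Mˣ, b.1 = a.1 * c ∧ a.2 = b.2 * v c
  iseqv :=
    { refl := fun a => ⟨1, by simp, by simp⟩
      symm := fun {a b} ⟨c, h, h'⟩ => ⟨c⁻¹, by rw [h, mul_assoc, Units.mul_inv, mul_one], by
        rw [h', map_inv, mul_assoc, mul_inv_cancel, mul_one]⟩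
      trans := fun ⟨c, h, h'⟩ ⟨d, k, k'⟩ => ⟨c * d, by rw [k, h, Units.val_mul, mul_assoc], by
        rw [h', k', map_mul, mul_assoc, mul_comm (v d)]⟩ }
  mul' := fun ⟨c, h, h'⟩ ⟨d, k, k'⟩ => ⟨c * d, by
      rw [Prod.fst_mul, Prod.fst_mul, h, k, Units.val_mul, mul_mul_mul_comm], by
      rw [Prod.snd_mul, Prod.snd_mul, h', k', map_mul, mul_mul_mul_comm]⟩

/-- The pushout of `M` and `G` along a homomorphism `Mˣ → G`. It turns a prelog structure into a log
structure. -/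
abbrev UnitPushout (v : Mˣ →* G) : Type _ := (unitPushoutCon v).Quotient

namespace UnitPushout

variable (v : Mˣ →* G)

/-- The canonical map from the product to the pushout. -/
def mk : M × G →* UnitPushout v := (unitPushoutCon v).mk'

theorem mk_surjective : Function.Surjective (mk v) := Con.mk'_surjective

variable {v}

theorem mk_eq_iff {a b : M × G} : mk v a = mk v b ↔ ∃ c : Mˣ, b.1 = a.1 * c ∧ a.2 = b.2 * v c :=
  Con.eq _

theorem mk_unit (c : Mˣ) (g : G) : mk v (c, g) = mk v (1, v c * g) :=
  mk_eq_iff.2 ⟨c⁻¹, by simp, by simp [mul_comm (v c), mul_assoc]⟩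

theorem mk_eq_mul (m : M) (g : G) : mk v (m, g) = mk v (m, 1) * mk v (1, g) := by
  rw [← map_mul, Prod.mk_mul_mk, mul_one, one_mul]

/-- The universal property of the pushout. -/
def lift {N : Type w} [CommMonoid N] (f : M →* N) (g : G →* N) (h : ∀ c : Mˣ, f c = g (v c)) :
    UnitPushout v →* N :=
  Con.lift _ (f.coprod g) (by
    rintro a b ⟨c, e, e'⟩
    rw [Con.ker_rel, MonoidHom.coprod_apply, MonoidHom.coprod_apply, e, e', map_mul, map_mul, h,
      mul_assoc, mul_comm (g b.2)])

variable {A : Type w} [CommMonoid A] (β : M →* A)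

/-- The structure map of the log structure associated with a prelog structure `β`: on the pushout of
`M` and `Aˣ` along `Mˣ`, it is induced by `β` and the inclusion of `Aˣ`. -/
noncomputable def structureMap : UnitPushout (Units.map β) →* A :=
  lift β (Units.coeHom A) fun _ => rfl

@[simp] theorem structureMap_mk (a : M × Aˣ) : structureMap β (mk _ a) = β a.1 * a.2 := rfl

variable {β}

theorem eq_mk_of_structureMap_eq (hβ : ∀ m, IsUnit (β m) → IsUnit m) {x : UnitPushout (Units.map β)}
    {a : Aˣ} (h : structureMap β x = a) : x = mk _ (1, a) := by
  obtain ⟨⟨m, c⟩, rfl⟩ := mk_surjective _ x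
  rw [structureMap_mk] at h
  obtain ⟨d, rfl⟩ := hβ m (isUnit_of_mul_isUnit_left (h ▸ a.isUnit))
  rw [mk_unit]
  exact congrArg (fun a => mk _ (1, a)) (Units.ext h)

theorem existsUnique_structureMap_eq (hβ : ∀ m, IsUnit (β m) → IsUnit m) (a : Aˣ) :
    ∃! x, structureMap β x = a :=
  ⟨mk _ (1, a), by simp, fun _ h => eq_mk_of_structureMap_eq hβ h⟩

theorem exists_eq_mul_unit {P : Type*} {π : P → M} (h : ∀ m, ∃ (p : P) (a : Mˣ), π p * a = m)
    (x : UnitPushout v) : ∃ (p : P) (a : (UnitPushout v)ˣ), mk v (π p, 1) * a = x := by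
  obtain ⟨⟨m, g⟩, rfl⟩ := mk_surjective _ x
  obtain ⟨p, a, rfl⟩ := h m
  refine ⟨p, Units.map (mk v) (MulEquiv.prodUnits.symm (a, toUnits g)), ?_⟩
  refine (map_mul (mk v) _ _).symm.trans (congrArg _ (Prod.ext rfl (one_mul _)))

theorem exists_unit_eq_mk (hβ : ∀ m, IsUnit (β m) → IsUnit m)
    (a : (UnitPushout (Units.map β))ˣ) : ∃ c : Aˣ, a.1 = mk _ (1, c) := by
  obtain ⟨c, hc⟩ := a.isUnit.map (structureMap β)
  exact ⟨c, eq_mk_of_structureMap_eq hβ hc.symm⟩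

theorem exists_of_mul_unit_eq (hβ : ∀ m, IsUnit (β m) → IsUnit m) {P : Type*} [CommMonoid P]
    {π : P →* M} (h : ∀ (p q : P) (a b : Mˣ), π p * a = π q * b →
      ∃ f g : P, IsUnit (π f) ∧ IsUnit (π g) ∧ p * f = q * g ∧ a * π g = b * π f)
    (p q : P) (a b : (UnitPushout (Units.map β))ˣ)
    (e : mk _ (π p, 1) * a.1 = mk _ (π q, 1) * b.1) :
    ∃ f g : P, IsUnit (π f) ∧ IsUnit (π g) ∧ p * f = q * g ∧
      a.1 * mk _ (π g, 1) = b.1 * mk _ (π f, 1) := by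
  obtain ⟨c, hc⟩ := exists_unit_eq_mk hβ a
  obtain ⟨d, hd⟩ := exists_unit_eq_mk hβ b
  rw [hc, hd, ← map_mul, ← map_mul, mk_eq_iff] at e
  obtain ⟨w, hπ, hunits⟩ := e
  simp only [Prod.mk_mul_mk, mul_one, one_mul] at hπ hunits
  obtain ⟨f, g, hf, hg, hfg, hw⟩ := h p q w 1 (by rw [← hπ, Units.val_one, mul_one])
  refine ⟨f, g, hf, hg, hfg, ?_⟩
  rw [hc, hd, ← map_mul, ← map_mul, mk_eq_iff]
  refine ⟨w, ?_, by simpa only [Prod.mk_mul_mk, mul_one] using hunits⟩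
  simp only [Prod.mk_mul_mk, mul_one, one_mul]
  rw [mul_comm, hw, Units.val_one, one_mul]

end UnitPushout

end UnitPushout

/-! ### Inverse images of log structures -/

namespace LogScheme

section PullbackLog

variable (Y : LogScheme.{u}) {S : Scheme.{u}} (i : S ⟶ Y.X)

/-- The homomorphism `M_{Y,i(t)} → 𝒪_{S,t}`. -/
noncomputable def pullbackα (t : S) : Y.M.stalk (i t) →* S.presheaf.stalk t :=
  (i.stalkMap t).hom.toMonoidHom.comp (Y.α (i t))

theorem isUnit_of_isUnit_pullbackα (t : S) (m : Y.M.stalk (i t))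
    (h : IsUnit (Y.pullbackα i t m)) : IsUnit m :=
  Y.isUnit_of_isUnit_α (isUnit_of_map_unit (i.stalkMap t).hom _ h)

theorem pullbackα_mem {V : Y.X.Opens} {m : ∀ y : V, Y.M.stalk y.1} (hm : m ∈ Y.M.sections V) :
    (fun t : ↥(i ⁻¹ᵁ V) => Y.pullbackα i t.1 (m ⟨i t.1, t.2⟩)) ∈
      (structSheaf S).sections (i ⁻¹ᵁ V) :=
  structSheaf_pullback i (α_mem hm)

/-- The stalks of the inverse image log structure. -/
abbrev PullbackStalk (t : S) : Type u := UnitPushout (Units.map (Y.pullbackα i t))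

/-- The basic sections of the inverse image log structure: those that come globally from a section
of the log structure and a section of units. -/
def IsPullbackBase (U : S.Opens) (s : ∀ t : U, Y.PullbackStalk i t.1) : Prop :=
  ∃ (V : Y.X.Opens) (hV : U ≤ i ⁻¹ᵁ V) (m : ∀ y : V, Y.M.stalk y.1)
    (c : ∀ t : U, (S.presheaf.stalk t.1)ˣ), m ∈ Y.M.sections V ∧
    (fun t : U => (c t : S.presheaf.stalk t.1)) ∈ (structSheaf S).sections U ∧
    ∀ t : U, s t = UnitPushout.mk _ (m ⟨i t.1, hV t.2⟩, c t)

theorem IsPullbackBase.germ_eq {U V : S.Opens} {s : ∀ t : U, Y.PullbackStalk i t.1}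
    {s' : ∀ t : V, Y.PullbackStalk i t.1} (hs : Y.IsPullbackBase i U s)
    (hs' : Y.IsPullbackBase i V s') {x : S} (hU : x ∈ U) (hV : x ∈ V)
    (e : s ⟨x, hU⟩ = s' ⟨x, hV⟩) : ∃ W : S.Opens, x ∈ W ∧
      ∀ (y : S) (hU : y ∈ U) (hV : y ∈ V), y ∈ W → s ⟨y, hU⟩ = s' ⟨y, hV⟩ := by
  obtain ⟨A, hA, m, c, hm, hc, es⟩ := hs
  obtain ⟨B, hB, m', c', hm', hc', es'⟩ := hs'
  rw [es, es', UnitPushout.mk_eq_iff] at e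
  obtain ⟨d, hmd, hcd⟩ := e
  obtain ⟨D, hD, p, hp, -, rfl⟩ := Y.M.exists_unit_section d
  obtain ⟨W, hW, hm'W⟩ := Y.M.germ_eq B (A ⊓ D) m' _ hm'
    (mul_mem (Y.M.restrict_mem inf_le_left hm) (Y.M.restrict_mem inf_le_right hp))
    (i x) (hB hV) ⟨hA hU, hD⟩ hmd
  obtain ⟨W', hW', hcW'⟩ := (structSheaf S).germ_eq U (V ⊓ i ⁻¹ᵁ D) _ _ hc
    (mul_mem ((structSheaf S).restrict_mem inf_le_left hc')
      ((structSheaf S).restrict_mem inf_le_right (pullbackα_mem Y i hp))) x hU ⟨hV, hD⟩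
    (congrArg Units.val hcd)
  refine ⟨W' ⊓ i ⁻¹ᵁ (W ⊓ D), ⟨hW', hW, hD⟩, fun y yU yV yW => ?_⟩
  rw [es, es', UnitPushout.mk_eq_iff]
  exact ⟨p ⟨i y, yW.2.2⟩, hm'W (i y) (hB yV) ⟨hA yU, yW.2.2⟩ yW.2.1,
    Units.ext (hcW' y yU ⟨yV, yW.2.2⟩ yW.1)⟩

/-- The sheaf of monoids of the inverse image log structure. -/
noncomputable def pullbackSheaf : MonoidSheaf.{u, u} S :=
  MonoidSheaf.ofBase (fun t : S => Y.PullbackStalk i t) (Y.IsPullbackBase i)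
    ⟨⊤, fun _ _ => trivial, 1, 1, one_mem _, ((structSheaf S).sections ⊤).one_mem,
      fun _ => (map_one _).symm⟩
    (by
      rintro U V s t ⟨A, hA, m, c, hm, hc, e⟩ ⟨B, hB, m', c', hm', hc', e'⟩
      refine ⟨A ⊓ B, fun x hx => ⟨hA hx.1, hB hx.2⟩, _,
        fun y => c ⟨y, y.2.1⟩ * c' ⟨y, y.2.2⟩,
        mul_mem (Y.M.restrict_mem inf_le_left hm) (Y.M.restrict_mem inf_le_right hm'),
        mul_mem ((structSheaf S).restrict_mem inf_le_left hc)
          ((structSheaf S).restrict_mem inf_le_right hc'), fun y => ?_⟩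
      exact (congrArg₂ (· * ·) (e ⟨y.1, y.2.1⟩) (e' ⟨y.1, y.2.2⟩)).trans
        (map_mul (UnitPushout.mk _) _ _).symm)
    (by
      intro x a
      obtain ⟨⟨m, c⟩, rfl⟩ := UnitPushout.mk_surjective _ a
      obtain ⟨A, hA, s, hs, rfl⟩ := Y.M.exists_germ (i x) m
      obtain ⟨B, hB, t, ht, -, rfl⟩ := exists_unit_germ c
      exact ⟨B ⊓ i ⁻¹ᵁ A, ⟨hB, hA⟩, fun y => UnitPushout.mk _ (s ⟨i y.1, y.2.2⟩, t ⟨y.1, y.2.1⟩),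
        ⟨A, inf_le_right, s, fun y => t ⟨y.1, y.2.1⟩, hs,
          (structSheaf S).restrict_mem inf_le_left ht, fun _ => rfl⟩, rfl⟩)
    (fun _ _ _ _ hs ht _ hU hV e => hs.germ_eq Y i ht hU hV e)

variable {Y i}

theorem pullbackSheaf_mem {U : S.Opens} {s : ∀ t : U, Y.PullbackStalk i t.1}
    (hs : Y.IsPullbackBase i U s) : s ∈ (Y.pullbackSheaf i).sections U :=
  fun _ hx => ⟨⊤, U, trivial, hx, s, hs, fun _ _ _ _ => rfl⟩

theorem structureMap_mem {U : S.Opens} {s : ∀ t : U, Y.PullbackStalk i t.1}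
    (hs : s ∈ (Y.pullbackSheaf i).sections U) :
    (fun t : U => UnitPushout.structureMap (Y.pullbackα i t.1) (s t)) ∈
      (structSheaf S).sections U := by
  refine (structSheaf S).locality _ _ fun x hx => ?_
  obtain ⟨W, V, hW, hV, t, ⟨A, hA, m, c, hm, hc, et⟩, e⟩ := hs x hx
  refine ⟨V ⊓ W, ⟨hV, hW⟩, _, (structSheaf S).restrict_mem inf_le_left
    (mul_mem ((structSheaf S).restrict_mem hA (pullbackα_mem Y i hm)) hc), fun y yU yV => ?_⟩
  exact congrArg (UnitPushout.structureMap (Y.pullbackα i y)) ((e y yU yV.1 yV.2).trans (et _))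

variable (Y i)

/-- The inverse image of a log structure under a morphism of schemes. -/
noncomputable def pullbackLog : LogScheme.{u} where
  X := S
  M := Y.pullbackSheaf i
  α t := UnitPushout.structureMap (Y.pullbackα i t)
  α_sections _ _ hs := exists_germ_of_mem (structureMap_mem hs)
  existsUnique_unit t a :=
    UnitPushout.existsUnique_structureMap_eq (Y.isUnit_of_isUnit_pullbackα i t) a

/-- The homomorphism to the stalk of the inverse image log structure. -/
noncomputable def pullbackStalkMap (t : S) : Y.M.stalk (i t) →* Y.PullbackStalk i t :=
  (UnitPushout.mk _).comp (MonoidHom.inl _ _)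

theorem pullbackStalkMap_mem {V : Y.X.Opens} {m : ∀ y : V, Y.M.stalk y.1}
    (hm : m ∈ Y.M.sections V) :
    (fun t : ↥(i ⁻¹ᵁ V) => Y.pullbackStalkMap i t.1 (m ⟨i t.1, t.2⟩)) ∈
      (Y.pullbackSheaf i).sections (i ⁻¹ᵁ V) :=
  pullbackSheaf_mem ⟨V, le_rfl, m, 1, hm, ((structSheaf S).sections _).one_mem, fun _ => rfl⟩

/-- The strict morphism from the inverse image log structure. -/
noncomputable def pullbackHom : Hom (Y.pullbackLog i) Y where
  base := i
  stalkMap t := Y.pullbackStalkMap i t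
  map_sections _ _ hs := Y.pullbackStalkMap_mem i hs
  α_stalkMap _ _ := mul_one _

theorem pullbackLog_isFs (hY : Y.IsFs) : (Y.pullbackLog i).IsFs := by
  intro x
  obtain ⟨U, hU, P, _, β, hP, hβ⟩ := hY (i x)
  refine ⟨i ⁻¹ᵁ U, hU, P, inferInstance,
    { toFun := fun p => ⟨_, Y.pullbackStalkMap_mem i (β p).2⟩
      map_one' := Subtype.ext (funext fun t => by rw [map_one]; exact map_one _)
      map_mul' := fun p q => Subtype.ext (funext fun t => by
        rw [map_mul]; exact map_mul (Y.pullbackStalkMap i t.1) _ _) }, hP, ⟨?_, ?_⟩⟩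
  · exact fun y m => UnitPushout.exists_eq_mul_unit (π := chartEval β ⟨i y.1, y.2⟩)
      (hβ.surjective ⟨i y.1, y.2⟩) m
  · intro y p q a b e
    obtain ⟨f, g, hf, hg, hfg, hab⟩ := UnitPushout.exists_of_mul_unit_eq
      (Y.isUnit_of_isUnit_pullbackα i y.1) (π := chartEval β ⟨i y.1, y.2⟩)
      (hβ.injective ⟨i y.1, y.2⟩) p q a b e
    exact ⟨f, g, hf.map (Y.pullbackStalkMap i y.1), hg.map (Y.pullbackStalkMap i y.1), hfg, hab⟩

end PullbackLog

theorem IsCompatible.comp {S T X : LogScheme.{u}} {F' : MonoidalSpace.{u}}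
    {φ : MonoidalSpace.Hom F' X.fan} {f : Hom T X} {g : MonoidalSpace.Hom T.sharp F'}
    (h : IsCompatible φ f g) (k : Hom S T) : IsCompatible φ (f.comp k) (g.comp k.sharp) := by
  intro t
  obtain ⟨hchar, hsections⟩ := h (k.base t)
  exact ⟨hchar, fun U s hs ht hy => congrArg (sharpMap (k.stalkMap t)) (hsections U s hs ht hy)⟩

end LogScheme

namespace MonoidalSpace.Hom

variable {X : MonoidalSpace.{u}} {Y : MonoidalSpace.{v}}

/-- The stalk map at `x` of a morphism that maps `x` to `y`. It avoids the transport of stalks along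
the equality `f x = y`. -/
noncomputable def stalkMapAt (f : Hom X Y) {x : X} {y : Y} (h : f x = y) :
    Y.stalk y →* X.stalk x :=
  (f.stalkMap x).comp (Y.sheaf.cosp (specializes_of_eq h))

theorem stalkMapAt_section (f : Hom X Y) {x : X} {y : Y} (h : f x = y) {U : Opens Y}
    {s : ∀ z : U, Y.stalk z.1} (hs : s ∈ Y.sheaf.sections U) (hy : y ∈ U) (hx : f x ∈ U) :
    f.stalkMapAt h (s ⟨y, hy⟩) = f.stalkMap x (s ⟨f x, hx⟩) :=
  congrArg (f.stalkMap x) (Y.sheaf.cosp_section (specializes_of_eq h) hs hx hy)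

theorem isUnit_of_isUnit_stalkMapAt (f : Hom X Y) {x : X} {y : Y} (h : f x = y) {m : Y.stalk y}
    (hm : IsUnit (f.stalkMapAt h m)) : IsUnit m := by
  subst h
  have hm' := f.isLocal x _ hm
  rwa [MonoidSheaf.cosp_refl] at hm'

theorem exists_forall_eq_stalkMapAt (f : Hom X Y) {x : X} {y : Y} (h : f x = y) {V : Opens X}
    {m : ∀ z : V, X.stalk z.1} (hm : m ∈ X.sheaf.sections V) (hx : x ∈ V) {p : Y.stalk y}
    (e : m ⟨x, hx⟩ = f.stalkMapAt h p) : ∃ W : Opens X, x ∈ W ∧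
      ∀ (z : X) (hz : z ∈ V) (hzy : f z = y), z ∈ W → m ⟨z, hz⟩ = f.stalkMapAt hzy p := by
  obtain ⟨A, hA, s, hs, rfl⟩ := Y.sheaf.exists_germ y p
  rw [f.stalkMapAt_section h hs hA (h ▸ hA)] at e
  obtain ⟨W, hW, hWe⟩ := X.sheaf.germ_eq V _ _ _ hm (f.map_sections A s hs) x hx
    (show f x ∈ A from h ▸ hA) e
  refine ⟨W, hW, fun z hz hzy hzW => ?_⟩
  rw [f.stalkMapAt_section hzy hs hA (hzy ▸ hA)]
  exact hWe z hz (show f z ∈ A from hzy ▸ hA) hzW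

end MonoidalSpace.Hom

namespace LogScheme

/-- The stalk map at `t` of a morphism that maps `t` to `x`. It avoids the transport of stalks along
the equality `f.base t = x`. -/
noncomputable def Hom.stalkMapAt {T X : LogScheme.{u}} (f : Hom T X) {t : T.X} {x : X.X}
    (h : f.base t = x) : X.M.stalk x →* T.M.stalk t :=
  (f.stalkMap t).comp (X.M.cosp (specializes_of_eq h))

theorem Hom.stalkMapAt_section {T X : LogScheme.{u}} (f : Hom T X) {t : T.X} {x : X.X}
    (h : f.base t = x) {U : X.X.Opens} {s : ∀ y : U, X.M.stalk y.1} (hs : s ∈ X.M.sections U)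
    (hx : x ∈ U) (ht : f.base t ∈ U) :
    f.stalkMapAt h (s ⟨x, hx⟩) = f.stalkMap t (s ⟨f.base t, ht⟩) :=
  congrArg (f.stalkMap t) (X.M.cosp_section (specializes_of_eq h) hs ht hx)

theorem Hom.stalkMap_stalkMapAt {T Y X : LogScheme.{u}} {f : Hom T Y} {b : Hom Y X} {g : Hom T X}
    (e : b.comp f = g) (t : T.X) {x : X.X} (hb : b.base (f.base t) = x) (hg : g.base t = x)
    (m : X.M.stalk x) : f.stalkMap t (b.stalkMapAt hb m) = g.stalkMapAt hg m := by
  subst e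
  rfl

/-! ### Charts of a subdivision at a point of a stratum -/

/-- The stalk map `M_{F(X),φ(x')} → M_{F',x'}` of a morphism to the fan, with its source written as
the characteristic monoid of `X`. -/
def subdivisionMap {X : LogScheme.{u}} {F' : MonoidalSpace.{u}}
    (φ : MonoidalSpace.Hom F' X.fan) (x' : F') :
    Associates (X.M.stalk (φ x').1) →* F'.stalk x' :=
  φ.stalkMap x'

/-- A splitting of the homomorphism `M_{X,x} → M_{F',x'}` at a point `x` of the stratum of `φ(x')`:
a homomorphism `torusPart` that makes `M_{F(X),φ(x')} → M_{F',x'} × ℤ^r` injective and surjective on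
groups, and a section `sec` of `M_{X,x} → M_{F(X),φ(x')}` with the projection `unitPart` onto the
units that belongs to it. -/
structure StratumChart {X : LogScheme.{u}} {F' : MonoidalSpace.{u}}
    (φ : MonoidalSpace.Hom F' X.fan) (x' : F') (x : X.X) where
  isCharPoint : X.IsCharPoint x (φ x')
  r : ℕ
  torusPart : Associates (X.M.stalk (φ x').1) →* Multiplicative (Fin r → ℤ)
  sec : Associates (X.M.stalk (φ x').1) →* X.M.stalk x
  unitPart : X.M.stalk x →* (X.M.stalk x)ˣ
  injective : Function.Injective ((subdivisionMap φ x').prod torusPart)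
  surjective : ∀ q, ∃ a c,
    (subdivisionMap φ x').prod torusPart a = q * (subdivisionMap φ x').prod torusPart c
  charMap_sec : ∀ n, X.charMap isCharPoint.choose (sec n) = n
  eq_sec_mul : ∀ m, m = sec (X.charMap isCharPoint.choose m) * unitPart m

namespace StratumChart

variable {X : LogScheme.{u}} {F' : MonoidalSpace.{u}} {φ : MonoidalSpace.Hom F' X.fan} {x' : F'}
  {x : X.X} (C : StratumChart φ x' x)

/-- The homomorphism `M_{F(X),φ(x')} → M_{F',x'} × ℤ^r` of a chart. -/
def splitting : Associates (X.M.stalk (φ x').1) →* F'.stalk x' × Multiplicative (Fin C.r → ℤ) :=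
  (subdivisionMap φ x').prod C.torusPart

/-- The homomorphism `M_{X,x} → M_{F(X),φ(x')}`. -/
noncomputable def char : X.M.stalk x →* Associates (X.M.stalk (φ x').1) :=
  X.charMap C.isCharPoint.choose

theorem unitPart_sec [IsCancelMul (X.M.stalk x)] (n) : C.unitPart (C.sec n) = 1 := by
  have h := C.eq_sec_mul (C.sec n)
  rw [C.charMap_sec] at h
  exact Units.ext (mul_left_cancel (h.symm.trans (mul_one _).symm))

theorem isUnit_of_subdivisionMap_char_eq_one {m : X.M.stalk x}
    (h : subdivisionMap φ x' (C.char m) = 1) : IsUnit m :=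
  C.isCharPoint.isUnit_of_isUnit_cosp
    (Associates.isUnit_mk.1 (φ.isLocal x' (C.char m) (h ▸ isUnit_one)))

theorem char_eq_one_of_isUnit {m : X.M.stalk x} (h : IsUnit m) : C.char m = 1 :=
  Associates.mk_eq_one.2 (h.map (X.M.cosp C.isCharPoint.choose))

theorem unitPart_of_isUnit {m : X.M.stalk x} (h : IsUnit m) :
    (C.unitPart m : X.M.stalk x) = m := by
  have hm := C.eq_sec_mul m
  rw [show X.charMap C.isCharPoint.choose m = 1 from C.char_eq_one_of_isUnit h, map_one,
    one_mul] at hm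
  exact hm.symm

section Compatible

variable {Y : LogScheme.{u}} {b : Hom Y X} {ρ : MonoidalSpace.Hom Y.sharp F'}

theorem stalkMapAt_subdivisionMap_char (hc : IsCompatible φ b ρ) {z : Y.X} (hb : b.base z = x)
    (hz : ρ z = x') (m : X.M.stalk x) :
    ρ.stalkMapAt hz (subdivisionMap φ x' (C.char m)) = Associates.mk (b.stalkMapAt hb m) := by
  subst hz hb
  obtain ⟨U, hU, s, hs, rfl⟩ := X.M.exists_germ (b.base z) m
  have hy : (φ (ρ z)).1 ∈ U := C.isCharPoint.choose.mem_open U.2 hU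
  have h := (hc z).2 U s hs hU hy
  rw [b.stalkMapAt_section rfl hs hU hU, ← h]
  refine congrArg (ρ.stalkMap z) ((MonoidSheaf.cosp_refl _ _ _).trans ?_)
  exact congrArg (φ.stalkMap (ρ z)) (charMap_section _ hs hU hy)

/-- The homomorphism `M_{F(X),φ(x')} → M_{Y,z}` given by the section `sec` at a point `z` over
`x`. -/
noncomputable def secStalk (b : Hom Y X) {z : Y.X} (hb : b.base z = x) :
    Associates (X.M.stalk (φ x').1) →* Y.M.stalk z :=
  (b.stalkMapAt hb).comp C.sec

theorem secStalk_eq_stalkMap {U : X.X.Opens} {s : ∀ y : U, X.M.stalk y.1}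
    (hs : s ∈ X.M.sections U) (hx : x ∈ U) {n} (e : s ⟨x, hx⟩ = C.sec n) {z : Y.X}
    (hb : b.base z = x) : C.secStalk b hb n = b.stalkMap z (s ⟨b.base z, hb ▸ hx⟩) := by
  rw [← b.stalkMapAt_section hb hs hx, e]
  rfl

theorem mk_secStalk (hc : IsCompatible φ b ρ) {z : Y.X} (hb : b.base z = x) (hz : ρ z = x') (n) :
    Associates.mk (C.secStalk b hb n) = ρ.stalkMapAt hz (subdivisionMap φ x' n) := by
  refine (C.stalkMapAt_subdivisionMap_char hc hb hz (C.sec n)).symm.trans ?_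
  exact congrArg (fun n => ρ.stalkMapAt hz (subdivisionMap φ x' n)) (C.charMap_sec n)

theorem exists_prodStalk (hY : Y.IsFs) (hc : IsCompatible φ b ρ) {z : Y.X} (hb : b.base z = x)
    (hz : ρ z = x') : ∃ E : F'.stalk x' × Multiplicative (Fin C.r → ℤ) →* Y.M.stalk z,
      ∀ q n k, C.splitting n = q * C.splitting k →
        C.secStalk b hb n = E q * C.secStalk b hb k := by
  have := hY.isCancelMul z
  refine exists_monoidHom_extension C.splitting C.injective C.surjective (C.secStalk b hb)
    fun q n k e => ?_
  rw [← Associates.mk_dvd_mk, C.mk_secStalk hc hb hz, C.mk_secStalk hc hb hz]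
  exact map_dvd _ ⟨q.1, (congrArg Prod.fst e).trans (mul_comm _ _)⟩

variable (hY : Y.IsFs) (hc : IsCompatible φ b ρ)

/-- The homomorphism `M_{F',x'} × ℤ^r → M_{Y,z}` that extends `secStalk`. -/
noncomputable def prodStalk {z : Y.X} (hb : b.base z = x) (hz : ρ z = x') :
    F'.stalk x' × Multiplicative (Fin C.r → ℤ) →* Y.M.stalk z :=
  (C.exists_prodStalk hY hc hb hz).choose

section Point

variable {z : Y.X} (hb : b.base z = x) (hz : ρ z = x')

theorem secStalk_eq_prodStalk_mul {q n k} (h : C.splitting n = q * C.splitting k) :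
    C.secStalk b hb n = C.prodStalk hY hc hb hz q * C.secStalk b hb k :=
  (C.exists_prodStalk hY hc hb hz).choose_spec q n k h

theorem prodStalk_splitting (n) :
    C.prodStalk hY hc hb hz (C.splitting n) = C.secStalk b hb n := by
  rw [C.secStalk_eq_prodStalk_mul hY hc hb hz (q := C.splitting n) (k := 1)
    (by rw [map_one, mul_one]), map_one, mul_one]

theorem mk_prodStalk (q) :
    Associates.mk (C.prodStalk hY hc hb hz q) = ρ.stalkMapAt hz q.1 := by
  have := (hY.isFsMonoid_associates z).cancel
  obtain ⟨n, k, h⟩ := C.surjective q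
  have hmk := congrArg Associates.mk (C.secStalk_eq_prodStalk_mul hY hc hb hz h)
  rw [← Associates.mk_mul_mk, C.mk_secStalk hc hb hz, C.mk_secStalk hc hb hz] at hmk
  exact mul_right_cancel (hmk.symm.trans
    ((congrArg (fun a => ρ.stalkMapAt hz a.1) h).trans (map_mul (ρ.stalkMapAt hz) _ _)))

end Point

theorem exists_forall_prodStalk_eq {z : Y.X} (hb : b.base z = x) (hz : ρ z = x')
    {V : Y.X.Opens} {m : ∀ y : V, Y.M.stalk y.1} (hm : m ∈ Y.M.sections V) (hzV : z ∈ V) {q}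
    (e : m ⟨z, hzV⟩ = C.prodStalk hY hc hb hz q) : ∃ W : Y.X.Opens, z ∈ W ∧
      ∀ (y : Y.X) (hy : y ∈ V) (hb : b.base y = x) (hz : ρ y = x'), y ∈ W →
        C.prodStalk hY hc hb hz q = m ⟨y, hy⟩ := by
  obtain ⟨n, k, h⟩ := C.surjective q
  obtain ⟨A, hA, s, hs, es⟩ := X.M.exists_germ x (C.sec n)
  obtain ⟨B, hB, t, ht, et⟩ := X.M.exists_germ x (C.sec k)
  obtain ⟨W, hW, hWe⟩ := Y.M.germ_eq (b.base ⁻¹ᵁ A) (V ⊓ b.base ⁻¹ᵁ B) _ _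
    (b.map_sections A s hs) (mul_mem (Y.M.restrict_mem inf_le_left hm)
      (Y.M.restrict_mem inf_le_right (b.map_sections B t ht))) z
    (show b.base z ∈ A from hb ▸ hA) ⟨hzV, show b.base z ∈ B from hb ▸ hB⟩
    ((C.secStalk_eq_stalkMap hs hA es hb).symm.trans
      ((C.secStalk_eq_prodStalk_mul hY hc hb hz h).trans
        (congrArg₂ (· * ·) e.symm (C.secStalk_eq_stalkMap ht hB et hb))))
  refine ⟨W, hW, fun y hy hb hz hyW => ?_⟩
  have := hY.isCancelMul y
  have hfrac := C.secStalk_eq_prodStalk_mul hY hc hb hz h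
  rw [C.secStalk_eq_stalkMap hs hA es, C.secStalk_eq_stalkMap ht hB et] at hfrac
  exact mul_right_cancel (hfrac.symm.trans
    (hWe y (show b.base y ∈ A from hb ▸ hA) ⟨hy, show b.base y ∈ B from hb ▸ hB⟩ hyW))

theorem exists_section_prodStalk {z : Y.X} (hb : b.base z = x) (hz : ρ z = x') (q) :
    ∃ (V : Y.X.Opens) (_ : z ∈ V) (m : ∀ y : V, Y.M.stalk y.1), m ∈ Y.M.sections V ∧
      (∀ (y : Y.X) (hy : y ∈ V) (hb : b.base y = x) (hz : ρ y = x'),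
        C.prodStalk hY hc hb hz q = m ⟨y, hy⟩) ∧
      ∀ (y : Y.X) (hy : y ∈ V) (hz : ρ y = x'),
        Associates.mk (m ⟨y, hy⟩) = ρ.stalkMapAt hz q.1 := by
  obtain ⟨D, hD, m, hm, em⟩ := Y.M.exists_germ z (C.prodStalk hY hc hb hz q)
  obtain ⟨W, hW, hWe⟩ := C.exists_forall_prodStalk_eq hY hc hb hz hm hD em
  obtain ⟨W', hW', hWe'⟩ := ρ.exists_forall_eq_stalkMapAt hz (Y.M.mk_mem_sharp hm) hD
    ((congrArg Associates.mk em).trans (C.mk_prodStalk hY hc hb hz q))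
  exact ⟨D ⊓ W ⊓ W', ⟨⟨hD, hW⟩, hW'⟩, _,
    Y.M.restrict_mem (inf_le_left.trans inf_le_left) hm,
    fun y hy hb hz => hWe y hy.1.1 hb hz hy.1.2, fun y hy hz => hWe' y hy.1.1 hz hy.2⟩

end Compatible

end StratumChart
end LogScheme

/-! ### Morphisms to spectra -/

section SpecMaps

variable {S : Scheme.{u}}

/-- The homomorphism `A → Γ(S, 𝒪_S)` given by a morphism `S → Spec A`. -/
noncomputable def specApp {A : CommRingCat.{u}} (f : S ⟶ Spec A) : A →+* Γ(S, ⊤) :=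
  ((Scheme.ΓSpecIso A).inv ≫ f.appTop).hom

theorem specApp_comp {T : Scheme.{u}} {A : CommRingCat.{u}} (g : T ⟶ S) (f : S ⟶ Spec A) (a : A) :
    specApp (g ≫ f) a = g.appTop (specApp f a) := by
  simp only [specApp, Scheme.Hom.comp_appTop]
  rfl

theorem specApp_comp_map {A B : CommRingCat.{u}} (f : S ⟶ Spec B) (g : A ⟶ B) (a : A) :
    specApp (f ≫ Spec.map g) a = specApp f (g a) := by
  have naturality := congrArg (fun k => (k ≫ f.appTop).hom a) (Scheme.ΓSpecIso_inv_naturality g)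
  simp only [specApp, Scheme.Hom.comp_appTop]
  exact naturality.symm

theorem eq_of_specApp_eq {A : CommRingCat.{u}} {f g : S ⟶ Spec A}
    (h : ∀ a, specApp f a = specApp g a) : f = g := by
  apply ext_of_isAffine
  rw [← cancel_epi (Scheme.ΓSpecIso A).inv]
  ext a
  exact h a

theorem exists_specApp_eq {A : CommRingCat.{u}} (φ : A →+* Γ(S, ⊤)) :
    ∃ f : S ⟶ Spec A, ∀ a, specApp f a = φ a := by
  refine ⟨S.toSpecΓ ≫ Spec.map (CommRingCat.ofHom φ), fun a => ?_⟩
  rw [specApp_comp_map]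
  simp [specApp]

section Torus

variable {k : CommRingCat.{u}} {r : ℕ}

/-- The monomials on the torus `Spec k[ℤ^r]`, as invertible functions. -/
noncomputable def torusChar (k : CommRingCat.{u}) (r : ℕ) :
    Multiplicative (Fin r → ℤ) →* Γ((splitTorus k r).left, ⊤) :=
  (specApp (𝟙 (splitTorus k r).left) :
    AddMonoidAlgebra k (Fin r → ℤ) →+* Γ((splitTorus k r).left, ⊤)).toMonoidHom.comp
    (AddMonoidAlgebra.of k (Fin r → ℤ))

theorem specApp_single (f : S ⟶ (splitTorus k r).left) (l) :
    specApp f (AddMonoidAlgebra.single (Multiplicative.toAdd l) 1) =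
      f.appTop (torusChar k r l) :=
  (congrArg (fun q => specApp q (AddMonoidAlgebra.single l.toAdd 1))
    (Category.comp_id f)).symm.trans (specApp_comp f (𝟙 (splitTorus k r).left) _)

theorem exists_hom_splitTorus (s : S ⟶ Spec k) (χ : Multiplicative (Fin r → ℤ) →* Γ(S, ⊤)) :
    ∃ f : S ⟶ (splitTorus k r).left, f ≫ (splitTorus k r).hom = s ∧
      ∀ l, f.appTop (torusChar k r l) = χ l := by
  obtain ⟨f, hf⟩ := exists_specApp_eq (S := S)
    (A := CommRingCat.of (AddMonoidAlgebra k (Fin r → ℤ)))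
    (AddMonoidAlgebra.liftNCRingHom (specApp s) χ fun _ _ => Commute.all _ _)
  refine ⟨f, eq_of_specApp_eq fun a => ?_, fun l => ?_⟩
  · refine (specApp_comp_map f _ a).trans ((hf _).trans ?_)
    simp [AddMonoidAlgebra.liftNCRingHom]
  · refine (specApp_single (k := k) (r := r) f l).symm.trans ((hf _).trans ?_)
    simp [AddMonoidAlgebra.liftNCRingHom]

theorem hom_splitTorus_ext {f g : S ⟶ (splitTorus k r).left}
    (hom_eq : f ≫ (splitTorus k r).hom = g ≫ (splitTorus k r).hom)
    (char_eq : ∀ l, f.appTop (torusChar k r l) = g.appTop (torusChar k r l)) : f = g := by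
  refine eq_of_specApp_eq fun a => ?_
  have specApp_algebraMap (f : S ⟶ (splitTorus k r).left) (c : k) :
      specApp (f ≫ (splitTorus k r).hom) c = specApp f (AddMonoidAlgebra.single 0 c) :=
    specApp_comp_map f (CommRingCat.ofHom (algebraMap k (AddMonoidAlgebra k (Fin r → ℤ)))) c
  have specApp_eq :
      (specApp f : AddMonoidAlgebra k (Fin r → ℤ) →+* Γ(S, ⊤)) = specApp g := by
    refine AddMonoidAlgebra.ringHom_ext (fun c => ?_) fun l => ?_
    · rw [← specApp_algebraMap, hom_eq, specApp_algebraMap]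
    · exact (specApp_single f (.ofAdd l)).trans
        ((char_eq _).trans (specApp_single g (.ofAdd l)).symm)
  exact DFunLike.congr_fun specApp_eq a

instance (k : CommRingCat.{u}) [IsDomain k] (r : ℕ) : IsReduced (splitTorus k r).left :=
  inferInstanceAs (IsReduced (Spec (CommRingCat.of (AddMonoidAlgebra k (Fin r → ℤ)))))

end Torus

/-- The germ of a global function. -/
noncomputable def topGerm (t : S) : Γ(S, ⊤) →+* S.presheaf.stalk t :=
  (S.presheaf.germ ⊤ t trivial).hom

theorem stalkMap_topGerm {T : Scheme.{u}} (g : T ⟶ S) (t : T) (a : Γ(S, ⊤)) :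
    g.stalkMap t (topGerm (g t) a) = topGerm t (g.appTop a) :=
  Scheme.Hom.germ_stalkMap_apply g ⊤ t trivial a

theorem topGerm_ext {a c : Γ(S, ⊤)} (h : ∀ t, topGerm t a = topGerm t c) : a = c :=
  germ_ext fun t _ => h t

theorem topGerm_mem (a : Γ(S, ⊤)) (U : S.Opens) :
    (fun t : U => topGerm t.1 a) ∈ (structSheaf S).sections U :=
  (structSheaf S).restrict_mem (U := ⊤) le_top (germ_mem_structSheaf a)

section ResidueField

variable {X : Scheme.{u}} {x : X} (s : S ⟶ Spec (X.residueField x))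

/-- The pullback of germs at `x` along a morphism `S → Spec κ(x)`. -/
noncomputable def resSection : X.presheaf.stalk x →+* Γ(S, ⊤) :=
  (specApp s).comp (X.residue x).hom

theorem resSection_comp {T : Scheme.{u}} (g : T ⟶ S) (a : X.presheaf.stalk x) :
    resSection (g ≫ s) a = g.appTop (resSection s a) :=
  specApp_comp g s _

theorem resSection_eq_zero {a : X.presheaf.stalk x} (ha : ¬ IsUnit a) : resSection s a = 0 := by
  have h : (X.residue x).hom a = 0 := (IsLocalRing.residue_eq_zero_iff a).2 ha
  rw [resSection, RingHom.comp_apply, h, map_zero]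

theorem comp_fromSpecResidueField_apply (t : S) : (s ≫ X.fromSpecResidueField x) t = x :=
  Scheme.fromSpecResidueField_apply x (s t)

theorem comp_fromSpecResidueField_app {V : X.Opens} (hx : x ∈ V) (f : Γ(X, V)) :
    (s ≫ X.fromSpecResidueField x).app V f =
      S.presheaf.map (homOfLE le_top).op (resSection s (X.presheaf.germ V x hx f)) := by
  change (s ≫ Spec.map (X.residue x) ≫ X.fromSpecStalk x).app V f =
    S.presheaf.map (homOfLE le_top).op (resSection s (X.presheaf.germ V x hx f))
  rw [← Category.assoc, Scheme.Hom.comp_app, Scheme.fromSpecStalk_app hx]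
  have naturality := congrArg (fun k => k.hom ((Scheme.ΓSpecIso (X.presheaf.stalk x)).inv
    (X.presheaf.germ V x hx f)))
    ((s ≫ Spec.map (X.residue x)).naturality (homOfLE (le_top : X.fromSpecStalk x ⁻¹ᵁ V ≤ ⊤)).op)
  exact naturality.trans (congrArg (S.presheaf.map (homOfLE (le_top :
    (s ≫ Spec.map (X.residue x)) ⁻¹ᵁ (X.fromSpecStalk x ⁻¹ᵁ V) ≤ ⊤)).op)
    (specApp_comp_map s (X.residue x) (X.presheaf.germ V x hx f)))

theorem stalkMap_eq_topGerm_resSection {p : S ⟶ X} (hp : p = s ≫ X.fromSpecResidueField x) (t : S)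
    (h : x ⤳ p t) (a : X.presheaf.stalk (p t)) :
    p.stalkMap t a = topGerm t (resSection s (X.presheaf.stalkSpecializes h a)) := by
  obtain ⟨V, hV, f, rfl⟩ := X.presheaf.exists_germ_eq a
  have hx : x ∈ V := h.mem_open V.2 hV
  rw [Scheme.Hom.germ_stalkMap_apply, TopCat.Presheaf.germ_stalkSpecializes_apply]
  subst hp
  rw [comp_fromSpecResidueField_app s hx]
  exact S.presheaf.germ_res_apply (homOfLE le_top) t hV _

end ResidueField

end SpecMaps

/-! ### Reduced subschemes -/

section Reduced

variable {Y S : Scheme.{u}} {Z : Set Y}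

theorem isReduced_subscheme_vanishingIdeal (Z : Closeds Y) :
    IsReduced (Scheme.IdealSheafData.vanishingIdeal Z).subscheme := by
  set I := Scheme.IdealSheafData.vanishingIdeal Z with hI
  have isReduced_quotient (U : Y.affineOpens) : _root_.IsReduced (Γ(Y, U) ⧸ I.ideal U) := by
    rw [← Ideal.isRadical_iff_quotient_reduced, hI, Scheme.IdealSheafData.vanishingIdeal_ideal]
    exact PrimeSpectrum.isRadical_vanishingIdeal _
  have isReduced_cover (U) : IsReduced (I.subschemeCover.openCover.X U) :=
    have := isReduced_quotient U
    inferInstanceAs (IsReduced (Spec (CommRingCat.of (_ ⧸ I.ideal U))))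
  exact IsReduced.of_openCover _ I.subschemeCover.openCover

instance (Y : Scheme.{u}) (Z : Set Y) : IsReduced (reducedSubscheme Y Z) :=
  have : IsReduced (reducedClosure Y Z).subscheme := isReduced_subscheme_vanishingIdeal _
  show IsReduced (openInClosure Y Z).toScheme from
    isReduced_of_isOpenImmersion (openInClosure Y Z).ι

instance (Y : Scheme.{u}) (Z : Set Y) : Mono (reducedSubschemeι Y Z) :=
  inferInstanceAs (Mono ((openInClosure Y Z).ι ≫ (reducedClosure Y Z).subschemeι))

theorem reducedSubschemeι_mem (t : reducedSubscheme Y Z) : reducedSubschemeι Y Z t ∈ Z :=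
  interior_subset (s := (reducedClosure Y Z).subschemeι ⁻¹' Z) t.2

theorem isOpen_preimage_subschemeι_reducedClosure (hZ : IsLocallyClosed Z) :
    IsOpen ((reducedClosure Y Z).subschemeι ⁻¹' Z) := by
  have mem_closure (t) : (reducedClosure Y Z).subschemeι t ∈ closure Z :=
    ((reducedClosure Y Z).range_subschemeι).le ⟨t, rfl⟩
  convert hZ.isOpen_coborder.preimage (reducedClosure Y Z).subschemeι.continuous using 1
  ext t
  exact ⟨fun h => subset_coborder h,
    fun h => (coborder_inter_closure (s := Z)).le ⟨h, mem_closure t⟩⟩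

theorem ker_subschemeι_reducedClosure_le [IsReduced S] (f : S ⟶ Y) (hf : ∀ t, f t ∈ Z) :
    (reducedClosure Y Z).subschemeι.ker ≤ f.ker := by
  have bot_eq : (⊥ : S.IdealSheafData) = Scheme.IdealSheafData.vanishingIdeal ⊤ := by
    rw [Scheme.IdealSheafData.vanishingIdeal_top, Scheme.nilradical_eq_bot]
  rw [Scheme.IdealSheafData.ker_subschemeι, ← Scheme.IdealSheafData.map_bot, bot_eq,
    Scheme.IdealSheafData.map_vanishingIdeal]
  refine Scheme.IdealSheafData.vanishingIdeal_antimono (closure_mono ?_)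
  rintro _ ⟨t, -, rfl⟩
  exact hf t

theorem exists_lift_reducedSubscheme [IsReduced S] (hZ : IsLocallyClosed Z) (f : S ⟶ Y)
    (hf : ∀ t, f t ∈ Z) : ∃ g : S ⟶ reducedSubscheme Y Z, g ≫ reducedSubschemeι Y Z = f := by
  let g := IsClosedImmersion.lift (reducedClosure Y Z).subschemeι f
    (ker_subschemeι_reducedClosure_le f hf)
  have hg : g ≫ (reducedClosure Y Z).subschemeι = f := IsClosedImmersion.lift_fac _ _ _
  have range_subset : Set.range g ⊆ Set.range (openInClosure Y Z).ι := by
    rw [Scheme.Opens.range_ι]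
    rintro _ ⟨t, rfl⟩
    refine (interior_eq_iff_isOpen.2 (isOpen_preimage_subschemeι_reducedClosure hZ)).ge ?_
    change (g ≫ (reducedClosure Y Z).subschemeι) t ∈ Z
    exact hg ▸ hf t
  let l : S ⟶ (openInClosure Y Z).toScheme :=
    IsOpenImmersion.lift (openInClosure Y Z).ι g range_subset
  have hl : l ≫ (openInClosure Y Z).ι ≫ (reducedClosure Y Z).subschemeι = f := by
    rw [IsOpenImmersion.lift_fac_assoc, hg]
  exact ⟨l, hl⟩

theorem eq_zero_of_forall_not_isUnit_germ [IsReduced S] {U : S.Opens} {f : Γ(S, U)}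
    (h : ∀ (t : S) (ht : t ∈ U), ¬ IsUnit (S.presheaf.germ U t ht f)) : f = 0 := by
  rw [← basicOpen_eq_bot_iff, eq_bot_iff]
  intro t ht
  exact h t (S.basicOpen_le f ht) ((Scheme.mem_basicOpen S f t _).1 ht)

end Reduced

theorem associates_mk_prod_one_eq {P : Type*} {G : Type*} [CommMonoid P] [CommGroup G] (p : P)
    (g : G) : Associates.mk ((p, 1) : P × G) = Associates.mk (p, g) :=
  Associates.mk_eq_mk_iff_associated.2 ⟨MulEquiv.prodUnits.symm (1, toUnits g),
    Prod.ext (mul_one _) (one_mul _)⟩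

namespace LogScheme

/-- The morphism from the characteristic of the hollow log structure `F'.stalk x' ⊕ 𝒪_S^×` to `F'`
that is constant with value `x'`. -/
noncomputable def hollowSharp (F' : MonoidalSpace.{u}) (x' : F')
    [Subsingleton (F'.stalk x')ˣ] (S : Scheme.{u}) :
    MonoidalSpace.Hom (hollow S (F'.stalk x')).sharp F' where
  toFun _ := x'
  continuous := continuous_const
  stalkMap t := Associates.mkMonoidHom.comp
    (MonoidHom.inl (F'.stalk x') (S.presheaf.stalk t)ˣ)
  isLocal t m h := (Prod.isUnit_iff.1 (Associates.isUnit_mk.1 h)).1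
  map_sections V σ _ := by
    refine (hollowSheaf S (F'.stalk x')).sharp.locality _ _ fun t ht => ?_
    have hx : x' ∈ V := ht
    exact ⟨⊤, trivial, _, MonoidSheaf.mk_mem_sharp _ (prodMk_mem_hollowSheaf (U := ⊤)
      (σ ⟨x', hx⟩) (s := 1) ((structSheaf S).sections ⊤).one_mem), fun _ _ _ => rfl⟩

theorem pullbackα_stalkMapAt {X Y : LogScheme.{u}} {b : Hom Y X} {S : Scheme.{u}} {i : S ⟶ Y.X}
    {x : X.X} {s : S ⟶ Spec (X.X.residueField x)}
    (e : i ≫ b.base = s ≫ X.X.fromSpecResidueField x) {t : S} (hb : b.base (i t) = x)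
    (m : X.M.stalk x) :
    Y.pullbackα i t (b.stalkMapAt hb m) = topGerm t (resSection s (X.α x m)) := by
  have hα := α_cosp (X := X) (specializes_of_eq hb.symm) (X.M.cosp (specializes_of_eq hb) m)
  rw [MonoidSheaf.cosp_cosp, MonoidSheaf.cosp_refl] at hα
  have hstalk := stalkMap_eq_topGerm_resSection s e t (specializes_of_eq hb.symm)
    (X.α _ (X.M.cosp (specializes_of_eq hb) m))
  rw [Scheme.Hom.stalkMap_comp] at hstalk
  rw [hα]
  exact (congrArg (i.stalkMap t) (b.α_stalkMap (i t) _)).trans hstalk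

/-- The functions that are nowhere invertible on the stratum of `x'` vanish on `S`. -/
def VanishesOn {Y : LogScheme.{u}} {F' : MonoidalSpace.{u}} (ρ : MonoidalSpace.Hom Y.sharp F')
    (x' : F') {S : Scheme.{u}} (i : S ⟶ Y.X) : Prop :=
  ∀ (V : Y.X.Opens) (f : Γ(Y.X, V)),
    (∀ (z : Y.X) (hz : z ∈ V), ρ z = x' → ¬ IsUnit (Y.X.presheaf.germ V z hz f)) →
    i.app V f = 0

theorem not_isUnit_α_of_mk_eq_stalkMapAt {Y : LogScheme.{u}} {F' : MonoidalSpace.{u}}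
    {ρ : MonoidalSpace.Hom Y.sharp F'} {x' : F'} [Subsingleton (F'.stalk x')ˣ] {z : Y.X}
    (hz : ρ z = x') {m : Y.M.stalk z} {p : F'.stalk x'} (hp : p ≠ 1)
    (h : Associates.mk m = ρ.stalkMapAt hz p) :
    ¬ IsUnit (Y.α z m) := fun hu =>
  hp (isUnit_iff_eq_one.1 (ρ.isUnit_of_isUnit_stalkMapAt hz
    (h ▸ Associates.isUnit_mk.2 (Y.isUnit_of_isUnit_α hu))))

end LogScheme

namespace LogScheme.StratumChart

variable {X : LogScheme.{u}} {F' : MonoidalSpace.{u}} {φ : MonoidalSpace.Hom F' X.fan} {x' : F'}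
  {x : X.X} (C : StratumChart φ x' x)

/-! ### Morphisms from hollow log schemes -/

section Hollow

variable {S : Scheme.{u}} (s : S ⟶ Spec (X.X.residueField x))
  (χ : Multiplicative (Fin C.r → ℤ) →* Γ(S, ⊤))

/-- The `𝒪_S^×`-component `m ↦ χ(torusPart m) · unitPart(m)` of the homomorphism from `M_{X,x}` to
a hollow log structure. -/
noncomputable def totalUnit : X.M.stalk x →* Γ(S, ⊤)ˣ :=
  (χ.toHomUnits.comp (C.torusPart.comp C.char)) *
    (Units.map ((resSection s).toMonoidHom.comp (X.α x))).comp C.unitPart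

theorem totalUnit_apply (m : X.M.stalk x) : (C.totalUnit s χ m : Γ(S, ⊤)) =
    χ (C.torusPart (C.char m)) * resSection s (X.α x (C.unitPart m)) := rfl

/-- The homomorphism from `M_{X,x}` to the stalk of a hollow log structure. -/
noncomputable def toHollow (t : S) : X.M.stalk x →* F'.stalk x' × (S.presheaf.stalk t)ˣ :=
  ((subdivisionMap φ x').comp C.char).prod
    ((Units.map (topGerm t).toMonoidHom).comp (C.totalUnit s χ))

theorem toHollow_sec [IsCancelMul (X.M.stalk x)] (t : S) (n) : C.toHollow s χ t (C.sec n) =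
    (subdivisionMap φ x' n,
      Units.map (topGerm t).toMonoidHom (χ.toHomUnits (C.torusPart n))) := by
  have char_sec : C.char (C.sec n) = n := C.charMap_sec n
  refine Prod.ext (congrArg (subdivisionMap φ x') char_sec)
    (congrArg (Units.map (topGerm t).toMonoidHom) (Units.ext ?_))
  rw [totalUnit_apply, char_sec, unitPart_sec, Units.val_one, map_one, map_one, mul_one]
  rfl

variable [Subsingleton (F'.stalk x')ˣ]

theorem hollowHom_toHollow (t : S) (m : X.M.stalk x) :
    hollowHom (F'.stalk x') (S.presheaf.stalk t) (C.toHollow s χ t m) =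
      topGerm t (resSection s (X.α x m)) := by
  by_cases h : subdivisionMap φ x' (C.char m) = 1
  · have hm := C.isUnit_of_subdivisionMap_char_eq_one h
    rw [hollowHom_of_eq_one (show (C.toHollow s χ t m).1 = 1 from h)]
    change topGerm t (C.totalUnit s χ m : Γ(S, ⊤)) = _
    rw [totalUnit_apply, C.char_eq_one_of_isUnit hm, map_one, map_one, one_mul,
      C.unitPart_of_isUnit hm]
  · rw [hollowHom_of_ne_one (show (C.toHollow s χ t m).1 ≠ 1 from h), resSection_eq_zero, map_zero]
    intro hunit
    exact h (by rw [C.char_eq_one_of_isUnit (X.isUnit_of_isUnit_α hunit), map_one])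

/-- The morphism to `X` from the hollow log structure `F'.stalk x' ⊕ 𝒪_S^×` on a scheme `S` over
`κ(x)` given by a homomorphism `χ` from `ℤ^r` to the invertible functions on `S`. -/
noncomputable def hollowMap : Hom (hollow S (F'.stalk x')) X where
  base := s ≫ X.X.fromSpecResidueField x
  stalkMap t := (C.toHollow s χ t).comp
    (X.M.cosp (specializes_of_eq (comp_fromSpecResidueField_apply s t).symm))
  map_sections V σ hσ := by
    refine (hollowSheaf S (F'.stalk x')).locality _ _ fun t ht => ?_
    have hx : x ∈ V := (comp_fromSpecResidueField_apply s t) ▸ ht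
    refine ⟨(s ≫ X.X.fromSpecResidueField x) ⁻¹ᵁ V, ht, _,
      prodMk_mem_hollowSheaf (subdivisionMap φ x' (C.char (σ ⟨x, hx⟩)))
        (s := fun t => Units.map (topGerm t.1).toMonoidHom (C.totalUnit s χ (σ ⟨x, hx⟩)))
        (topGerm_mem _ _), fun y hU _ => ?_⟩
    exact congrArg (C.toHollow s χ y) (X.M.cosp_section _ hσ hx hU)
  α_stalkMap t m := by
    have hspec := specializes_of_eq (comp_fromSpecResidueField_apply s t).symm
    exact (C.hollowHom_toHollow s χ t _).trans
      ((congrArg (fun a => topGerm t (resSection s a)) (α_cosp (X := X) hspec m)).trans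
        (stalkMap_eq_topGerm_resSection s rfl t hspec (X.α _ m)).symm)

theorem hollowMap_stalkMap_section (t : S) {V : X.X.Opens} {σ : ∀ y : V, X.M.stalk y.1}
    (hσ : σ ∈ X.M.sections V) (hx : x ∈ V) (ht : (C.hollowMap s χ).base t ∈ V) :
    (C.hollowMap s χ).stalkMap t (σ ⟨(C.hollowMap s χ).base t, ht⟩) =
      C.toHollow s χ t (σ ⟨x, hx⟩) :=
  congrArg (C.toHollow s χ t) (X.M.cosp_section _ hσ hx ht)

theorem isCompatible_hollow :
    IsCompatible φ (C.hollowMap s χ) (hollowSharp F' x' S) := by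
  intro (t : S)
  have ht := comp_fromSpecResidueField_apply s t
  refine ⟨?_, fun U σ hσ hU hy => ?_⟩
  · have h := C.isCharPoint
    rwa [← ht] at h
  · have hx : x ∈ U := ht ▸ hU
    have char_eq : C.char (σ ⟨x, hx⟩) = Associates.mk (σ ⟨(φ x').1, hy⟩) :=
      charMap_section _ hσ hx hy
    have toHollow_eq : C.toHollow s χ t (σ ⟨x, hx⟩) =
        (subdivisionMap φ x' (Associates.mk (σ ⟨(φ x').1, hy⟩)),
          Units.map (topGerm t).toMonoidHom (C.totalUnit s χ (σ ⟨x, hx⟩))) := by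
      rw [← char_eq]; rfl
    rw [C.hollowMap_stalkMap_section s χ t hσ hx hU, toHollow_eq]
    exact associates_mk_prod_one_eq _ _

end Hollow

/-! ### Morphisms to hollow log schemes -/

section Stratum

variable {Y : LogScheme.{u}} {b : Hom Y X} {ρ : MonoidalSpace.Hom Y.sharp F'}
  (hY : Y.IsFs) (hc : IsCompatible φ b ρ) {S : Scheme.{u}} {i : S ⟶ Y.X}
  (hb : ∀ t, b.base (i t) = x) (hz : ∀ t, ρ (i t) = x')

theorem pullbackStalkMap_prodStalk_mem (q) : (fun t : (⊤ : S.Opens) =>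
    Y.pullbackStalkMap i t.1 (C.prodStalk hY hc (hb t.1) (hz t.1) q)) ∈
      (Y.pullbackSheaf i).sections ⊤ := by
  refine (Y.pullbackSheaf i).locality _ _ fun t _ => ?_
  obtain ⟨V, hV, m, hm, prodStalk_eq, -⟩ := C.exists_section_prodStalk hY hc (hb t) (hz t) q
  exact ⟨i ⁻¹ᵁ V, hV, _, Y.pullbackStalkMap_mem i hm, fun y _ hy =>
    congrArg (Y.pullbackStalkMap i y) (prodStalk_eq (i y) hy (hb y) (hz y))⟩

theorem exists_torusUnit (l : Multiplicative (Fin C.r → ℤ)) : ∃ f : Γ(S, ⊤), ∀ t,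
    topGerm t f = Y.pullbackα i t (C.prodStalk hY hc (hb t) (hz t) (1, l)) := by
  obtain ⟨f, hf⟩ := structureMap_mem (C.pullbackStalkMap_prodStalk_mem hY hc hb hz (1, l))
  exact ⟨f, fun t => ((mul_one _).symm.trans (hf ⟨t, trivial⟩)).symm⟩

/-- The invertible functions on a scheme over the stratum of `x'` in the fibre over `x` that a chart
attaches to the elements of `ℤ^r`. -/
noncomputable def torusUnit : Multiplicative (Fin C.r → ℤ) →* Γ(S, ⊤) where
  toFun l := (C.exists_torusUnit hY hc hb hz l).choose
  map_one' := topGerm_ext fun t => by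
    rw [(C.exists_torusUnit hY hc hb hz 1).choose_spec, map_one, ← Prod.one_eq_mk, map_one,
      map_one]
  map_mul' l l' := topGerm_ext fun t => by
    rw [(C.exists_torusUnit hY hc hb hz _).choose_spec, map_mul,
      (C.exists_torusUnit hY hc hb hz _).choose_spec,
      (C.exists_torusUnit hY hc hb hz _).choose_spec, ← map_mul, ← map_mul, Prod.mk_mul_mk, one_mul]

theorem topGerm_torusUnit (t : S) (l) : topGerm t (C.torusUnit hY hc hb hz l) =
    Y.pullbackα i t (C.prodStalk hY hc (hb t) (hz t) (1, l)) :=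
  (C.exists_torusUnit hY hc hb hz l).choose_spec t

theorem torusUnit_comp {T : Scheme.{u}} (j : T ⟶ S) {i' : T ⟶ Y.X} (h : j ≫ i = i')
    (hb' : ∀ t, b.base (i' t) = x) (hz' : ∀ t, ρ (i' t) = x') (l) :
    C.torusUnit hY hc hb' hz' l = j.appTop (C.torusUnit hY hc hb hz l) := by
  subst h
  refine topGerm_ext fun t => ?_
  rw [← stalkMap_topGerm, topGerm_torusUnit, topGerm_torusUnit]
  exact congrArg (fun f => f.hom (Y.α (i (j t)) (C.prodStalk hY hc (hb (j t)) (hz (j t)) (1, l))))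
    (Scheme.Hom.stalkMap_comp j i t)

/-- The homomorphism from the stalk of the hollow log structure `F'.stalk x' ⊕ 𝒪_G^×` to the stalk
of the inverse image log structure on `S` given by a chart. -/
noncomputable def fromHollow {G : Scheme.{u}} (r : S ⟶ G) (t : S) :
    F'.stalk x' × (G.presheaf.stalk (r t))ˣ →* Y.PullbackStalk i t :=
  (UnitPushout.mk (Units.map (Y.pullbackα i t))).comp
    (MonoidHom.prodMap ((C.prodStalk hY hc (hb t) (hz t)).comp (MonoidHom.inl _ _))
      (Units.map (r.stalkMap t).hom.toMonoidHom))

theorem fromHollow_apply {G : Scheme.{u}} (r : S ⟶ G) (t : S) (m) :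
    C.fromHollow hY hc hb hz r t m =
      UnitPushout.mk _ (C.prodStalk hY hc (hb t) (hz t) (m.1, 1),
        Units.map (r.stalkMap t).hom.toMonoidHom m.2) := rfl

theorem fromHollow_mem {G : Scheme.{u}} (r : S ⟶ G) {V : G.Opens}
    {σ : ∀ y : V, F'.stalk x' × (G.presheaf.stalk y.1)ˣ}
    (hσ : σ ∈ (hollowSheaf G (F'.stalk x')).sections V) :
    (fun t : ↥(r ⁻¹ᵁ V) => C.fromHollow hY hc hb hz r t.1 (σ ⟨r t.1, t.2⟩)) ∈
      (Y.pullbackSheaf i).sections (r ⁻¹ᵁ V) := by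
  refine (Y.pullbackSheaf i).locality _ _ fun t ht => ?_
  obtain ⟨W, A, hW, hA, τ, ⟨p, hp, hτ⟩, στ⟩ := hσ (r t) ht
  refine ⟨r ⁻¹ᵁ W ⊓ r ⁻¹ᵁ A, ⟨hW, hA⟩, _, mul_mem
    ((Y.pullbackSheaf i).restrict_mem le_top
      (C.pullbackStalkMap_prodStalk_mem hY hc hb hz (p, 1)))
    ((Y.pullbackSheaf i).restrict_mem inf_le_right (pullbackSheaf_mem (U := r ⁻¹ᵁ A)
      ⟨⊤, fun _ _ => trivial, 1, fun y => Units.map (r.stalkMap y.1).hom.toMonoidHom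
        (τ ⟨r y.1, y.2⟩).2, one_mem _, structSheaf_pullback r hτ, fun _ => rfl⟩)),
    fun y hU hy => ?_⟩
  refine (congrArg (C.fromHollow hY hc hb hz r y) (στ (r y) hU hy.2 hy.1)).trans ?_
  refine Eq.trans ?_ (UnitPushout.mk_eq_mul _ _)
  refine congrArg (UnitPushout.mk _) (Prod.ext ?_ rfl)
  exact congrArg (fun p => C.prodStalk hY hc (hb y) (hz y) (p, 1)) (hp ⟨r y, hy.2⟩)

variable [Subsingleton (F'.stalk x')ˣ]

theorem pullbackα_prodStalk_eq_zero (hv : VanishesOn ρ x' i) (t : S) {q} (hq : q.1 ≠ 1) :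
    Y.pullbackα i t (C.prodStalk hY hc (hb t) (hz t) q) = 0 := by
  obtain ⟨V, hV, m, hm, prodStalk_eq, mk_eq⟩ :=
    C.exists_section_prodStalk hY hc (hb t) (hz t) q
  obtain ⟨f, hf⟩ := α_mem hm
  have α_eq (z : Y.X) (hzV : z ∈ V) : Y.α z (m ⟨z, hzV⟩) = Y.X.presheaf.germ V z hzV f :=
    hf ⟨z, hzV⟩
  have app_eq_zero : i.app V f = 0 := hv V f fun z hzV hzx =>
    α_eq z hzV ▸ not_isUnit_α_of_mk_eq_stalkMapAt hzx hq (mk_eq z hzV hzx)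
  rw [prodStalk_eq (i t) hV (hb t) (hz t)]
  refine (congrArg (i.stalkMap t) (α_eq (i t) hV)).trans ?_
  rw [Scheme.Hom.germ_stalkMap_apply, app_eq_zero, map_zero]

theorem structureMap_fromHollow (hv : VanishesOn ρ x' i) {G : Scheme.{u}} (r : S ⟶ G) (t : S)
    (m : F'.stalk x' × (G.presheaf.stalk (r t))ˣ) :
    UnitPushout.structureMap (Y.pullbackα i t) (C.fromHollow hY hc hb hz r t m) =
      r.stalkMap t (hollowHom (F'.stalk x') (G.presheaf.stalk (r t)) m) := by
  rw [fromHollow_apply, UnitPushout.structureMap_mk]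
  by_cases h : m.1 = 1
  · rw [hollowHom_of_eq_one h, h, ← Prod.one_eq_mk, map_one, map_one, one_mul]
    rfl
  · rw [hollowHom_of_ne_one h, map_zero,
      C.pullbackα_prodStalk_eq_zero hY hc hb hz hv t (q := (m.1, 1)) h, zero_mul]

/-- The morphism to a hollow log scheme given by a chart and a morphism of schemes. -/
noncomputable def toHollowHom (hv : VanishesOn ρ x' i) {G : Scheme.{u}} (r : S ⟶ G) :
    Hom (Y.pullbackLog i) (hollow G (F'.stalk x')) where
  base := r
  stalkMap t := C.fromHollow hY hc hb hz r t
  map_sections _ _ hσ := C.fromHollow_mem hY hc hb hz r hσ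
  α_stalkMap t m := C.structureMap_fromHollow hY hc hb hz hv r t m

end Stratum

end LogScheme.StratumChart

namespace LogScheme

theorem Hom.sharp_comp {S T X : LogScheme.{u}} (f : Hom T X) (g : Hom S T) :
    (f.comp g).sharp = f.sharp.comp g.sharp := by
  refine MonoidalSpace.Hom.ext (funext fun _ => rfl) (heq_of_eq (funext fun t => ?_))
  ext m
  obtain ⟨m, rfl⟩ := Associates.mk_surjective m
  rfl

namespace StratumChart

variable {X : LogScheme.{u}} {F' : MonoidalSpace.{u}} {φ : MonoidalSpace.Hom F' X.fan} {x' : F'}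
  {x : X.X} (C : StratumChart φ x' x) {Y : LogScheme.{u}} {b : Hom Y X}
  {ρ : MonoidalSpace.Hom Y.sharp F'}

/-! ### Lifts to a log blow-up -/

section Compare

variable (hY : Y.IsFs) (hc : IsCompatible φ b ρ)

theorem stalkMapAt_eq_prodStalk_mul {z : Y.X} (hb : b.base z = x) (hz : ρ z = x')
    (m : X.M.stalk x) : b.stalkMapAt hb m =
      C.prodStalk hY hc hb hz (subdivisionMap φ x' (C.char m), 1) *
        (C.prodStalk hY hc hb hz (1, C.torusPart (C.char m)) *
          b.stalkMapAt hb (C.unitPart m)) := by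
  have prodStalk_mul : C.prodStalk hY hc hb hz (subdivisionMap φ x' (C.char m), 1) *
      C.prodStalk hY hc hb hz (1, C.torusPart (C.char m)) = C.secStalk b hb (C.char m) := by
    rw [← map_mul, Prod.mk_mul_mk, mul_one, one_mul]
    exact C.prodStalk_splitting hY hc hb hz (C.char m)
  rw [← mul_assoc, prodStalk_mul]
  exact (congrArg (b.stalkMapAt hb) (C.eq_sec_mul m)).trans (map_mul _ _ _)

section Scheme

variable {S : Scheme.{u}} {i : S ⟶ Y.X} (hb : ∀ t, b.base (i t) = x) (hz : ∀ t, ρ (i t) = x')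
  {s : S ⟶ Spec (X.X.residueField x)} {G : Scheme.{u}} {sG : G ⟶ Spec (X.X.residueField x)}
  {χ : Multiplicative (Fin C.r → ℤ) →* Γ(G, ⊤)} {r : S ⟶ G}

theorem fromHollow_toHollow (e : i ≫ b.base = s ≫ X.X.fromSpecResidueField x) (hr : r ≫ sG = s)
    (hχ : ∀ l, r.appTop (χ l) = C.torusUnit hY hc hb hz l) (t : S) (m : X.M.stalk x) :
    C.fromHollow hY hc hb hz r t (C.toHollow sG χ (r t) m) =
      Y.pullbackStalkMap i t (b.stalkMapAt (hb t) m) := by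
  obtain ⟨c, hc_eq⟩ : IsUnit (C.prodStalk hY hc (hb t) (hz t) (1, C.torusPart (C.char m)) *
      b.stalkMapAt (hb t) (C.unitPart m)) :=
    ((Prod.isUnit_iff.2 ⟨isUnit_one, Group.isUnit _⟩).map _).mul ((C.unitPart m).isUnit.map _)
  have pullbackα_c : Y.pullbackα i t c =
      topGerm t (C.torusUnit hY hc hb hz (C.torusPart (C.char m))) *
        topGerm t (resSection s (X.α x (C.unitPart m))) := by
    rw [hc_eq, map_mul, topGerm_torusUnit, pullbackα_stalkMapAt e]
  have stalkMap_totalUnit : r.stalkMap t (topGerm (r t) (C.totalUnit sG χ m : Γ(G, ⊤))) =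
      Y.pullbackα i t c := by
    rw [pullbackα_c, stalkMap_topGerm, totalUnit_apply, map_mul, map_mul, hχ, ← hr,
      resSection_comp]
  rw [C.stalkMapAt_eq_prodStalk_mul hY hc (hb t) (hz t), ← hc_eq, fromHollow_apply]
  exact UnitPushout.mk_eq_iff.2
    ⟨c, rfl, Units.ext (stalkMap_totalUnit.trans (one_mul (Y.pullbackα i t c)).symm)⟩

variable [Subsingleton (F'.stalk x')ˣ]

theorem hollowMap_comp (e : i ≫ b.base = s ≫ X.X.fromSpecResidueField x) (hv : VanishesOn ρ x' i)
    (hr : r ≫ sG = s) (hχ : ∀ l, r.appTop (χ l) = C.torusUnit hY hc hb hz l) :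
    (C.hollowMap sG χ).comp (C.toHollowHom hY hc hb hz hv r) = b.comp (Y.pullbackHom i) := by
  refine Hom.ext_of_sections ?_ ?_
  · refine (Category.assoc r sG (X.X.fromSpecResidueField x)).symm.trans ?_
    rw [hr, ← e]
    rfl
  · intro (t : S) V σ hσ hf hg
    have hx : x ∈ V := hb t ▸ hg
    exact (congrArg (C.fromHollow hY hc hb hz r t)
        (C.hollowMap_stalkMap_section sG χ (r t) hσ hx hf)).trans
      ((C.fromHollow_toHollow hY hc hb hz e hr hχ t _).trans
        (congrArg (Y.pullbackStalkMap i t) (b.stalkMapAt_section (hb t) hσ hx hg)))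

theorem hollowSharp_comp (hv : VanishesOn ρ x' i) (r : S ⟶ G) :
    (hollowSharp F' x' G).comp (C.toHollowHom hY hc hb hz hv r).sharp =
      ρ.comp (Y.pullbackHom i).sharp := by
  refine MonoidalSpace.Hom.ext_of_sections (fun t => (hz t).symm) ?_
  intro (t : S) V σ hσ hf hg
  have hx : x' ∈ V := hf
  have mk_prodStalk_eq := C.mk_prodStalk hY hc (hb t) (hz t) (σ ⟨x', hx⟩, 1)
  rw [ρ.stalkMapAt_section (hz t) hσ hx hg] at mk_prodStalk_eq
  have fromHollow_eq : C.fromHollow hY hc hb hz r t (σ ⟨x', hx⟩, 1) =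
      Y.pullbackStalkMap i t (C.prodStalk hY hc (hb t) (hz t) (σ ⟨x', hx⟩, 1)) := by
    rw [fromHollow_apply, map_one]
    rfl
  exact (congrArg Associates.mk fromHollow_eq).trans
    (congrArg ((Y.pullbackHom i).sharp.stalkMap t) mk_prodStalk_eq)

end Scheme

section Lift

variable [Subsingleton (F'.stalk x')ˣ] {G : Scheme.{u}} {sG : G ⟶ Spec (X.X.residueField x)}
  {χ : Multiplicative (Fin C.r → ℤ) →* Γ(G, ⊤)} {h : Hom (hollow G (F'.stalk x')) Y}

theorem stalkMap_secStalk_of_comp_eq [IsCancelMul (X.M.stalk x)]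
    (e : b.comp h = C.hollowMap sG χ) (t : G) (hb : b.base (h.base t) = x) (n) :
    h.stalkMap t (C.secStalk b hb n) =
      ((subdivisionMap φ x' n,
        Units.map (topGerm t).toMonoidHom (χ.toHomUnits (C.torusPart n))) :
        F'.stalk x' × (G.presheaf.stalk t)ˣ) := by
  have hx := comp_fromSpecResidueField_apply sG t
  have cosp_sec : X.M.cosp (specializes_of_eq hx.symm)
      (X.M.cosp (specializes_of_eq hx) (C.sec n)) = C.sec n := by
    rw [MonoidSheaf.cosp_cosp, MonoidSheaf.cosp_refl]
  exact (Hom.stalkMap_stalkMapAt e t hb hx (C.sec n)).trans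
    ((congrArg (C.toHollow sG χ t) cosp_sec).trans (C.toHollow_sec sG χ t n))

theorem stalkMap_prodStalk_of_comp_eq [IsCancelMul (X.M.stalk x)] [IsCancelMul (F'.stalk x')]
    (e : b.comp h = C.hollowMap sG χ) (t : G) (hb : b.base (h.base t) = x)
    (hz : ρ (h.base t) = x') (q) :
    h.stalkMap t (C.prodStalk hY hc hb hz q) =
      ((q.1, Units.map (topGerm t).toMonoidHom (χ.toHomUnits q.2)) :
        F'.stalk x' × (G.presheaf.stalk t)ˣ) := by
  let H : Y.M.stalk (h.base t) →* F'.stalk x' × (G.presheaf.stalk t)ˣ := h.stalkMap t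
  let T : F'.stalk x' × Multiplicative (Fin C.r → ℤ) →* F'.stalk x' × (G.presheaf.stalk t)ˣ :=
    (MonoidHom.id _).prodMap ((Units.map (topGerm t).toMonoidHom).comp χ.toHomUnits)
  have H_secStalk (n) : H (C.secStalk b hb n) = T (C.splitting n) :=
    C.stalkMap_secStalk_of_comp_eq e t hb n
  obtain ⟨n, k, hnk⟩ := C.surjective q
  refine mul_right_cancel (b := T (C.splitting k)) ?_
  calc H (C.prodStalk hY hc hb hz q) * T (C.splitting k)
      = H (C.secStalk b hb n) := by
        rw [← H_secStalk, ← map_mul, ← C.secStalk_eq_prodStalk_mul hY hc hb hz hnk]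
    _ = T (q * C.splitting k) := (H_secStalk n).trans (congrArg T hnk)
    _ = T q * T (C.splitting k) := map_mul T _ _

theorem torusUnit_of_comp_eq [IsCancelMul (X.M.stalk x)] [IsCancelMul (F'.stalk x')]
    (e : b.comp h = C.hollowMap sG χ) (hb : ∀ t : G, b.base (h.base t) = x)
    (hz : ∀ t : G, ρ (h.base t) = x') (l) :
    C.torusUnit (S := G) (i := h.base) hY hc hb hz l = χ l := by
  refine topGerm_ext fun t => (C.topGerm_torusUnit hY hc hb hz t l).trans ?_
  refine (h.α_stalkMap t (C.prodStalk hY hc (hb t) (hz t) (1, l))).symm.trans ?_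
  refine (congrArg (hollowHom (F'.stalk x') (G.presheaf.stalk t))
    (C.stalkMap_prodStalk_of_comp_eq hY hc e t (hb t) (hz t) (1, l))).trans ?_
  exact hollowHom_of_eq_one rfl

end Lift

end Compare

theorem comp_base_eq (hbl : IsLogBlowup φ b ρ) [Subsingleton (F'.stalk x')ˣ] {S : Scheme.{u}}
    {i : S ⟶ Y.X} {s : S ⟶ Spec (X.X.residueField x)}
    (e : i ≫ b.base = s ≫ X.X.fromSpecResidueField x) (hb : ∀ t, b.base (i t) = x)
    (hz : ∀ t, ρ (i t) = x') (hv : VanishesOn ρ x' i) {G : Scheme.{u}}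
    {sG : G ⟶ Spec (X.X.residueField x)} {χ : Multiplicative (Fin C.r → ℤ) →* Γ(G, ⊤)}
    {h : Hom (hollow G (F'.stalk x')) Y} (h_map : b.comp h = C.hollowMap sG χ)
    (h_sharp : ρ.comp h.sharp = hollowSharp F' x' G) {r : S ⟶ G} (hr : r ≫ sG = s)
    (hχ : ∀ l, r.appTop (χ l) = C.torusUnit hbl.isFs hbl.isCompatible hb hz l) :
    r ≫ h.base = i := by
  let k := C.toHollowHom hbl.isFs hbl.isCompatible hb hz hv r
  have map_comp : b.comp (h.comp k) = b.comp (Y.pullbackHom i) :=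
    (congrArg (Hom.comp · k) h_map).trans
      (C.hollowMap_comp hbl.isFs hbl.isCompatible hb hz e hv hr hχ)
  have sharp_comp : ρ.comp (h.comp k).sharp = ρ.comp (Y.pullbackHom i).sharp := by
    rw [Hom.sharp_comp]
    exact (congrArg (MonoidalSpace.Hom.comp · k.sharp) h_sharp).trans
      (C.hollowSharp_comp hbl.isFs hbl.isCompatible hb hz hv r)
  exact congrArg Hom.base ((hbl.existsUnique _ (b.comp (Y.pullbackHom i))
    (ρ.comp (Y.pullbackHom i).sharp) (Y.pullbackLog_isFs i hbl.isFs)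
    (hbl.isCompatible.comp _)).unique ⟨map_comp, sharp_comp⟩ ⟨rfl, rfl⟩)

theorem nonempty_iso_splitTorus (hP : IsFsMonoid (F'.stalk x')) [Subsingleton (F'.stalk x')ˣ]
    [IsCancelMul (X.M.stalk x)] (hbl : IsLogBlowup φ b ρ) {S : Scheme.{u}} {i : S ⟶ Y.X} [Mono i]
    {s : S ⟶ Spec (X.X.residueField x)} (e : i ≫ b.base = s ≫ X.X.fromSpecResidueField x)
    (hz : ∀ t, ρ (i t) = x') (hv : VanishesOn ρ x' i)
    (hlift : ∀ (G : Scheme.{u}) (sG : G ⟶ Spec (X.X.residueField x)) (g : G ⟶ Y.X), IsReduced G →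
      g ≫ b.base = sG ≫ X.X.fromSpecResidueField x → (∀ t, ρ (g t) = x') →
      ∃ j : G ⟶ S, j ≫ i = g ∧ j ≫ s = sG) :
    Nonempty (Over.mk s ≅ splitTorus (X.X.residueField x) C.r) := by
  have := hP.cancel
  have base_eq {G : Scheme.{u}} {g : G ⟶ Y.X} {sG : G ⟶ Spec (X.X.residueField x)}
      (e : g ≫ b.base = sG ≫ X.X.fromSpecResidueField x) (t : G) : b.base (g t) = x := by
    rw [← Scheme.Hom.comp_apply, e, comp_fromSpecResidueField_apply]
  let G := (splitTorus (X.X.residueField x) C.r).left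
  let sG : G ⟶ Spec (X.X.residueField x) := (splitTorus (X.X.residueField x) C.r).hom
  let χ := torusChar (X.X.residueField x) C.r
  obtain ⟨r, hr, hχ⟩ :=
    exists_hom_splitTorus s (C.torusUnit hbl.isFs hbl.isCompatible (base_eq e) hz)
  obtain ⟨h, ⟨h_map, h_sharp⟩, -⟩ := hbl.existsUnique _ (C.hollowMap sG χ) (hollowSharp F' x' G)
    (hollow_isFs hP) (C.isCompatible_hollow sG χ)
  have h_base : h.base ≫ b.base = sG ≫ X.X.fromSpecResidueField x := congrArg Hom.base h_map
  have h_stratum (t : G) : ρ (h.base t) = x' := congrArg (fun g => g.toFun t) h_sharp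
  have r_comp : r ≫ h.base = i := C.comp_base_eq hbl e (base_eq e) hz hv h_map h_sharp hr hχ
  obtain ⟨j, j_comp, j_hom⟩ := hlift G sG h.base inferInstance h_base h_stratum
  refine ⟨Over.isoMk ⟨r, j, ?_, ?_⟩ hr⟩
  · rw [← cancel_mono i, Category.assoc, j_comp, r_comp, Category.id_comp]
  · refine hom_splitTorus_ext ?_ fun l => ?_
    · rw [Category.assoc, hr, j_hom, Category.id_comp]
    · rw [Scheme.Hom.comp_appTop, CommRingCat.comp_apply, hχ, ← C.torusUnit_comp _ _ _ _ j j_comp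
        (base_eq h_base) h_stratum, C.torusUnit_of_comp_eq _ _ h_map]
      rfl

end StratumChart
end LogScheme

/-! ### Points of fs fans -/

theorem Face.eq_of_closure_eq_top {P : Type u} [CommMonoid P] {G : Set P}
    (hG : Submonoid.closure G = ⊤) {S T : Face P} (h : ∀ g ∈ G, g ∈ S.1 ↔ g ∈ T.1) : S = T := by
  refine Subtype.ext (Submonoid.ext fun p => ?_)
  have hp : p ∈ Submonoid.closure G := hG ▸ Submonoid.mem_top p
  induction hp using Submonoid.closure_induction with
  | mem g hg => exact h g hg
  | one => exact ⟨fun _ => T.1.one_mem, fun _ => S.1.one_mem⟩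
  | mul a b _ _ ha hb =>
    exact S.mul_mem_iff.trans ((and_congr ha hb).trans T.mul_mem_iff.symm)

theorem Face.isOpen_setOf_mem {P : Type u} [CommMonoid P] (a : P) :
    IsOpen {S : Face P | a ∈ S.1} :=
  TopologicalSpace.isOpen_generateFrom_of_mem ⟨a, rfl⟩

theorem Face.isLocallyClosed_singleton {P : Type u} [CommMonoid P] [Monoid.FG P]
    (S : Face P) : IsLocallyClosed ({S} : Set (Face P)) := by
  obtain ⟨G, hG⟩ := Monoid.FG.fg_top (M := P)
  classical
  refine ⟨⋂ g ∈ G.filter (· ∈ S.1), {T : Face P | g ∈ T.1},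
    ⋂ g ∈ G.filter (· ∉ S.1), {T : Face P | g ∈ T.1}ᶜ,
    isOpen_biInter_finset fun g _ => isOpen_setOf_mem g,
    isClosed_biInter fun g _ => (isOpen_setOf_mem g).isClosed_compl, ?_⟩
  ext T
  simp only [Set.mem_singleton_iff, Set.mem_inter_iff, Set.mem_iInter, Finset.mem_filter,
    Set.mem_ofPred_eq, Set.mem_compl_iff]
  constructor
  · rintro rfl
    exact ⟨fun g hg => hg.2, fun g hg => hg.2⟩
  · rintro ⟨mem_of_mem, notMem_of_notMem⟩
    refine eq_of_closure_eq_top hG fun g hg => ⟨fun hT => ?_, fun hS => mem_of_mem g ⟨hg, hS⟩⟩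
    by_contra hS
    exact notMem_of_notMem g ⟨hg, hS⟩ hT

theorem IsFsFan.isLocallyClosed_singleton {F : MonoidalSpace.{u}} (hF : IsFsFan F) (t : F) :
    IsLocallyClosed ({t} : Set F) := by
  obtain ⟨U, ht, P, _, hP, f, hf⟩ := hF t
  have := hP.fg
  have preimage_eq : (f.toFun ⁻¹' {f ⟨t, ht⟩} : Set (U : Set F)) = {⟨t, ht⟩} := by
    ext y
    exact ⟨fun h => hf.isHomeomorph.injective h, fun h => congrArg f.toFun h⟩
  have locallyClosed_in_U : IsLocallyClosed ({⟨t, ht⟩} : Set (U : Set F)) :=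
    preimage_eq ▸ (Face.isLocallyClosed_singleton (f ⟨t, ht⟩)).preimage f.continuous
  have locallyClosed_image := locallyClosed_in_U.image Topology.IsInducing.subtypeVal
    (Subtype.range_coe.symm ▸ U.2.isLocallyClosed)
  rwa [Set.image_singleton] at locallyClosed_image

theorem IsFsFan.exists_face_quotient {F : MonoidalSpace.{u}} (hF : IsFsFan F) (t : F) :
    ∃ (P : Type u) (_ : CommMonoid P) (S : Face P) (π : P →* F.stalk t), IsFsMonoid P ∧
      Function.Surjective π ∧ ∀ p q, π p = π q ↔ ∃ f ∈ S.1, ∃ g ∈ S.1, p * f = q * g := by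
  obtain ⟨U, ht, P, _, hP, f, hf⟩ := hF t
  let S : Face P := f ⟨t, ht⟩
  let e : (faceCon S).Quotient →* F.stalk t := f.stalkMap ⟨t, ht⟩
  have he : Function.Bijective e := hf.bijective ⟨t, ht⟩
  exact ⟨P, _, S, e.comp (faceCon S).mk', hP, he.2.comp Con.mk'_surjective,
    fun p q => he.1.eq_iff.trans (Con.eq _)⟩

theorem IsFsFan.isFsMonoid_stalk {F : MonoidalSpace.{u}} (hF : IsFsFan F) (t : F) :
    IsFsMonoid (F.stalk t) := by
  obtain ⟨P, _, S, π, hP, hπ, h⟩ := hF.exists_face_quotient t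
  exact hP.of_face_quotient hπ h

theorem IsFsFan.subsingleton_units {F : MonoidalSpace.{u}} (hF : IsFsFan F) (t : F) :
    Subsingleton (F.stalk t)ˣ := by
  obtain ⟨P, _, S, π, -, hπ, h⟩ := hF.exists_face_quotient t
  exact subsingleton_units_of_face_quotient hπ h

/-! ### Strata of log blow-ups along subdivisions -/

namespace LogScheme

theorem exists_stratumChart {X : LogScheme.{u}} (hX : X.IsFs) {F' : MonoidalSpace.{u}}
    (hF : IsFsFan F') {φ : MonoidalSpace.Hom F' X.fan} {x' : F'}
    (hφ : Function.Surjective (gpMap (φ.stalkMap x'))) {x : X.X} (hx : X.IsCharPoint x (φ x')) :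
    ∃ C : StratumChart φ x' x,
      gpRank (X.fan.stalk (φ x')) = gpRank (F'.stalk x') + C.r := by
  have hP := hF.isFsMonoid_stalk x'
  have := hF.subsingleton_units x'
  have := hP.cancel
  have := hP.free_gp
  have hN := hX.isFsMonoid_associates (φ x').1
  have := hN.cancel
  have := hN.fg
  have := hN.free_gp
  have := hX.isCancelMul x
  obtain ⟨r, θ, hr, injective, surjective⟩ := exists_torus_splitting (subdivisionMap φ x') hφ
  obtain ⟨σ, hσ⟩ := exists_rightInverse_of_associated (μ := X.charMap hx.choose)
    (hx.charMap_surjective hX) fun a b => hx.associated_of_charMap_eq hX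
  obtain ⟨c, hc⟩ := exists_unitPart (μ := X.charMap hx.choose) (σ := σ) fun m =>
    hx.associated_of_charMap_eq hX (hσ _)
  exact ⟨⟨hx, r, θ, σ, c, injective, surjective, hσ, hc⟩, hr⟩

theorem height_fan {X : LogScheme.{u}} (hX : X.IsFs) (y : X.fan) :
    height X.fan y = (gpRank (X.fan.stalk y) : ℕ) := by
  have hN := hX.isFsMonoid_associates y.1
  have := hN.cancel
  have := hN.fg
  exact monoidDim_eq_gpRank (N := Associates (X.M.stalk y.1))

theorem vanishesOn_reducedSubscheme {Y : LogScheme.{u}} {F' : MonoidalSpace.{u}}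
    (ρ : MonoidalSpace.Hom Y.sharp F') (x' : F') {S : Scheme.{u}}
    (j : S ⟶ reducedSubscheme Y.X (ρ.toFun ⁻¹' {x'})) :
    VanishesOn ρ x' (j ≫ reducedSubschemeι Y.X (ρ.toFun ⁻¹' {x'})) := by
  intro V f hf
  have app_eq_zero : (reducedSubschemeι Y.X (ρ.toFun ⁻¹' {x'})).app V f = 0 :=
    eq_zero_of_forall_not_isUnit_germ fun t ht hu => by
      have germ_eq :=
        Scheme.Hom.germ_stalkMap_apply (reducedSubschemeι Y.X (ρ.toFun ⁻¹' {x'})) V t ht f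
      exact hf _ ht (reducedSubschemeι_mem t)
        (isUnit_of_map_unit (Scheme.Hom.stalkMap _ t).hom _ (germ_eq ▸ hu))
  rw [Scheme.Hom.comp_app]
  exact (congrArg (j.app _) app_eq_zero).trans (map_zero _)

theorem StratumChart.nonempty_fiber_iso_splitTorus {X : LogScheme.{u}} {F' : MonoidalSpace.{u}}
    {φ : MonoidalSpace.Hom F' X.fan} {x' : F'} {x : X.X} (C : StratumChart φ x' x)
    (hX : X.IsFs) (hF : IsFsFan F') {Y : LogScheme.{u}} {b : Hom Y X}
    {ρ : MonoidalSpace.Hom Y.sharp F'} (hbl : IsLogBlowup φ b ρ) :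
    Nonempty
      (Over.mk ((reducedSubschemeι Y.X (ρ ⁻¹' {x'}) ≫ b.base).fiberToSpecResidueField x) ≅
        splitTorus (X.X.residueField x) C.r) := by
  have := hX.isCancelMul x
  have := hF.subsingleton_units x'
  let ι := reducedSubschemeι Y.X (ρ ⁻¹' {x'})
  refine C.nonempty_iso_splitTorus (hF.isFsMonoid_stalk x') hbl (i := (ι ≫ b.base).fiberι x ≫ ι)
    (by rw [Category.assoc, Scheme.Hom.fiber_fac])
    (fun t => reducedSubschemeι_mem ((ι ≫ b.base).fiberι x t))
    (vanishesOn_reducedSubscheme ρ x' _) fun G sG g _ hg hgz => ?_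
  obtain ⟨l, rfl⟩ := exists_lift_reducedSubscheme
    ((hF.isLocallyClosed_singleton x').preimage ρ.continuous) g hgz
  rw [Category.assoc] at hg
  exact ⟨Limits.pullback.lift l sG hg, Limits.pullback.lift_fst_assoc _ _ hg ι,
    Limits.pullback.lift_snd _ _ _⟩

end LogScheme

end LogGeom

theorem mainTheorem7_general {X : LogGeom.LogScheme.{u}} (hX : X.IsFs)
    {F' : LogGeom.MonoidalSpace.{u}} (hF : LogGeom.IsFsFan F')
    {φ : LogGeom.MonoidalSpace.Hom F' X.fan}
    {Y : LogGeom.LogScheme.{u}} {b : LogGeom.LogScheme.Hom Y X}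
    {ρ : LogGeom.MonoidalSpace.Hom Y.sharp F'} (hY : LogGeom.LogScheme.IsLogBlowup φ b ρ) (x' : F')
    (hφ : Function.Surjective (LogGeom.gpMap (φ.stalkMap x'))) (x : X.X)
    (hx : X.IsCharPoint x (φ x')) :
    IsLocallyClosed (ρ ⁻¹' {x'}) ∧
    ∃ h' h : ℕ, LogGeom.height F' x' = h' ∧ LogGeom.height X.fan (φ x') = h ∧ h' ≤ h ∧
      Nonempty
        (Over.mk ((LogGeom.reducedSubschemeι Y.X (ρ ⁻¹' {x'}) ≫
            b.base).fiberToSpecResidueField x) ≅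
          LogGeom.splitTorus (X.X.residueField x) (h - h')) := by
  obtain ⟨C, hr⟩ := LogGeom.LogScheme.exists_stratumChart hX hF hφ hx
  have := (hF.isFsMonoid_stalk x').cancel
  have := (hF.isFsMonoid_stalk x').fg
  have := hF.subsingleton_units x'
  refine ⟨(hF.isLocallyClosed_singleton x').preimage ρ.continuous, _, _,
    LogGeom.monoidDim_eq_gpRank, LogGeom.LogScheme.height_fan hX _, hr ▸ Nat.le_add_right _ _, ?_⟩
  rw [hr, Nat.add_sub_cancel_left]
  exact C.nonempty_fiber_iso_splitTorus hX hF hY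

theorem mainTheorem7 {R : Type u} [CommRing R] [IsDomain R] [IsDiscreteValuationRing R]
    {𝒳 : Scheme.{u}} (q : 𝒳 ⟶ Spec (CommRingCat.of R)) (hflat : Flat q)
    (hreg : (LogGeom.dagger q).IsLogRegular)
    {F' : LogGeom.MonoidalSpace.{u}}
    (φ : LogGeom.MonoidalSpace.Hom F' (LogGeom.dagger q).fan) (hφ : LogGeom.IsSubdivision φ)
    {Y : LogGeom.LogScheme.{u}} (b : LogGeom.LogScheme.Hom Y (LogGeom.dagger q))
    (ρ : LogGeom.MonoidalSpace.Hom Y.sharp F') (hY : LogGeom.LogScheme.IsLogBlowup φ b ρ)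
    (x' : F') (x : (LogGeom.dagger q).X) (hx : (LogGeom.dagger q).IsCharPoint x (φ x')) :
    IsLocallyClosed (ρ ⁻¹' {x'}) ∧
    ∃ h' h : ℕ, LogGeom.height F' x' = h' ∧
      LogGeom.height (LogGeom.dagger q).fan (φ x') = h ∧ h' ≤ h ∧
      Nonempty
        (Over.mk ((LogGeom.reducedSubschemeι Y.X (ρ ⁻¹' {x'}) ≫
            b.base).fiberToSpecResidueField x) ≅
          LogGeom.splitTorus ((LogGeom.dagger q).X.residueField x) (h - h')) :=
  mainTheorem7_general hreg.isFs hφ.isFsFan hY x' (hφ.gp_surjective x') x hx
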